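/- Conventions. A variety over a field $K$ is a geometrically reduced scheme of finite type over $\operatorname{Spec} K$ (not necessarily irreducible). For a variety $V$ over $K$ and a homomorphism $\sigma\colon K\to K'$ of fields, $\sigma V$ denotes the base change of $V$ along $\sigma$; we identify $\sigma(\tau V)$ with $(\sigma\tau)V$ canonically. A variety over $K$ is quasiprojective if it is isomorphic over $K$ to a locally closed subscheme of some $\mathbb{P}^n_K$. Let $\Omega$ be an algebraically closed field of characteristic zero, let $k$ be a subfield of $\Omega$, and for a field $L\subset\Omega$ let $A(\Omega/L)$ be the group of automorphisms of $\Omega$ fixing the elements of $L$. Let $V$ be a variety over $\Omega$. A descent system on $V$ indexed by $A(\Omega/k)$ is a family $(f_\sigma)_{\sigma\in A(\Omega/k)}$ of isomorphisms $f_\sigma\colon \sigma V\to V$ over $\Omega$ such that $f_{\sigma\tau}=f_\sigma\circ\sigma f_\tau$ for all $\sigma,\tau\in A(\Omega/k)$. It is effective if there are a variety $V_0$ over $k$ and an isomorphism $f\colon V_{0,\Omega}\to V$ over $\Omega$ such that $f_\sigma=f\circ(\sigma f)^{-1}$ for all $\sigma\in A(\Omega/k)$, where $\sigma(V_{0,\Omega})$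 is identified canonically with $V_{0,\Omega}$. The same definitions apply with $k$ replaced by any subfield $L$ of $\Omega$. Theorem 1.1. Assume that $\Omega$ has infinite transcendence degree over $k$, and let $V$ be a quasiprojective variety over $\Omega$. A descent system $(f_\sigma)_{\sigma\in A(\Omega/k)}$ on $V$ is effective if, for some subfield $L$ of $\Omega$ containing $k$ and finitely generated over $k$ as a field, the descent system $(f_\sigma)_{\sigma\in A(\Omega/L)}$ is effective. -/

import Mathlib

open CategoryTheory CategoryTheory.Limits AlgebraicGeometry

universe u

noncomputable section

namespace WeilDescent

/-- The base change `φ X` of a scheme `X` over `Spec A` along a ring homomorphism `φ : A →+* B`: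
the scheme `X ×_{Spec A} Spec B` over `Spec B`. For an automorphism `σ` of a field `Ω` and a
variety `V` over `Ω` this is the conjugate variety `σV`. -/
def baseChange {A B : Type u} [CommRing A] [CommRing B] (φ : A →+* B)
    (X : Over (Spec (CommRingCat.of A))) : Over (Spec (CommRingCat.of B)) :=
  Over.mk (pullback.snd X.hom (Spec.map (CommRingCat.ofHom φ)))

/-- The projection `φ X ⟶ X` of the base change to the original scheme. -/
def baseChangeProj {A B : Type u} [CommRing A] [CommRing B] (φ : A →+* B)
    (X : Over (Spec (CommRingCat.of A))) : (baseChange φ X).left ⟶ X.left :=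
  pullback.fst X.hom (Spec.map (CommRingCat.ofHom φ))

theorem baseChange_isPullback {A B : Type u} [CommRing A] [CommRing B] (φ : A →+* B)
    (X : Over (Spec (CommRingCat.of A))) :
    IsPullback (baseChangeProj φ X) (baseChange φ X).hom X.hom
      (Spec.map (CommRingCat.ofHom φ)) :=
  IsPullback.of_hasPullback _ _

theorem baseChange_hom_ext {A B : Type u} [CommRing A] [CommRing B] (φ : A →+* B)
    (X : Over (Spec (CommRingCat.of A))) {T : Over (Spec (CommRingCat.of B))}
    {f g : T ⟶ baseChange φ X}
    (h : f.left ≫ baseChangeProj φ X = g.left ≫ baseChangeProj φ X) : f = g :=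
  Over.OverMorphism.ext ((baseChange_isPullback φ X).hom_ext h (by rw [Over.w f, Over.w g]))

/-- The morphism into a base change `φ X` determined by its component in `X`. -/
def toBaseChange {A B : Type u} [CommRing A] [CommRing B] (φ : A →+* B)
    (X : Over (Spec (CommRingCat.of A))) (T : Over (Spec (CommRingCat.of B)))
    (p : T.left ⟶ X.left)
    (hp : p ≫ X.hom = T.hom ≫ Spec.map (CommRingCat.ofHom φ)) : T ⟶ baseChange φ X :=
  Over.homMk ((baseChange_isPullback φ X).lift p T.hom hp)
    ((baseChange_isPullback φ X).lift_snd p T.hom hp)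

theorem toBaseChange_proj {A B : Type u} [CommRing A] [CommRing B] (φ : A →+* B)
    (X : Over (Spec (CommRingCat.of A))) (T : Over (Spec (CommRingCat.of B)))
    (p : T.left ⟶ X.left) (hp : p ≫ X.hom = T.hom ≫ Spec.map (CommRingCat.ofHom φ)) :
    (toBaseChange φ X T p hp).left ≫ baseChangeProj φ X = p :=
  (baseChange_isPullback φ X).lift_fst p T.hom hp

/-- The base change `φ f : φ X ⟶ φ Y` of a morphism `f : X ⟶ Y`. -/
def baseChangeMap {A B : Type u} [CommRing A] [CommRing B] (φ : A →+* B)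
    {X Y : Over (Spec (CommRingCat.of A))} (f : X ⟶ Y) : baseChange φ X ⟶ baseChange φ Y :=
  toBaseChange φ Y (baseChange φ X) (baseChangeProj φ X ≫ f.left) (by
    rw [Category.assoc, Over.w f]
    exact (baseChange_isPullback φ X).w)

theorem baseChangeMap_proj {A B : Type u} [CommRing A] [CommRing B] (φ : A →+* B)
    {X Y : Over (Spec (CommRingCat.of A))} (f : X ⟶ Y) :
    (baseChangeMap φ f).left ≫ baseChangeProj φ Y = baseChangeProj φ X ≫ f.left :=
  toBaseChange_proj _ _ _ _ _

/-- The base change `φ e : φ X ≅ φ Y` of an isomorphism `e : X ≅ Y`. -/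
def baseChangeIso {A B : Type u} [CommRing A] [CommRing B] (φ : A →+* B)
    {X Y : Over (Spec (CommRingCat.of A))} (e : X ≅ Y) : baseChange φ X ≅ baseChange φ Y where
  hom := baseChangeMap φ e.hom
  inv := baseChangeMap φ e.inv
  hom_inv_id := baseChange_hom_ext φ X (by
    rw [Over.comp_left, Category.assoc, baseChangeMap_proj, ← Category.assoc,
      baseChangeMap_proj, Category.assoc, ← Over.comp_left, e.hom_inv_id, Over.id_left,
      Over.id_left, Category.comp_id, Category.id_comp])
  inv_hom_id := baseChange_hom_ext φ Y (by
    rw [Over.comp_left, Category.assoc, baseChangeMap_proj, ← Category.assoc,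
      baseChangeMap_proj, Category.assoc, ← Over.comp_left, e.inv_hom_id, Over.id_left,
      Over.id_left, Category.comp_id, Category.id_comp])

/-- The canonical identification `ψ(φ X) = (ψ ∘ φ) X`, that is, the isomorphism over `Spec C`
compatible with the projections to `X`. -/
def baseChangeComp {A B C : Type u} [CommRing A] [CommRing B] [CommRing C]
    (φ : A →+* B) (ψ : B →+* C) (χ : A →+* C) (h : ψ.comp φ = χ)
    (X : Over (Spec (CommRingCat.of A))) :
    baseChange ψ (baseChange φ X) ≅ baseChange χ X where
  hom := toBaseChange χ X _ (baseChangeProj ψ (baseChange φ X) ≫ baseChangeProj φ X) (by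
    subst h
    rw [CommRingCat.ofHom_comp, Spec.map_comp, Category.assoc, (baseChange_isPullback φ X).w,
      ← Category.assoc, (baseChange_isPullback ψ (baseChange φ X)).w, Category.assoc])
  inv := toBaseChange ψ (baseChange φ X) _
    (toBaseChange φ X (Over.mk ((baseChange χ X).hom ≫ Spec.map (CommRingCat.ofHom ψ)))
      (baseChangeProj χ X) (by
        subst h
        rw [(baseChange_isPullback (ψ.comp φ) X).w, CommRingCat.ofHom_comp, Spec.map_comp]
        exact (Category.assoc _ _ _).symm)).left
    (Over.w (toBaseChange φ X _ _ _))
  hom_inv_id := by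
    subst h
    apply baseChange_hom_ext
    rw [Over.comp_left, Category.assoc, toBaseChange_proj, Over.id_left, Category.id_comp]
    apply (baseChange_isPullback φ X).hom_ext
    · rw [Category.assoc, toBaseChange_proj, toBaseChange_proj]
    · exact (Category.assoc _ _ _).trans ((congrArg _ (Over.w _)).trans
        (((Category.assoc _ _ _).symm.trans
          (congrArg (· ≫ Spec.map (CommRingCat.ofHom ψ)) (Over.w (toBaseChange _ _ _ _ _)))).trans
          (baseChange_isPullback ψ (baseChange φ X)).w.symm))
  inv_hom_id := by
    subst h
    apply baseChange_hom_ext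
    rw [Over.comp_left, Category.assoc, toBaseChange_proj, ← Category.assoc, toBaseChange_proj,
      toBaseChange_proj, Over.id_left, Category.id_comp]

/-- A variety over a field `K`: a geometrically reduced scheme of finite type over `Spec K`,
not necessarily irreducible. -/
structure IsVariety {K : Type u} [Field K] (X : Over (Spec (CommRingCat.of K))) : Prop where
  geometricallyReduced : GeometricallyReduced X.hom
  locallyOfFiniteType : LocallyOfFiniteType X.hom
  quasiCompact : QuasiCompact X.hom

/-- Projective `n`-space over a field `K`: `Proj K[x₀, …, xₙ]` over `Spec K`. -/
def projectiveSpace (K : Type u) [Field K] (n : ℕ) : Over (Spec (CommRingCat.of K)) :=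
  letI : GradedAlgebra (MvPolynomial.homogeneousSubmodule (Fin (n + 1)) K) :=
    MvPolynomial.gradedAlgebra
  Over.mk (Proj.toSpecZero (MvPolynomial.homogeneousSubmodule (Fin (n + 1)) K) ≫
    Spec.map (CommRingCat.ofHom
      (algebraMap K (MvPolynomial.homogeneousSubmodule (Fin (n + 1)) K 0))))

/-- `X` is quasiprojective over `K`: it is isomorphic over `K` to a locally closed subscheme of
some projective space over `K`. -/
def IsQuasiprojective {K : Type u} [Field K] (X : Over (Spec (CommRingCat.of K))) : Prop :=
  ∃ (n : ℕ) (i : X ⟶ projectiveSpace K n), IsImmersion i.left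

theorem comp_eq_mul {k Ω : Type u} [Field k] [Field Ω] [Algebra k Ω] (σ τ : Ω ≃ₐ[k] Ω) :
    (σ : Ω →+* Ω).comp (τ : Ω →+* Ω) = ((σ * τ : Ω ≃ₐ[k] Ω) : Ω →+* Ω) :=
  rfl

/-- A descent system on `V` indexed by the group `Aut(Ω/k)`: isomorphisms `f_σ : σV ≅ V` of
schemes over `Ω` such that `f_{στ} = f_σ ∘ σ f_τ`, where `σ(τV)` is identified with `(στ)V`. -/
structure DescentSystem (k : Type u) {Ω : Type u} [Field k] [Field Ω] [Algebra k Ω]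
    (V : Over (Spec (CommRingCat.of Ω))) where
  iso : ∀ σ : Ω ≃ₐ[k] Ω, baseChange (σ : Ω →+* Ω) V ≅ V
  iso_mul : ∀ σ τ : Ω ≃ₐ[k] Ω,
    baseChangeComp (τ : Ω →+* Ω) (σ : Ω →+* Ω) ((σ * τ : Ω ≃ₐ[k] Ω) : Ω →+* Ω)
        (comp_eq_mul σ τ) V ≪≫ iso (σ * τ) =
    baseChangeIso (σ : Ω →+* Ω) (iso τ) ≪≫ iso σ

/-- A model of `V` over `k`: a variety `V₀` over `k` with an isomorphism `f : V₀_Ω ≅ V`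
over `Ω`. -/
structure Model (k : Type u) {Ω : Type u} [Field k] [Field Ω] [Algebra k Ω]
    (V : Over (Spec (CommRingCat.of Ω))) where
  obj : Over (Spec (CommRingCat.of k))
  isVariety : IsVariety obj
  iso : baseChange (algebraMap k Ω) obj ≅ V

/-- The canonical identification `σ(X_Ω) = X_Ω` for `X` over `k` and `σ ∈ Aut(Ω/k)`. -/
def conjBaseChange {k Ω : Type u} [Field k] [Field Ω] [Algebra k Ω] (σ : Ω ≃ₐ[k] Ω)
    (X : Over (Spec (CommRingCat.of k))) :
    baseChange (σ : Ω →+* Ω) (baseChange (algebraMap k Ω) X) ≅ baseChange (algebraMap k Ω) X :=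
  baseChangeComp (algebraMap k Ω) (σ : Ω →+* Ω) (algebraMap k Ω)
    (RingHom.ext fun x => σ.commutes x) X

/-- The model `(V₀, f)` splits `(f_σ)`: `f_σ = f ∘ (σ f)⁻¹` for all `σ ∈ Aut(Ω/k)`, where
`σ(V₀_Ω)` is identified with `V₀_Ω`. -/
def Model.Splits {k Ω : Type u} [Field k] [Field Ω] [Algebra k Ω]
    {V : Over (Spec (CommRingCat.of Ω))} (M : Model k V) (D : DescentSystem k V) : Prop :=
  ∀ σ : Ω ≃ₐ[k] Ω,
    D.iso σ =
      (baseChangeIso (σ : Ω →+* Ω) M.iso).symm ≪≫ conjBaseChange σ M.obj ≪≫ M.iso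

/-- A descent system is effective if some model over `k` splits it. -/
def DescentSystem.IsEffective {k Ω : Type u} [Field k] [Field Ω] [Algebra k Ω]
    {V : Over (Spec (CommRingCat.of Ω))} (D : DescentSystem k V) : Prop :=
  ∃ M : Model k V, M.Splits D

/-- The restriction of a descent system to the subgroup `Aut(Ω/L)` of `Aut(Ω/k)`. -/
def DescentSystem.restrict {k Ω : Type u} [Field k] [Field Ω] [Algebra k Ω]
    {V : Over (Spec (CommRingCat.of Ω))} (D : DescentSystem k V) (L : IntermediateField k Ω) :
    DescentSystem L V where
  iso σ := D.iso (σ.restrictScalars k)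
  iso_mul σ τ := D.iso_mul (σ.restrictScalars k) (τ.restrictScalars k)

end WeilDescent

end

/-!
A descent system `(f_σ)` on `V` is the same as an action of `Aut(Ω/k)` on the scheme `V` by
automorphisms `a_σ` lying over the automorphisms `Spec σ` of `Spec Ω` (`DescentSystem.action`), and
a model of `V` over `k` splits the system if and only if the projection from `V` to the model is
invariant (`Model.splits_iff`). The system is effective if and only if the action *descends*: `V` is
the base change of a scheme over `k` along an invariant morphism. The fixed field of `Aut(Ω/k)` is
`k`, so by Galois descent for vector spaces an invariant morphism on `V` factors through such a
model, and a stable open subset comes from an open subset of it (`exists_comp_eq_of_invariant`,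
`exists_preimage_eq_of_stable`).

Suppose that the action descends to the finitely generated extension `L` of `k`. The elements of `L`
that are algebraic over `k` form a finite extension `κ` of `k`, over which `L` is regular. The first
half of the proof descends the action to a finite extension of `κ`. The model over `L` extends to a
family `X ⟶ Spec R` with `R ⊂ L` of finite type over `κ`, whose fibre at the generic point
`ι : R ⟶ Ω` is `V`. For an automorphism `ρ` that moves `ι` into general position, `a_ρ` identifies
the fibres at `ι` and `ρι`, and spreads out to a *transport* between the fibres of the family at
general pairs of points (`exists_transport`). Since all pairs of points in general position are
conjugate under `Aut(Ω/κ)`, which is where the infinite transcendence degree of `Ω` enters, the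
transports satisfy the cocycle relations, generically and hence on a nonempty open set
(`exists_rel_symm`, `exists_rel_trans`). By the Nullstellensatz this open set meets a fibre at a
point `s` with values in a finite extension `F` of `κ`; transport identifies `V` with the fibre at
`s`, which is defined over `F`, and the cocycle relation shows that this identification is invariant
under the automorphisms in general position over `F`. These generate all of `Aut(Ω/F)`
(`exists_finite_descends`).

The second half passes from the finite extension `F` to `k`. For affine `V` this is Galois descent
with traces (`SemilinearAction.descends_of_isAffine`). In general `V` is covered by stable affine
open subsets: the orbit of the fibre over a closed point of the model over `F` is a finite set,
contained in an affine open subset because `V` is quasiprojective; this open subset specializes to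
one defined over a finite extension that still contains the orbit, and the intersection of its
finitely many translates is stable and affine, since `V` is separated (`exists_stable_affineOpen`).
The models of the members of the cover glue (`SemilinearAction.descends_of_finite`). Finally, the
model is a variety, since being of finite type and geometrically reduced descends along the
faithfully flat morphism from `V`.
-/


noncomputable section

namespace WeilDescent

/-! ### Galois descent for vector spaces -/

section LinearAlgebra

open TensorProduct

variable {F K M : Type*} [Field F] [Field K] [Algebra F K] [AddCommGroup M] [Module F M]

theorem repr_rTensor {ι : Type*} (b : Module.Basis ι F M) (σ : K ≃ₐ[F] K) (x : K ⊗[F] M) (i : ι) :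
    (b.baseChange K).repr (σ.toLinearMap.rTensor M x) i = σ ((b.baseChange K).repr x i) := by
  induction x with
  | zero => simp
  | tmul c m => simp
  | add x y hx hy => simp only [map_add, Finsupp.add_apply, hx, hy]

/-- If `F` is the fixed field of a set `s` of automorphisms of `K`, the `s`-invariant vectors of
`K ⊗ M` are those of `M`. -/
theorem exists_one_tmul_eq_of_invariant (s : Set (K ≃ₐ[F] K))
    (hs : ∀ x : K, (∀ σ ∈ s, σ x = x) → x ∈ Set.range (algebraMap F K)) (x : K ⊗[F] M)
    (hx : ∀ σ ∈ s, σ.toLinearMap.rTensor M x = x) : ∃ m : M, (1 : K) ⊗ₜ[F] m = x := by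
  let b := Module.Basis.ofVectorSpace F M
  have h : ∀ i, ∃ c : F, algebraMap F K c = (b.baseChange K).repr x i := fun i ↦
    hs _ fun σ hσ ↦ by rw [← repr_rTensor, hx σ hσ]
  choose c hc using h
  have hsupp : ∀ i, c i ≠ 0 → i ∈ ((b.baseChange K).repr x).support := fun i hi ↦ by
    rw [Finsupp.mem_support_iff, ← hc]
    simpa using hi
  refine ⟨b.repr.symm (Finsupp.onFinset _ c hsupp), (b.baseChange K).repr.injective ?_⟩
  ext i
  rw [← hc, Module.Basis.baseChange_repr_tmul, LinearEquiv.apply_symm_apply,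
    Finsupp.onFinset_apply, Algebra.algebraMap_eq_smul_one]

/-- Artin's lemma: if `F` is the fixed field of `s`, an `s`-stable subspace of `K ⊗ M` that contains
no nonzero vector of `M` vanishes. The proof looks at a nonzero vector of minimal support. -/
theorem eq_bot_of_stable (s : Set (K ≃ₐ[F] K))
    (hs : ∀ x : K, (∀ σ ∈ s, σ x = x) → x ∈ Set.range (algebraMap F K))
    (N : Submodule K (K ⊗[F] M)) (hN : ∀ σ ∈ s, ∀ n ∈ N, σ.toLinearMap.rTensor M n ∈ N)
    (h0 : ∀ m : M, (1 : K) ⊗ₜ[F] m ∈ N → m = 0) : N = ⊥ := by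
  classical
  let b := (Module.Basis.ofVectorSpace F M)
  by_contra hne
  obtain ⟨n₀, hn₀, hn₀0⟩ := Submodule.exists_mem_ne_zero_of_ne_bot hne
  let P : ℕ → Prop := fun d ↦ ∃ n ∈ N, n ≠ 0 ∧ ((b.baseChange K).repr n).support.card = d
  have hP : ∃ d, P d := ⟨_, n₀, hn₀, hn₀0, rfl⟩
  obtain ⟨n, hn, hn0, hcard⟩ := Nat.find_spec hP
  obtain ⟨i, hi⟩ : ∃ i, (b.baseChange K).repr n i ≠ 0 := by
    by_contra! h
    exact hn0 ((b.baseChange K).repr.injective (by ext i; simpa using h i))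
  set c := (b.baseChange K).repr n i with hc
  have hci : (b.baseChange K).repr (c⁻¹ • n) i = 1 := by
    simp [← hc, inv_mul_cancel₀ hi]
  have hn' : c⁻¹ • n ∈ N := N.smul_mem _ hn
  have hinv : ∀ σ ∈ s, σ.toLinearMap.rTensor M (c⁻¹ • n) = c⁻¹ • n := by
    intro σ hσ
    by_contra hne'
    refine Nat.find_min hP (m := ((b.baseChange K).repr
      (σ.toLinearMap.rTensor M (c⁻¹ • n) - c⁻¹ • n)).support.card) ?_
      ⟨_, N.sub_mem (hN σ hσ _ hn') hn', sub_ne_zero.mpr hne', rfl⟩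
    rw [← hcard]
    apply Finset.card_lt_card
    rw [Finset.ssubset_iff_of_subset]
    · refine ⟨i, by simpa using hi, ?_⟩
      rw [Finsupp.notMem_support_iff, map_sub, Finsupp.sub_apply, repr_rTensor, hci, map_one,
        sub_self]
    · intro j hj
      rw [Finsupp.mem_support_iff] at hj ⊢
      intro h
      apply hj
      rw [map_sub, Finsupp.sub_apply, repr_rTensor, map_smul, Finsupp.smul_apply, h, smul_zero,
        map_zero, sub_self]
  obtain ⟨m, hm⟩ := exists_one_tmul_eq_of_invariant s hs _ hinv
  have : m = 0 := h0 m (hm ▸ hn')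
  rw [this, tmul_zero] at hm
  rw [← hm] at hci
  simp at hci

/-- If `F` is the fixed field of `s`, every `s`-stable subspace of `K ⊗ M` is spanned by its
vectors in `M`. -/
theorem mem_span_of_stable (s : Set (K ≃ₐ[F] K))
    (hs : ∀ x : K, (∀ σ ∈ s, σ x = x) → x ∈ Set.range (algebraMap F K))
    (N : Submodule K (K ⊗[F] M)) (hN : ∀ σ ∈ s, ∀ n ∈ N, σ.toLinearMap.rTensor M n ∈ N)
    {n : K ⊗[F] M} (hn : n ∈ N) :
    n ∈ Submodule.span K {x | x ∈ N ∧ ∃ m : M, (1 : K) ⊗ₜ[F] m = x} := by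
  let M₀ : Submodule F M := (N.restrictScalars F).comap (TensorProduct.mk F K M 1)
  have hker : LinearMap.ker (M₀.mkQ.baseChange K) ≤
      Submodule.span K {x | x ∈ N ∧ ∃ m : M, (1 : K) ⊗ₜ[F] m = x} := by
    intro x hx
    have hex : Function.Exact (M₀.subtype.lTensor K) (M₀.mkQ.lTensor K) :=
      lTensor_exact K (by rw [LinearMap.exact_iff]; simp) M₀.mkQ_surjective
    obtain ⟨y, rfl⟩ := (hex x).mp hx
    induction y with
    | zero => simp
    | tmul c m =>
      rw [LinearMap.lTensor_tmul, ← mul_one c, ← smul_eq_mul, ← smul_tmul']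
      exact Submodule.smul_mem _ _ (Submodule.subset_span ⟨m.2, _, rfl⟩)
    | add y z hy hz =>
      rw [map_add]
      have h (w) : M₀.mkQ.baseChange K (M₀.subtype.lTensor K w) = 0 := (hex _).mpr ⟨w, rfl⟩
      exact Submodule.add_mem _ (hy (h y)) (hz (h z))
  have hspan : Submodule.span K {x | x ∈ N ∧ ∃ m : M, (1 : K) ⊗ₜ[F] m = x} ≤ N :=
    Submodule.span_le.mpr fun x hx ↦ hx.1
  have hcomm (σ : K ≃ₐ[F] K) (x : K ⊗[F] M) : σ.toLinearMap.rTensor (M ⧸ M₀)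
      (M₀.mkQ.baseChange K x) = M₀.mkQ.baseChange K (σ.toLinearMap.rTensor M x) := by
    induction x with
    | zero => simp
    | tmul c m => simp
    | add x y hx hy => simp only [map_add, hx, hy]
  have key : N.map (M₀.mkQ.baseChange K) = ⊥ := by
    apply eq_bot_of_stable s hs
    · rintro σ hσ _ ⟨x, hx, rfl⟩
      rw [hcomm]
      exact ⟨_, hN σ hσ x hx, rfl⟩
    · intro m hm
      obtain ⟨m, rfl⟩ := M₀.mkQ_surjective m
      obtain ⟨x, hx, hxm⟩ := hm
      have hd : (1 : K) ⊗ₜ[F] m - x ∈ LinearMap.ker (M₀.mkQ.baseChange K) := by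
        rw [LinearMap.mem_ker, map_sub, hxm, LinearMap.baseChange_tmul, sub_self]
      have hmem : (1 : K) ⊗ₜ[F] m ∈ N := by
        have := N.add_mem (hspan (hker hd)) hx
        rwa [sub_add_cancel] at this
      rw [Submodule.mkQ_apply, Submodule.Quotient.mk_eq_zero]
      exact hmem
  apply hker
  rw [LinearMap.mem_ker]
  have : M₀.mkQ.baseChange K n ∈ N.map (M₀.mkQ.baseChange K) := ⟨n, hn, rfl⟩
  rwa [key, Submodule.mem_bot] at this

end LinearAlgebra

section Pushout

open TensorProduct

variable {F K A B : Type*} [Field F] [Field K] [Algebra F K] [CommRing A] [CommRing B]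
  [Algebra F A] [Algebra A B] [Algebra K B] [Algebra F B] [IsScalarTower F A B]
  [IsScalarTower F K B] [Algebra.IsPushout F K A B]

theorem equiv_rTensor_comm (σ : K ≃ₐ[F] K) (act : B →+* B)
    (hK : ∀ c, act (algebraMap K B c) = algebraMap K B (σ c))
    (hA : ∀ a, act (algebraMap A B a) = algebraMap A B a) (x : K ⊗[F] A) :
    Algebra.IsPushout.equiv F K A B (σ.toLinearMap.rTensor A x) =
      act (Algebra.IsPushout.equiv F K A B x) := by
  induction x with
  | zero => simp
  | tmul c a =>
    simp only [LinearMap.rTensor_tmul, AlgEquiv.toLinearMap_apply, Algebra.IsPushout.equiv_tmul,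
      map_mul, hK, hA]
  | add x y hx hy => simp only [map_add, hx, hy]

/-- The invariants of the base change of an `F`-algebra `A` to `K` are `A`. -/
theorem exists_algebraMap_eq_of_invariant (s : Set (K ≃ₐ[F] K))
    (hs : ∀ x : K, (∀ σ ∈ s, σ x = x) → x ∈ Set.range (algebraMap F K))
    (act : (K ≃ₐ[F] K) → B →+* B)
    (hK : ∀ σ ∈ s, ∀ c, act σ (algebraMap K B c) = algebraMap K B (σ c))
    (hA : ∀ σ ∈ s, ∀ a, act σ (algebraMap A B a) = algebraMap A B a) (b : B)
    (hb : ∀ σ ∈ s, act σ b = b) : ∃ a : A, algebraMap A B a = b := by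
  obtain ⟨a, ha⟩ := exists_one_tmul_eq_of_invariant s hs
    ((Algebra.IsPushout.equiv F K A B).symm b) fun σ hσ ↦
      (Algebra.IsPushout.equiv F K A B).injective (by
        rw [equiv_rTensor_comm σ (act σ) (hK σ hσ) (hA σ hσ), AlgEquiv.apply_symm_apply, hb σ hσ])
  refine ⟨a, ?_⟩
  rw [← (Algebra.IsPushout.equiv F K A B).apply_symm_apply b, ← ha, Algebra.IsPushout.equiv_tmul,
    map_one, one_mul]

/-- A stable subspace of the base change of an `F`-algebra `A` to `K` is spanned by elements
of `A`. -/
theorem mem_span_algebraMap_of_stable (s : Set (K ≃ₐ[F] K))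
    (hs : ∀ x : K, (∀ σ ∈ s, σ x = x) → x ∈ Set.range (algebraMap F K))
    (act : (K ≃ₐ[F] K) → B →+* B)
    (hK : ∀ σ ∈ s, ∀ c, act σ (algebraMap K B c) = algebraMap K B (σ c))
    (hA : ∀ σ ∈ s, ∀ a, act σ (algebraMap A B a) = algebraMap A B a) (N : Submodule K B)
    (hN : ∀ σ ∈ s, ∀ n ∈ N, act σ n ∈ N) {n : B} (hn : n ∈ N) :
    n ∈ Submodule.span K {x | x ∈ N ∧ ∃ a : A, algebraMap A B a = x} := by
  let e := (Algebra.IsPushout.equiv F K A B).toLinearEquiv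
  have h := mem_span_of_stable s hs (N.comap e.toLinearMap) (fun σ hσ x hx ↦ by
    change Algebra.IsPushout.equiv F K A B _ ∈ N
    rw [equiv_rTensor_comm σ (act σ) (hK σ hσ) (hA σ hσ)]
    exact hN σ hσ _ hx) (n := e.symm n) (by simpa using hn)
  have h' := Submodule.mem_map_of_mem (f := e.toLinearMap) h
  rw [Submodule.map_span] at h'
  simp only [LinearEquiv.coe_coe, LinearEquiv.apply_symm_apply] at h'
  refine Submodule.span_mono ?_ h'
  rintro _ ⟨x, ⟨hx, a, rfl⟩, rfl⟩
  refine ⟨hx, a, ?_⟩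
  refine Eq.trans ?_ (Algebra.IsPushout.equiv_tmul F K A B 1 a).symm
  rw [map_one, one_mul]

end Pushout

/-! ### Stable opens and invariant morphisms -/

section Rings

variable {F K : Type u} [Field F] [Field K] [Algebra F K] {A B : CommRingCat.{u}}
  {α : CommRingCat.of F ⟶ A} {π : A ⟶ B} {β : CommRingCat.of K ⟶ B}

theorem injective_of_isPushout
    (h : IsPushout α (CommRingCat.ofHom (algebraMap F K)) π β) : Function.Injective π := by
  algebraize [α.hom, π.hom, β.hom, π.hom.comp α.hom]
  have : IsScalarTower F K B := .of_algebraMap_eq' congr(($(h.w)).hom)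
  have : Algebra.IsPushout F A K B := CommRingCat.isPushout_iff_isPushout.mp h
  have : Algebra.IsPushout F K A B := this.symm
  intro x y hxy
  have h1 := Algebra.TensorProduct.includeRight_injective (R := F) (A := K) (B := A)
    (FaithfulSMul.algebraMap_injective F K)
  refine h1 ((Algebra.IsPushout.equiv F K A B).injective ?_)
  have h2 (x : A) : Algebra.IsPushout.equiv F K A B (1 ⊗ₜ x) = π x :=
    (Algebra.IsPushout.equiv_tmul F K A B 1 x).trans (by rw [map_one, one_mul]; rfl)
  rw [Algebra.TensorProduct.includeRight_apply, Algebra.TensorProduct.includeRight_apply, h2, h2]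
  exact hxy

/-- The invariants of a base change `A ⊗ K` are the elements of `A`, in terms of a pushout square. -/
theorem exists_eq_of_invariant_of_isPushout
    (h : IsPushout α (CommRingCat.ofHom (algebraMap F K)) π β)
    (hfix : ∀ x : K, (∀ σ : K ≃ₐ[F] K, σ x = x) → x ∈ Set.range (algebraMap F K))
    (act : (K ≃ₐ[F] K) → B →+* B) (hβ : ∀ σ c, act σ (β c) = β (σ c))
    (hπ : ∀ σ a, act σ (π a) = π a) (b : B) (hb : ∀ σ, act σ b = b) : ∃ a, π a = b := by
  algebraize [α.hom, π.hom, β.hom, π.hom.comp α.hom]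
  have : IsScalarTower F K B := .of_algebraMap_eq' congr(($(h.w)).hom)
  have : Algebra.IsPushout F A K B := CommRingCat.isPushout_iff_isPushout.mp h
  have : Algebra.IsPushout F K A B := this.symm
  exact exists_algebraMap_eq_of_invariant (F := F) (K := K) (A := A) (B := B) Set.univ
    (fun x hx ↦ hfix x fun σ ↦ hx σ trivial) act (fun σ _ ↦ hβ σ) (fun σ _ ↦ hπ σ) b
    fun σ _ ↦ hb σ

/-- An induction principle for stable subspaces of a base change `A ⊗ K`: they are spanned by
elements of `A`. -/
theorem mem_of_stable_of_isPushout
    (h : IsPushout α (CommRingCat.ofHom (algebraMap F K)) π β)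
    (hfix : ∀ x : K, (∀ σ : K ≃ₐ[F] K, σ x = x) → x ∈ Set.range (algebraMap F K))
    (act : (K ≃ₐ[F] K) → B →+* B) (hβ : ∀ σ c, act σ (β c) = β (σ c))
    (hπ : ∀ σ a, act σ (π a) = π a)
    (N N' : AddSubmonoid B) (hN : ∀ c, ∀ b ∈ N, β c * b ∈ N) (hN' : ∀ c, ∀ b ∈ N', β c * b ∈ N')
    (hstab : ∀ σ, ∀ b ∈ N, act σ b ∈ N) (hle : ∀ a, π a ∈ N → π a ∈ N') : N ≤ N' := by
  algebraize [α.hom, π.hom, β.hom, π.hom.comp α.hom]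
  have : IsScalarTower F K B := .of_algebraMap_eq' congr(($(h.w)).hom)
  have : Algebra.IsPushout F A K B := CommRingCat.isPushout_iff_isPushout.mp h
  have : Algebra.IsPushout F K A B := this.symm
  intro b hb
  have key := mem_span_algebraMap_of_stable (F := F) (K := K) (A := A) (B := B) Set.univ
    (fun x hx ↦ hfix x fun σ ↦ hx σ trivial) act (fun σ _ ↦ hβ σ) (fun σ _ ↦ hπ σ)
    { toAddSubmonoid := N
      smul_mem' := fun c b hb ↦ by
        rw [Algebra.smul_def]
        exact hN c b hb } (fun σ _ n hn ↦ hstab σ n hn) (n := b) hb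
  refine (Submodule.span_le (p := { toAddSubmonoid := N'
                                    smul_mem' := fun c b hb ↦ by
                                      rw [Algebra.smul_def]
                                      exact hN' c b hb })).mpr ?_ key
  rintro _ ⟨hx, a, rfl⟩
  exact hle a hx

end Rings

theorem le_preimage_top {X Y : Scheme.{u}} (f : X ⟶ Y) (U : X.Opens) : U ≤ f ⁻¹ᵁ ⊤ :=
  le_top

/-- The ring homomorphism `R ⟶ Γ(X, U)` given by a structure morphism `X ⟶ Spec R`. -/
def scalars {R : CommRingCat.{u}} {X : Scheme.{u}} (x : X ⟶ Spec R) (U : X.Opens) :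
    R ⟶ Γ(X, U) :=
  (Scheme.ΓSpecIso R).inv ≫ x.appLE ⊤ U (le_preimage_top x U)

/-- Flat base change for sections over a quasi-compact and quasi-separated open subset. -/
theorem isPushout_sections {R S : CommRingCat.{u}} {φ : R ⟶ S} {V X : Scheme.{u}} {q : V ⟶ X}
    {v : V ⟶ Spec S} {x : X ⟶ Spec R} [Flat (Spec.map φ)] (hq : IsPullback q v x (Spec.map φ))
    {O : X.Opens} (hO : IsCompact (O : Set X)) (hO' : IsQuasiSeparated (O : Set X)) :
    IsPushout (scalars x O) φ (q.app O) (scalars v (q ⁻¹ᵁ O)) := by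
  have h := (isIso_pushoutSection_iff hq (US := ⊤) (UT := ⊤) (UX := O)
    (le_preimage_top _ _) (le_preimage_top _ _)
    (UY := q ⁻¹ᵁ O) (by simp)).mp
      (isIso_pushoutSection_of_isQuasiSeparated_of_flat_right hq _ _ _ (isAffineOpen_top _)
        (isAffineOpen_top _) hO hO')
  refine h.of_iso (Scheme.ΓSpecIso R) (Iso.refl _) (Scheme.ΓSpecIso S) (Iso.refl _) ?_ ?_ ?_ ?_
  · simp [scalars]
  · rw [← Scheme.ΓSpecIso_naturality, Scheme.Hom.appTop, Scheme.Hom.app_eq_appLE]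
    rfl
  · simp [Scheme.Hom.app_eq_appLE]
  · simp [scalars]

/-- The morphism `Spec Ω ⟶ Spec F` for an extension `Ω` of `F`. -/
abbrev baseMap (F Ω : Type u) [CommRing F] [CommRing Ω] [Algebra F Ω] :
    Spec (CommRingCat.of Ω) ⟶ Spec (CommRingCat.of F) :=
  Spec.map (CommRingCat.ofHom (algebraMap F Ω))

/-- The automorphism of `Spec Ω` induced by an automorphism of `Ω`. -/
abbrev specAut {F Ω : Type u} [CommRing F] [CommRing Ω] [Algebra F Ω] (σ : Ω ≃ₐ[F] Ω) :
    Spec (CommRingCat.of Ω) ⟶ Spec (CommRingCat.of Ω) :=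
  Spec.map (CommRingCat.ofHom (σ : Ω →+* Ω))

instance {F Ω : Type u} [Field F] [CommRing Ω] [Nontrivial Ω] [Algebra F Ω] :
    Surjective (baseMap F Ω) := by
  rw [surjective_iff]
  exact PrimeSpectrum.comap_surjective_of_faithfullyFlat

instance {F Ω : Type u} [Field F] [CommRing Ω] [Algebra F Ω] : Flat (baseMap F Ω) := by
  rw [HasRingHomProperty.Spec_iff (P := @Flat)]
  exact RingHom.flat_algebraMap_iff.mpr inferInstance

section Geometry

variable {F Ω : Type u} [Field F] [Field Ω] [Algebra F Ω] {V X : Scheme.{u}} {q : V ⟶ X}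
    {v : V ⟶ Spec (CommRingCat.of Ω)} {x : X ⟶ Spec (CommRingCat.of F)}

theorem flat_of_isPullback (hq : IsPullback q v x (baseMap F Ω)) : Flat q :=
  MorphismProperty.of_isPullback hq.flip inferInstance

theorem surjective_of_isPullback (hq : IsPullback q v x (baseMap F Ω)) : Surjective q :=
  MorphismProperty.of_isPullback hq.flip inferInstance

theorem isAffineHom_of_isPullback (hq : IsPullback q v x (baseMap F Ω)) : IsAffineHom q :=
  MorphismProperty.of_isPullback hq.flip inferInstance

theorem appLE_spec_comm {a : V ⟶ V} {σ : Ω ≃ₐ[F] Ω} (hav : a ≫ v = v ≫ specAut σ)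
    (U : V.Opens) (hU : U ≤ a ⁻¹ᵁ U) (c : Ω) :
    (a.appLE U U hU) (scalars v U c) = scalars v U (σ c) := by
  have : scalars v U ≫ a.appLE U U hU = CommRingCat.ofHom (σ : Ω →+* Ω) ≫ scalars v U := by
    have h1 : v.appLE ⊤ U (le_preimage_top v U) ≫ a.appLE U U hU =
        (a ≫ v).appLE ⊤ U (le_preimage_top _ U) := Scheme.Hom.appLE_comp_appLE ..
    have h2 : (v ≫ specAut σ).appLE ⊤ U (le_preimage_top _ U) =
        (specAut σ).appTop ≫ v.appLE ⊤ U (le_preimage_top v U) := Scheme.Hom.comp_appLE ..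
    have h3 : (a ≫ v).appLE ⊤ U (le_preimage_top _ U) =
        (v ≫ specAut σ).appLE ⊤ U (le_preimage_top _ U) := by simp only [hav]
    rw [scalars, Scheme.ΓSpecIso_inv_naturality_assoc, Category.assoc, h1, h3, h2]
  exact congr($this c)

/-- A stable open subset of the base change `V` of `X` comes from `X`. -/
theorem exists_preimage_eq_of_stable (hq : IsPullback q v x (baseMap F Ω))
    (hfix : ∀ y : Ω, (∀ σ : Ω ≃ₐ[F] Ω, σ y = y) → y ∈ Set.range (algebraMap F Ω))
    (a : (Ω ≃ₐ[F] Ω) → (V ⟶ V)) (hav : ∀ σ, a σ ≫ v = v ≫ specAut σ) (haq : ∀ σ, a σ ≫ q = q)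
    (U : V.Opens) (hU : ∀ σ, a σ ⁻¹ᵁ U ≤ U) : ∃ O : X.Opens, q ⁻¹ᵁ O = U := by
  have := isAffineHom_of_isPullback hq
  suffices h : ∀ z ∈ U, ∃ O : X.Opens, z ∈ q ⁻¹ᵁ O ∧ q ⁻¹ᵁ O ≤ U by
    refine ⟨sSup {O | q ⁻¹ᵁ O ≤ U}, le_antisymm ?_ fun z hz ↦ ?_⟩
    · rw [sSup_eq_iSup']
      simp only [Scheme.Hom.preimage_iSup]
      exact iSup_le fun O ↦ O.2
    · obtain ⟨O, hO, hOU⟩ := h z hz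
      exact Scheme.Hom.preimage_mono q (le_sSup hOU) hO
  intro z hz
  obtain ⟨O, hO, hzO, -⟩ :=
    exists_isAffineOpen_mem_and_subset (TopologicalSpace.Opens.mem_top (q z))
  have hqO : IsAffineOpen (q ⁻¹ᵁ O) := hO.preimage q
  obtain ⟨b, hbU, hzb⟩ := hqO.exists_basicOpen_le ⟨z, hz⟩ hzO
  have hle (σ) : q ⁻¹ᵁ O ≤ a σ ⁻¹ᵁ q ⁻¹ᵁ O := by
    rw [← Scheme.Hom.comp_preimage, haq]
  let N : AddSubmonoid Γ(V, q ⁻¹ᵁ O) :=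
    { carrier := {b | V.basicOpen b ≤ U}
      zero_mem' := by simp
      add_mem' := fun hb hc ↦ (V.basicOpen_add_le _ _).trans (sup_le hb hc) }
  let N' : AddSubmonoid Γ(V, q ⁻¹ᵁ O) :=
    { carrier := {b | z ∈ V.basicOpen b → ∃ a : Γ(X, O), z ∈ V.basicOpen (q.app O a) ∧
        V.basicOpen (q.app O a) ≤ U}
      zero_mem' := by simp
      add_mem' := fun hb hc h ↦ (V.basicOpen_add_le _ _ h).elim hb hc }
  have key : N ≤ N' := by
    refine mem_of_stable_of_isPushout (isPushout_sections hq hO.isCompact hO.isQuasiSeparated) hfix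
      (fun σ ↦ ((a σ).appLE _ _ (hle σ)).hom) (fun σ c ↦ appLE_spec_comm (hav σ) _ _ c)
      (fun σ c ↦ ?_) N N' (fun c b hb ↦ ?_) (fun c b hb h ↦ ?_) (fun σ b hb ↦ ?_) ?_
    · rw [Scheme.Hom.app_eq_appLE, ← CommRingCat.comp_apply, Scheme.Hom.appLE_comp_appLE]
      simp only [haq]
    · exact (V.basicOpen_mul _ _).trans_le (inf_le_right.trans hb)
    · rw [V.basicOpen_mul] at h
      exact hb h.2
    · change V.basicOpen _ ≤ U
      rw [Scheme.basicOpen_appLE]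
      exact inf_le_right.trans ((Scheme.Hom.preimage_mono _ hb).trans (hU σ))
    · exact fun a ha h ↦ ⟨a, h, ha⟩
  obtain ⟨c, hzc, hcU⟩ := key hbU hzb
  exact ⟨X.basicOpen c, by rwa [Scheme.preimage_basicOpen], by rwa [Scheme.preimage_basicOpen]⟩

/-- Morphisms descend along a flat surjective morphism if they do so locally. -/
theorem exists_comp_eq_of_openCover {V X T : Scheme.{u}} (q : V ⟶ X) [Flat q] [Surjective q]
    (g : V ⟶ T) (𝒰 : X.OpenCover) (f : ∀ i, 𝒰.X i ⟶ T)
    (hf : ∀ i, pullback.snd q (𝒰.f i) ≫ f i = pullback.fst q (𝒰.f i) ≫ g) :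
    ∃ f : X ⟶ T, q ≫ f = g := by
  refine ⟨𝒰.glueMorphisms f fun i j ↦ ?_, ?_⟩
  · have : Epi (pullback.snd q (pullback.fst (𝒰.f i) (𝒰.f j) ≫ 𝒰.f i)) :=
      Flat.epi_of_flat_of_surjective _
    rw [← cancel_epi (pullback.snd q (pullback.fst (𝒰.f i) (𝒰.f j) ≫ 𝒰.f i))]
    let P := pullback q (pullback.fst (𝒰.f i) (𝒰.f j) ≫ 𝒰.f i)
    let pi : P ⟶ pullback q (𝒰.f i) := pullback.lift (pullback.fst _ _)
      (pullback.snd _ _ ≫ pullback.fst _ _) (by rw [pullback.condition, Category.assoc])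
    let pj : P ⟶ pullback q (𝒰.f j) := pullback.lift (pullback.fst _ _)
      (pullback.snd _ _ ≫ pullback.snd _ _) (by
        rw [pullback.condition, Category.assoc, ← pullback.condition (f := 𝒰.f i)])
    have hi : pi ≫ pullback.snd _ _ = pullback.snd _ _ ≫ pullback.fst _ _ := pullback.lift_snd _ _ _
    have hj : pj ≫ pullback.snd _ _ = pullback.snd _ _ ≫ pullback.snd _ _ := pullback.lift_snd _ _ _
    rw [← Category.assoc, ← Category.assoc, ← hi, ← hj, Category.assoc, Category.assoc, hf, hf,
      ← Category.assoc, ← Category.assoc]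
    congr 1
    exact (pullback.lift_fst _ _ _).trans (pullback.lift_fst _ _ _).symm
  · refine Scheme.Cover.hom_ext (𝒰.pullback₁ q) _ _ fun (i : 𝒰.I₀) ↦ ?_
    change pullback.fst q (𝒰.f i) ≫ q ≫ _ = pullback.fst q (𝒰.f i) ≫ g
    rw [pullback.condition_assoc, Scheme.Cover.ι_glueMorphisms, hf]

theorem exists_comp_eq_of_locally {V X T : Scheme.{u}} (q : V ⟶ X) [Flat q] [Surjective q]
    (g : V ⟶ T) (h : ∀ y : X, ∃ O : X.Opens, y ∈ O ∧ ∃ h : O.toScheme ⟶ T,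
      (q ∣_ O) ≫ h = (q ⁻¹ᵁ O).ι ≫ g) : ∃ f : X ⟶ T, q ≫ f = g := by
  choose O hO f hf using h
  have hcov : TopologicalSpace.IsOpenCover O :=
    .mk (top_le_iff.mp fun y _ ↦ TopologicalSpace.Opens.mem_iSup.mpr ⟨y, hO y⟩)
  refine exists_comp_eq_of_openCover q g (X.openCoverOfIsOpenCover O hcov) f fun i ↦ ?_
  have h0 (i) : pullback.snd q (O i).ι ≫ f i = pullback.fst q (O i).ι ≫ g := by
    rw [← cancel_epi (isPullback_morphismRestrict q (O i)).flip.isoPullback.hom,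
      IsPullback.isoPullback_hom_snd_assoc, IsPullback.isoPullback_hom_fst_assoc, hf]
  exact h0 i

/-- An invariant morphism on the base change `V` of `X` factors through `X`. -/
theorem exists_comp_eq_of_invariant (hq : IsPullback q v x (baseMap F Ω))
    (hfix : ∀ y : Ω, (∀ σ : Ω ≃ₐ[F] Ω, σ y = y) → y ∈ Set.range (algebraMap F Ω))
    (a : (Ω ≃ₐ[F] Ω) → (V ⟶ V)) (hav : ∀ σ, a σ ≫ v = v ≫ specAut σ) (haq : ∀ σ, a σ ≫ q = q)
    {T : Scheme.{u}} (g : V ⟶ T) (hg : ∀ σ, a σ ≫ g = g) : ∃ f : X ⟶ T, q ≫ f = g := by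
  have := isAffineHom_of_isPullback hq
  have := flat_of_isPullback hq
  have := surjective_of_isPullback hq
  apply exists_comp_eq_of_locally
  intro y
  obtain ⟨z, rfl⟩ := q.surjective y
  obtain ⟨W, hW, hzW, -⟩ :=
    exists_isAffineOpen_mem_and_subset (TopologicalSpace.Opens.mem_top (g z))
  obtain ⟨O', hO'⟩ := exists_preimage_eq_of_stable hq hfix a hav haq (g ⁻¹ᵁ W) fun σ ↦ by
    rw [← Scheme.Hom.comp_preimage, hg]
  obtain ⟨O, hO, hzO, hOO'⟩ := exists_isAffineOpen_mem_and_subset (U := O') (x := q z)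
    (show z ∈ q ⁻¹ᵁ O' from hO' ▸ hzW)
  have hqO : IsAffineOpen (q ⁻¹ᵁ O) := hO.preimage q
  have hle (σ) : q ⁻¹ᵁ O ≤ a σ ⁻¹ᵁ q ⁻¹ᵁ O := by
    rw [← Scheme.Hom.comp_preimage, haq]
  have hOW : q ⁻¹ᵁ O ≤ g ⁻¹ᵁ W := (Scheme.Hom.preimage_mono q hOO').trans hO'.le
  have hpo := isPushout_sections hq hO.isCompact hO.isQuasiSeparated
  have hinj := injective_of_isPushout hpo
  have hex (t : Γ(T, W)) : ∃ c, q.app O c = g.appLE W (q ⁻¹ᵁ O) hOW t := by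
    refine exists_eq_of_invariant_of_isPushout hpo hfix
      (fun σ ↦ ((a σ).appLE _ _ (hle σ)).hom) (fun σ c ↦ appLE_spec_comm (hav σ) _ _ c)
      (fun σ c ↦ ?_) _ fun σ ↦ ?_
    · rw [Scheme.Hom.app_eq_appLE, ← CommRingCat.comp_apply, Scheme.Hom.appLE_comp_appLE]
      simp only [haq]
    · rw [← CommRingCat.comp_apply, Scheme.Hom.appLE_comp_appLE]
      simp only [hg]
  let e := RingEquiv.ofBijective (q.app O).hom.rangeRestrict
      ⟨fun _ _ h ↦ hinj (congrArg Subtype.val h), RingHom.rangeRestrict_surjective _⟩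
  let ψ : Γ(T, W) ⟶ Γ(X, O) := CommRingCat.ofHom (e.symm.toRingHom.comp
    ((g.appLE W (q ⁻¹ᵁ O) hOW).hom.codRestrict (q.app O).hom.range fun t ↦ hex t))
  have hψ : ψ ≫ q.app O = g.appLE W (q ⁻¹ᵁ O) hOW := by
    ext t
    exact congrArg Subtype.val (e.apply_symm_apply
      ⟨(g.appLE W (q ⁻¹ᵁ O) hOW).hom t, hex t⟩)
  refine ⟨O, hzO, hO.isoSpec.hom ≫ Spec.map ψ ≫ hW.fromSpec, ?_⟩
  rw [← cancel_epi hqO.isoSpec.inv]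
  have h1 : hqO.isoSpec.inv ≫ (q ∣_ O) = Spec.map (q.app O) ≫ hO.isoSpec.inv := by
    rw [← cancel_mono O.ι, Category.assoc, morphismRestrict_ι, Category.assoc,
      IsAffineOpen.isoSpec_inv_ι, Scheme.Hom.app_eq_appLE, hO.SpecMap_appLE_fromSpec _ hqO,
      IsAffineOpen.isoSpec_inv_ι_assoc]
  rw [reassoc_of% h1, Iso.inv_hom_id_assoc, ← Spec.map_comp_assoc, hψ,
    hW.SpecMap_appLE_fromSpec _ hqO, IsAffineOpen.isoSpec_inv_ι_assoc]

end Geometry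

/-! ### Automorphisms of algebraically closed fields -/

section Fields

open TensorProduct IntermediateField.algebraAdjoinAdjoin

/-- Algebraically closed extensions of the same transcendence degree are isomorphic. -/
theorem exists_algEquiv_of_trdeg_eq {E K L : Type u} [Field E] [Field K] [Field L] [Algebra E K]
    [Algebra E L] [IsAlgClosed K] [IsAlgClosed L] (h : Algebra.trdeg E K = Algebra.trdeg E L) :
    Nonempty (K ≃ₐ[E] L) := by
  obtain ⟨s, hs⟩ := exists_isTranscendenceBasis E K
  obtain ⟨t, ht⟩ := exists_isTranscendenceBasis E L
  obtain ⟨e⟩ := Cardinal.eq.mp (hs.cardinalMk_eq_trdeg.trans (h.trans ht.cardinalMk_eq_trdeg.symm))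
  have := IsAlgClosed.isAlgClosure_of_transcendence_basis _ hs
  have := IsAlgClosed.isAlgClosure_of_transcendence_basis _ ht
  let e₀ := hs.1.aevalEquiv.symm.trans ((MvPolynomial.renameEquiv E e).trans ht.1.aevalEquiv)
  refine ⟨AlgEquiv.ofRingEquiv (f := IsAlgClosure.equivOfEquiv K L e₀.toRingEquiv) fun x ↦ ?_⟩
  rw [IsScalarTower.algebraMap_apply E (Algebra.adjoin E (Set.range ((↑) : s → K))) K,
    IsAlgClosure.equivOfEquiv_algebraMap]
  exact (congrArg _ (e₀.commutes x)).trans (IsScalarTower.algebraMap_apply _ _ _ x).symm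

theorem trdeg_eq_of_finite {κ E Ω : Type u} [Field κ] [Field E] [Field Ω] [Algebra κ E]
    [Algebra κ Ω] [Algebra E Ω] [IsScalarTower κ E Ω]
    (hE : Algebra.trdeg κ E < Cardinal.aleph0) (htr : Cardinal.aleph0 ≤ Algebra.trdeg κ Ω) :
    Algebra.trdeg E Ω = Algebra.trdeg κ Ω := by
  have h := trdeg_add_eq κ E (A := Ω)
  have h' : Cardinal.aleph0 ≤ Algebra.trdeg E Ω := by
    by_contra! hlt
    exact htr.not_gt (h ▸ Cardinal.add_lt_aleph0 hE hlt)
  rw [← h, Cardinal.add_eq_right h' (hE.le.trans h')]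

/-- Homogeneity: two embeddings of a field `E` of finite transcendence degree into an algebraically
closed field `Ω` of infinite transcendence degree differ by an automorphism of `Ω`. -/
theorem exists_algEquiv_apply_eq {κ E Ω : Type u} [Field κ] [Field E] [Field Ω] [Algebra κ E]
    [Algebra κ Ω] [IsAlgClosed Ω] (hE : Algebra.trdeg κ E < Cardinal.aleph0)
    (htr : Cardinal.aleph0 ≤ Algebra.trdeg κ Ω) (i j : E →ₐ[κ] Ω) :
    ∃ θ : Ω ≃ₐ[κ] Ω, ∀ e, θ (i e) = j e := by
  have key (i : E →ₐ[κ] Ω) :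
      (let := i.toAlgebra; Algebra.trdeg E Ω) = Algebra.trdeg κ Ω := by
    let := i.toAlgebra
    have : IsScalarTower κ E Ω := .of_algebraMap_eq' i.comp_algebraMap.symm
    exact trdeg_eq_of_finite hE htr
  obtain ⟨θ⟩ := @exists_algEquiv_of_trdeg_eq E Ω Ω _ _ _ i.toAlgebra j.toAlgebra _ _
    ((key i).trans (key j).symm)
  have hθ (e : E) : θ (i e) = j e :=
    @AlgEquiv.commutes E Ω Ω _ _ _ i.toAlgebra j.toAlgebra θ e
  refine ⟨AlgEquiv.ofRingEquiv (f := @AlgEquiv.toRingEquiv E Ω Ω _ _ _ i.toAlgebra j.toAlgebra θ)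
    fun x ↦ ?_, hθ⟩
  have h := hθ (algebraMap κ E x)
  rwa [i.commutes, j.commutes] at h

theorem exists_algEquiv_of_algebraicIndependent {κ Ω : Type u} {ι : Type*} [Finite ι] [Field κ]
    [Field Ω] [Algebra κ Ω] [IsAlgClosed Ω] (htr : Cardinal.aleph0 ≤ Algebra.trdeg κ Ω)
    {v w : ι → Ω} (hv : AlgebraicIndependent κ v) (hw : AlgebraicIndependent κ w) :
    ∃ θ : Ω ≃ₐ[κ] Ω, ∀ i, θ (v i) = w i := by
  let E := IntermediateField.adjoin κ (Set.range v)
  have : Algebra.EssFiniteType κ E :=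
    IntermediateField.essFiniteType_iff.mpr
      (IntermediateField.fg_adjoin_of_finite (Set.finite_range v))
  obtain ⟨θ, hθ⟩ := exists_algEquiv_apply_eq (E := E) (trdeg_lt_aleph0 κ E) htr E.val
    ((IntermediateField.val _).comp
      (hv.aevalEquivField.symm.trans hw.aevalEquivField).toAlgHom)
  refine ⟨θ, fun i ↦ ?_⟩
  let X : FractionRing (MvPolynomial ι κ) := algebraMap (MvPolynomial ι κ) _ (MvPolynomial.X i)
  have hX : E.val (hv.aevalEquivField X) = v i :=
    (hv.aevalEquivField_algebraMap_apply_coe _).trans (MvPolynomial.aeval_X _ _)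
  rw [← hX, hθ]
  refine Eq.trans ?_ ((hw.aevalEquivField_algebraMap_apply_coe (MvPolynomial.X i)).trans
    (MvPolynomial.aeval_X _ _))
  simp [X]

/-- The fixed field of the automorphisms of `Ω` over `F` is `F`. -/
theorem mem_range_of_forall_algEquiv {F Ω : Type u} [Field F] [Field Ω] [Algebra F Ω]
    [CharZero Ω] [IsAlgClosed Ω] (htr : Cardinal.aleph0 ≤ Algebra.trdeg F Ω) (x : Ω)
    (hx : ∀ σ : Ω ≃ₐ[F] Ω, σ x = x) : x ∈ Set.range (algebraMap F Ω) := by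
  by_contra hxF
  by_cases halg : IsAlgebraic F x
  · have : CharZero F := (algebraMap F Ω).charZero
    have hint := halg.isIntegral
    obtain ⟨y, hy, hyx⟩ : ∃ y ∈ (minpoly F x).aroots Ω, y ≠ x := by
      by_contra! h
      have hsep : ((minpoly F x).map (algebraMap F Ω)).Separable :=
        (minpoly.irreducible hint).separable.map
      have hnodup := Polynomial.nodup_roots hsep
      have hcard : ((minpoly F x).aroots Ω).card = (minpoly F x).natDegree := by
        rw [Polynomial.aroots, ← (IsAlgClosed.splits _).natDegree_eq_card_roots,
          Polynomial.natDegree_map]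
      have hle : ((minpoly F x).aroots Ω).card ≤ 1 := by
        have hsub : (minpoly F x).aroots Ω ≤ {x} :=
          (Multiset.le_iff_subset hnodup).mpr fun y hy ↦ by simpa using h y hy
        simpa using Multiset.card_le_card hsub
      have hpos := minpoly.natDegree_pos hint
      exact hxF (minpoly.natDegree_eq_one_iff.mp (by omega))
    have : Module.Finite F (IntermediateField.adjoin F {x}) :=
      IntermediateField.adjoin.finiteDimensional hint
    obtain ⟨θ, hθ⟩ := exists_algEquiv_apply_eq (E := IntermediateField.adjoin F {x})
      (trdeg_lt_aleph0 F _) htr (IntermediateField.val _)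
      ((IntermediateField.algHomAdjoinIntegralEquiv F hint).symm ⟨y, hy⟩)
    have h := hθ (IntermediateField.AdjoinSimple.gen F x)
    rw [IntermediateField.algHomAdjoinIntegralEquiv_symm_apply_gen] at h
    exact hyx (h.symm.trans (hx θ))
  · have hv : AlgebraicIndependent F (fun _ : Unit ↦ x) :=
      algebraicIndependent_unique_type_iff.mpr halg
    have hw : AlgebraicIndependent F (fun _ : Unit ↦ x + 1) := by
      refine algebraicIndependent_unique_type_iff.mpr fun h ↦ halg ?_
      simpa using h.sub isAlgebraic_one
    obtain ⟨θ, hθ⟩ := exists_algEquiv_of_algebraicIndependent htr hv hw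
    have h := hθ ()
    rw [hx] at h
    simp at h

theorem finite_range_comp {κ R A B : Type*} [Field κ] [CommRing R] [CommRing A] [CommRing B]
    [Algebra κ R] [Algebra κ A] [Algebra κ B] (f : R →ₐ[κ] A) (g : A →ₐ[κ] B)
    [hg : Module.Finite κ g.range] : Module.Finite κ (g.comp f).range :=
  Submodule.finiteDimensional_of_le (S₁ := Subalgebra.toSubmodule (g.comp f).range)
    (S₂ := Subalgebra.toSubmodule g.range) (AlgHom.range_comp_le_range f g)

/-- A form of the Nullstellensatz: a nonzero element of a finitely generated domain over `κ` has
nonzero value at some point with coordinates in a finite extension of `κ`. -/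
theorem exists_algHom_apply_ne_zero {κ Ω R : Type*} [Field κ] [Field Ω] [Algebra κ Ω]
    [IsAlgClosed Ω] [CommRing R] [IsDomain R] [Algebra κ R] [Algebra.FiniteType κ R] {g : R}
    (hg : g ≠ 0) : ∃ s : R →ₐ[κ] Ω, s g ≠ 0 ∧ Module.Finite κ s.range := by
  let R' := Localization.Away g
  have : Algebra.FiniteType κ R' := .trans (S := R) inferInstance
    (IsLocalization.finiteType_of_monoid_fg (Submonoid.powers g) R')
  have : Nontrivial R' := (IsLocalization.injective R'
    (powers_le_nonZeroDivisors_of_noZeroDivisors hg)).nontrivial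
  obtain ⟨m, hm⟩ := Ideal.exists_maximal R'
  let := Ideal.Quotient.field m
  have : Module.Finite κ (R' ⧸ m) := finite_of_finite_type_of_isJacobsonRing κ (R' ⧸ m)
  let φ : R' →ₐ[κ] Ω := (IsAlgClosed.lift (R := κ) (S := R' ⧸ m)).comp (Ideal.Quotient.mkₐ κ m)
  have : Module.Finite κ (IsAlgClosed.lift (R := κ) (S := R' ⧸ m) (M := Ω)).range :=
    Module.Finite.range (IsAlgClosed.lift (R := κ) (S := R' ⧸ m) (M := Ω)).toLinearMap
  have : Module.Finite κ φ.range := finite_range_comp _ _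
  exact ⟨φ.comp (IsScalarTower.toAlgHom κ R R'),
    ((IsLocalization.Away.algebraMap_isUnit (S := R') g).map φ).ne_zero, finite_range_comp _ _⟩

/-- Over an algebraically closed field `K`, the base change of a finitely generated domain to an
extension field `E` is a domain: a product that vanishes does so at every `K`-point of `A`. -/
theorem isDomain_tensorProduct {K E A : Type*} [Field K] [IsAlgClosed K] [Field E] [Algebra K E]
    [CommRing A] [IsDomain A] [Algebra K A] [Algebra.FiniteType K A] : IsDomain (A ⊗[K] E) := by
  have : FaithfulSMul K A := inferInstance
  have : Nontrivial (A ⊗[K] E) := (Algebra.TensorProduct.includeLeft_injective (S := K)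
    (FaithfulSMul.algebraMap_injective K E)).nontrivial
  refine @NoZeroDivisors.to_isDomain _ _ _ ⟨fun {x y} hxy ↦ ?_⟩
  let b := Module.Basis.ofVectorSpace K E
  let B := b.baseChange A
  let ψ (φ : A →ₐ[K] K) : A ⊗[K] E →ₐ[K] E :=
    Algebra.TensorProduct.productMap ((Algebra.ofId K E).comp φ) (AlgHom.id K E)
  have hψ (φ : A →ₐ[K] K) (z : A ⊗[K] E) (i) : b.repr (ψ φ z) i = φ (B.repr z i) := by
    induction z with
    | zero => simp
    | tmul a e =>
      have : ψ φ (a ⊗ₜ e) = φ a • e := by simp [ψ, Algebra.smul_def, Algebra.ofId_apply]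
      rw [this]
      simp [B, mul_comm]
    | add z w hz hw => simp only [map_add, Finsupp.add_apply, hz, hw]
  by_contra! h
  obtain ⟨i, hi⟩ : ∃ i, B.repr x i ≠ 0 := by
    by_contra! h'
    exact h.1 (B.repr.injective (by ext i; simpa using h' i))
  obtain ⟨j, hj⟩ : ∃ i, B.repr y i ≠ 0 := by
    by_contra! h'
    exact h.2 (B.repr.injective (by ext i; simpa using h' i))
  obtain ⟨φ, hφ, -⟩ := exists_algHom_apply_ne_zero (κ := K) (Ω := K) (mul_ne_zero hi hj)
  rw [map_mul, ← hψ, ← hψ] at hφ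
  have h0 : ψ φ x * ψ φ y = 0 := by rw [← map_mul, hxy, map_zero]
  rcases mul_eq_zero.mp h0 with h0 | h0 <;> simp [h0] at hφ

/-- A finitely generated domain `A` over an algebraically closed field `K` can be embedded in `Ω` in
general position with respect to a given extension `E` of `K` of finite transcendence degree. -/
theorem exists_algEquiv_injective_productMap {K E Ω A : Type u} [Field K] [IsAlgClosed K] [Field E]
    [Field Ω] [IsAlgClosed Ω] [Algebra K E] [Algebra K Ω] [Algebra E Ω] [IsScalarTower K E Ω]
    [CommRing A] [IsDomain A] [Algebra K A] [Algebra.FiniteType K A]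
    (hE : Algebra.trdeg K E < Cardinal.aleph0) (htr : Cardinal.aleph0 ≤ Algebra.trdeg K Ω)
    (f : A →ₐ[K] Ω) (hf : Function.Injective f) : ∃ ρ : Ω ≃ₐ[K] Ω, Function.Injective
      (Algebra.TensorProduct.productMap (IsScalarTower.toAlgHom K E Ω) (ρ.toAlgHom.comp f)) := by
  have : IsDomain (E ⊗[K] A) :=
    have := isDomain_tensorProduct (K := K) (E := E) (A := A)
    (Algebra.TensorProduct.comm K E A).toMulEquiv.isDomain _
  obtain ⟨s, hs⟩ := exists_isTranscendenceBasis K A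
  have hsfin : Finite s := Cardinal.mk_lt_aleph0_iff.mp
    (hs.cardinalMk_eq_trdeg.trans_lt _root_.trdeg_lt_aleph0_of_finiteType)
  have hsf : AlgebraicIndependent K (fun i : s ↦ f i) := hs.1.map' hf
  obtain ⟨t, ht⟩ := exists_isTranscendenceBasis E Ω
  have ht' : Infinite t := by
    rw [Cardinal.infinite_iff, ht.cardinalMk_eq_trdeg, trdeg_eq_of_finite hE htr]
    exact htr
  -- The automorphism `ρ` moves a transcendence basis of `A` over `K` to elements of `Ω` that are
  -- algebraically independent over `E`.
  obtain ⟨j⟩ : Nonempty (s ↪ t) := (Cardinal.le_def s t).mp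
    ((Cardinal.lt_aleph0_of_finite s).le.trans (Cardinal.aleph0_le_mk t))
  have hy : AlgebraicIndependent E (fun i : s ↦ (j i : Ω)) := ht.1.comp j j.injective
  obtain ⟨ρ, hρ⟩ := exists_algEquiv_of_algebraicIndependent htr hsf
    (hy.restrictScalars (algebraMap K E).injective)
  refine ⟨ρ, ?_⟩
  set g := Algebra.TensorProduct.productMap (IsScalarTower.toAlgHom K E Ω) (ρ.toAlgHom.comp f)
  let h : MvPolynomial s E →ₐ[E] E ⊗[K] A := MvPolynomial.aeval fun i ↦ 1 ⊗ₜ (i : A)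
  have hgh (P) : g (h P) = MvPolynomial.aeval (fun i : s ↦ (j i : Ω)) P := by
    induction P using MvPolynomial.induction_on with
    | C e => simp [g, h, Algebra.TensorProduct.algebraMap_apply]
    | add P Q hP hQ => simp only [map_add, hP, hQ]
    | mul_X P i hP => rw [map_mul, map_mul, hP, map_mul]; simp [g, h, hρ]
  have hh : Function.Injective h := fun P Q hPQ ↦ hy (by rw [← hgh, ← hgh, hPQ])
  let := h.toAlgebra
  have halg : Algebra.IsAlgebraic (MvPolynomial s E) (E ⊗[K] A) := by
    refine ⟨fun x ↦ ?_⟩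
    induction x with
    | zero => exact isAlgebraic_zero
    | add x y hx hy => exact hx.add hy
    | tmul e a =>
      have h1 : (e ⊗ₜ a : E ⊗[K] A) = h (MvPolynomial.C e) * (1 ⊗ₜ a) := by
        simp [h, Algebra.TensorProduct.algebraMap_apply]
      rw [h1]
      refine (isAlgebraic_algebraMap (R := MvPolynomial s E) (MvPolynomial.C e)).mul ?_
      have ha := hs.isAlgebraic.isAlgebraic a
      refine ha.ringHom_of_comp_eq ((MvPolynomial.map (algebraMap K E)).comp
        (hs.1.aevalEquiv.symm : _ →+* MvPolynomial s K))
        (Algebra.TensorProduct.includeRight : A →ₐ[K] E ⊗[K] A)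
        ((MvPolynomial.map_injective _ (algebraMap K E).injective).comp
          hs.1.aevalEquiv.symm.injective) (RingHom.ext fun z ↦ ?_)
      obtain ⟨P, rfl⟩ := hs.1.aevalEquiv.surjective z
      change h (MvPolynomial.map _ (hs.1.aevalEquiv.symm (hs.1.aevalEquiv P))) =
        (1 : E) ⊗ₜ (hs.1.aevalEquiv P : A)
      rw [AlgEquiv.symm_apply_apply, hs.1.aevalEquiv_apply_coe]
      induction P using MvPolynomial.induction_on with
      | C c =>
        simp [h, Algebra.algebraMap_eq_smul_one]
        rfl
      | add P Q hP hQ => simp only [map_add, hP, hQ, tmul_add]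
      | mul_X P i hP =>
        rw [map_mul, map_mul, hP, map_mul, MvPolynomial.map_X, MvPolynomial.aeval_X,
          MvPolynomial.aeval_X, Algebra.TensorProduct.tmul_mul_tmul, one_mul]
  -- The map `g` is injective on the polynomial ring, over which `E ⊗ A` is algebraic: a nonzero
  -- element of the kernel would divide a nonzero element of the polynomial ring.
  rw [injective_iff_map_eq_zero]
  intro x hx
  by_contra hx0
  obtain ⟨r, hr, y, hy'⟩ :=
    (halg.isAlgebraic x).exists_nonzero_dvd (mem_nonZeroDivisors_of_ne_zero hx0)
  have h2 : g (h r) = 0 := by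
    change g (algebraMap _ _ r) = 0
    rw [hy', map_mul, hx, zero_mul]
  rw [hgh] at h2
  exact hr (hy (by rw [h2, map_zero]))

/-- Elements of a subfield that is algebraic over `κ` are linearly disjoint from a regular
extension of `κ`. -/
theorem injective_productMap_algebraicClosure {κ Ω R : Type u} [Field κ] [Field Ω] [Algebra κ Ω]
    [CharZero Ω] [IsAlgClosed Ω] [CommRing R] [Algebra κ R] (ι : R →ₐ[κ] Ω)
    (hι : Function.Injective ι) (L : IntermediateField κ Ω) (hL : ι.range ≤ L.toSubalgebra)
    (hreg : ∀ x ∈ L, IsAlgebraic κ x → x ∈ Set.range (algebraMap κ Ω))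
    (htr : Cardinal.aleph0 ≤ Algebra.trdeg L Ω) :
    Function.Injective (Algebra.TensorProduct.productMap (algebraicClosure κ Ω).val ι) := by
  set g := Algebra.TensorProduct.productMap (algebraicClosure κ Ω).val ι
  let s : Set (algebraicClosure κ Ω ≃ₐ[κ] algebraicClosure κ Ω) :=
    {τ | ∃ σ : Ω ≃ₐ[κ] Ω, (∀ x ∈ L, σ x = x) ∧ ∀ c : algebraicClosure κ Ω, σ c = τ c}
  -- The kernel is stable under automorphisms over `L`, whose fixed field in the algebraic closure
  -- is `κ`.
  let N : Submodule (algebraicClosure κ Ω) (algebraicClosure κ Ω ⊗[κ] R) :=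
    { RingHom.ker g with
      smul_mem' := fun c x hx ↦ by
        change g (c • x) = 0
        have : c • x = (c ⊗ₜ 1) * x := Algebra.smul_def c x
        rw [this, map_mul, show g x = 0 from hx, mul_zero] }
  have key : N = ⊥ := eq_bot_of_stable s ?_ N ?_ ?_
  · rw [injective_iff_map_eq_zero]
    intro x hx
    have hx' : x ∈ N := hx
    rwa [key] at hx'
  · intro x hx
    obtain ⟨y, hy⟩ := mem_range_of_forall_algEquiv (F := L) htr (x : Ω) fun σ ↦ by
      have h := hx (algebraicClosure.algEquivOfAlgEquiv (σ.restrictScalars κ))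
        ⟨σ.restrictScalars κ, fun z hz ↦ σ.commutes ⟨z, hz⟩, fun c ↦ rfl⟩
      exact congrArg Subtype.val h
    obtain ⟨z, hz⟩ := hreg x (hy ▸ y.2) (mem_algebraicClosure_iff.mp x.2)
    exact ⟨z, Subtype.ext hz⟩
  · rintro τ ⟨σ, hσ, hτ⟩ x hx
    have h (x) : g (τ.toLinearMap.rTensor R x) = σ (g x) := by
      induction x with
      | zero => simp
      | add x y hx hy => simp only [map_add, hx, hy]
      | tmul c a => simp [g, hτ, hσ (ι a) (hL ⟨a, rfl⟩)]
    change g _ = 0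
    rw [h, show g x = 0 from hx, map_zero]
  · intro m hm
    have hm' : g (1 ⊗ₜ m) = 0 := hm
    apply hι
    simpa [g] using hm'

/-- General position with respect to a field `E` implies general position with respect to points with
coordinates in `E`. -/
theorem injective_productMap_of_range_le {κ Ω P R : Type*} [Field κ] [Field Ω] [Algebra κ Ω]
    [CommRing P] [Algebra κ P] [CommRing R] [Algebra κ R] {E : IntermediateField κ Ω}
    {g : R →ₐ[κ] Ω} (hg : Function.Injective (Algebra.TensorProduct.productMap E.val g))
    (f : P →ₐ[κ] Ω) (hf : Function.Injective f) (hfE : f.range ≤ E.toSubalgebra) :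
    Function.Injective (Algebra.TensorProduct.productMap f g) := by
  let f' : P →ₐ[κ] E := f.codRestrict E.toSubalgebra fun x ↦ hfE ⟨x, rfl⟩
  have h : Algebra.TensorProduct.productMap f g =
      (Algebra.TensorProduct.productMap E.val g).comp
        (Algebra.TensorProduct.map f' (AlgHom.id κ R)) := by
    ext x
    · exact (Algebra.TensorProduct.productMap_left_apply _ _ x).trans (by simp [f']; rfl)
    · simp
  rw [h]
  refine hg.comp (Module.Flat.rTensor_preserves_injective_linearMap (M := R) f'.toLinearMap ?_)
  exact fun x y hxy ↦ hf congr(($hxy : Ω))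

/-- A finitely generated regular domain `R` over `κ` can be embedded in `Ω` in general position
with respect to a given field `E` of finite transcendence degree. -/
theorem exists_algEquiv_general_position {κ K E Ω R : Type u} [Field κ] [Field K] [Field E]
    [Field Ω] [Algebra κ K] [Algebra κ E] [Algebra κ Ω] [Algebra K E] [Algebra K Ω] [Algebra E Ω]
    [IsScalarTower κ K E] [IsScalarTower κ K Ω] [IsScalarTower κ E Ω] [IsScalarTower K E Ω]
    [Algebra.IsAlgebraic κ K] [IsAlgClosed K] [IsAlgClosed Ω]
    (hE : Algebra.trdeg κ E < Cardinal.aleph0)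
    (htr : Cardinal.aleph0 ≤ Algebra.trdeg κ Ω) [CommRing R] [Algebra κ R]
    [Algebra.FiniteType κ R] (ι : R →ₐ[κ] Ω) (hι : Function.Injective
      (Algebra.TensorProduct.productMap (IsScalarTower.toAlgHom κ K Ω) ι)) :
    ∃ ρ : Ω ≃ₐ[K] Ω, Function.Injective (Algebra.TensorProduct.productMap
      (IsScalarTower.toAlgHom κ E Ω) ((ρ.restrictScalars κ).toAlgHom.comp ι)) := by
  let f : K ⊗[κ] R →ₐ[K] Ω := Algebra.TensorProduct.lift (Algebra.ofId K Ω) ι fun _ _ ↦ .all _ _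
  have hf : Function.Injective f := hι
  have : IsDomain (K ⊗[κ] R) := hf.isDomain f.toRingHom
  have h0 : Algebra.trdeg κ K = 0 := trdeg_eq_zero
  have hE' : Algebra.trdeg K E < Cardinal.aleph0 := by
    rwa [← trdeg_add_eq κ K, h0, zero_add] at hE
  have htr' : Cardinal.aleph0 ≤ Algebra.trdeg K Ω := by
    rwa [← trdeg_add_eq κ K, h0, zero_add] at htr
  obtain ⟨ρ, hρ⟩ := exists_algEquiv_injective_productMap hE' htr' f hf
  refine ⟨ρ, ?_⟩
  have h (x) : (Algebra.TensorProduct.productMap (IsScalarTower.toAlgHom κ E Ω)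
      ((ρ.restrictScalars κ).toAlgHom.comp ι) : E ⊗[κ] R →ₐ[κ] Ω) x =
        (Algebra.TensorProduct.productMap
        (IsScalarTower.toAlgHom K E Ω) (ρ.toAlgHom.comp f))
          ((Algebra.TensorProduct.cancelBaseChange κ K E E R).symm x) := by
    induction x with
    | zero => simp
    | add x y hx hy => simp only [map_add, hx, hy]
    | tmul c a => simp [f]
  intro x y hxy
  rw [h, h] at hxy
  exact (Algebra.TensorProduct.cancelBaseChange κ K E E R).symm.injective (hρ hxy)

/-- The elements of a finitely generated extension `L` of `k` that are algebraic over `k` form a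
finite extension: a basis over `k` remains linearly independent over a purely transcendental
subfield over which `L` is finite. -/
theorem finite_algebraicClosure {k L : Type u} [Field k] [Field L] [Algebra k L]
    [Algebra.EssFiniteType k L] : Module.Finite k (algebraicClosure k L) := by
  obtain ⟨s, hs⟩ := exists_finset_isTranscendenceBasis k L
  let F₀ := IntermediateField.adjoin k (Set.range ((↑) : s → L))
  have : Algebra.IsAlgebraic F₀ L := hs.isAlgebraic_field
  have : Algebra.EssFiniteType F₀ L := .of_comp k F₀ L
  have : Module.Finite F₀ L := Algebra.finite_of_essFiniteType_of_isAlgebraic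
  let b := Module.Basis.ofVectorSpace k (algebraicClosure k L)
  have hC := hs.1.extendScalars (algebraicClosure k L)
  have hli : LinearIndependent (Algebra.adjoin k (Set.range ((↑) : s → L)))
      (fun i ↦ (b i : L)) := by
    rw [linearIndependent_iff']
    intro t a hta i hi
    let P (j) := hs.1.aevalEquiv.symm (a j)
    have hP (j) : (a j : L) = MvPolynomial.aeval (fun x : s ↦ (x : L)) (P j) := by
      rw [← hs.1.aevalEquiv_apply_coe, AlgEquiv.apply_symm_apply]
    let Q : MvPolynomial s (algebraicClosure k L) :=
      ∑ j ∈ t, MvPolynomial.C (b j) * MvPolynomial.map (algebraMap k _) (P j)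
    have hQ : Q = 0 := by
      apply hC
      rw [map_zero, ← hta, map_sum]
      refine Finset.sum_congr rfl fun j _ ↦ ?_
      rw [map_mul, MvPolynomial.aeval_C, MvPolynomial.aeval_map_algebraMap, ← hP, mul_comm,
        Algebra.smul_def]
      rfl
    have hcoeff : P i = 0 := by
      ext m
      have h : ∑ j ∈ t, (P j).coeff m • b j = 0 := by
        have := congrArg (MvPolynomial.coeff m) hQ
        rw [MvPolynomial.coeff_zero] at this
        rw [← this, MvPolynomial.coeff_sum]
        refine Finset.sum_congr rfl fun j _ ↦ ?_
        rw [MvPolynomial.coeff_C_mul, MvPolynomial.coeff_map, Algebra.smul_def, mul_comm]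
      exact linearIndependent_iff'.mp b.linearIndependent t _ h i hi
    exact hs.1.aevalEquiv.symm.injective (hcoeff.trans (map_zero _).symm)
  have hli' : LinearIndependent F₀ (fun i ↦ (b i : L)) :=
    (LinearIndependent.iff_fractionRing (Algebra.adjoin k (Set.range ((↑) : s → L))) F₀).mp hli
  have := hli'.finite_of_isNoetherian
  exact Module.Finite.of_basis b

end Fields

/-! ### Spreading out -/

section Spreading

open Opposite

variable (D F : Type u) [CommRing D] [CommRing F] [Algebra D F]

/-- The directed set of finitely generated `D`-subalgebras of `F`. -/
abbrev FGSubalgebra : Type u := {B : Subalgebra D F // B.FG}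

instance : Nonempty (FGSubalgebra D F) := ⟨⟨⊥, Subalgebra.fg_bot⟩⟩

instance : IsDirectedOrder (FGSubalgebra D F) where
  directed B C := ⟨⟨B.1 ⊔ C.1, B.2.sup C.2⟩, show B.1 ≤ B.1 ⊔ C.1 from le_sup_left,
    show C.1 ≤ B.1 ⊔ C.1 from le_sup_right⟩

variable {D F} {Z : Scheme.{u}} (z : Z ⟶ Spec (CommRingCat.of D))

/-- The base change of a scheme over `D` to a `D`-algebra. -/
abbrev baseScheme (B : Type u) [CommRing B] [Algebra D B] : Scheme.{u} := pullback z (baseMap D B)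

/-- Compatibility of base change with a homomorphism of `D`-algebras. -/
def baseSchemeMap {B C : Type u} [CommRing B] [CommRing C] [Algebra D B] [Algebra D C]
    (f : B →ₐ[D] C) : baseScheme z C ⟶ baseScheme z B :=
  pullback.lift (pullback.fst _ _) (pullback.snd _ _ ≫ Spec.map (CommRingCat.ofHom f.toRingHom)) (by
    have : f.toRingHom.comp (algebraMap D B) = algebraMap D C := f.comp_algebraMap
    rw [pullback.condition, Category.assoc, ← Spec.map_comp, ← CommRingCat.ofHom_comp, this])

@[simp]
theorem baseSchemeMap_fst {B C : Type u} [CommRing B] [CommRing C] [Algebra D B] [Algebra D C]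
    (f : B →ₐ[D] C) : baseSchemeMap z f ≫ pullback.fst _ _ = pullback.fst _ _ :=
  pullback.lift_fst _ _ _

@[simp]
theorem baseSchemeMap_snd {B C : Type u} [CommRing B] [CommRing C] [Algebra D B] [Algebra D C]
    (f : B →ₐ[D] C) : baseSchemeMap z f ≫ pullback.snd _ _ =
      pullback.snd _ _ ≫ Spec.map (CommRingCat.ofHom f.toRingHom) :=
  pullback.lift_snd _ _ _

theorem isPullback_baseSchemeMap {B C : Type u} [CommRing B] [CommRing C] [Algebra D B]
    [Algebra D C] (f : B →ₐ[D] C) : IsPullback (baseSchemeMap z f) (pullback.snd _ _)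
      (pullback.snd _ _) (Spec.map (CommRingCat.ofHom f.toRingHom)) := by
  refine IsPullback.of_right ?_ (baseSchemeMap_snd z f) (IsPullback.of_hasPullback z (baseMap D B))
  rw [baseSchemeMap_fst, ← Spec.map_comp, ← CommRingCat.ofHom_comp]
  have : f.toRingHom.comp (algebraMap D B) = algebraMap D C := f.comp_algebraMap
  rw [this]
  exact IsPullback.of_hasPullback _ _

instance {B C : Type u} [CommRing B] [CommRing C] [Algebra D B] [Algebra D C] (f : B →ₐ[D] C) :
    IsAffineHom (baseSchemeMap z f) :=
  MorphismProperty.of_isPullback (isPullback_baseSchemeMap z f).flip inferInstance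

/-- The inverse system of the base changes of `Z` to the finitely generated subalgebras of `F`. -/
def fgDiagram : (FGSubalgebra D F)ᵒᵖ ⥤ Scheme.{u} where
  obj B := baseScheme z B.unop.1
  map f := baseSchemeMap z (Subalgebra.inclusion (leOfHom f.unop))
  map_id B := by
    apply pullback.hom_ext
    · simp
    · simp only [baseSchemeMap_snd, Category.id_comp]
      exact (congrArg _ (Spec.map_id _)).trans (Category.comp_id _)
  map_comp f g := by
    apply pullback.hom_ext
    · simp
    · rw [baseSchemeMap_snd, Category.assoc, baseSchemeMap_snd, ← Category.assoc,
        baseSchemeMap_snd, Category.assoc, ← Spec.map_comp]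
      rfl

variable {ZF : Scheme.{u}} {p : ZF ⟶ Z} {zF : ZF ⟶ Spec (CommRingCat.of F)}
  (hp : IsPullback p zF z (baseMap D F))

include hp in
theorem toBaseScheme_w (B : Subalgebra D F) :
    p ≫ z = (zF ≫ Spec.map (CommRingCat.ofHom B.val.toRingHom)) ≫ baseMap D B := by
  rw [hp.w, Category.assoc, ← Spec.map_comp]
  rfl

/-- The map to the base change of `Z` to a subalgebra `B` of `F`. -/
def toBaseScheme (B : Subalgebra D F) : ZF ⟶ baseScheme z B :=
  pullback.lift p (zF ≫ Spec.map (CommRingCat.ofHom B.val.toRingHom)) (toBaseScheme_w z hp B)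

@[simp]
theorem toBaseScheme_fst (B : Subalgebra D F) :
    toBaseScheme z hp B ≫ pullback.fst _ _ = p :=
  pullback.lift_fst _ _ _

@[simp]
theorem toBaseScheme_snd (B : Subalgebra D F) :
    toBaseScheme z hp B ≫ pullback.snd _ _ =
      zF ≫ Spec.map (CommRingCat.ofHom B.val.toRingHom) :=
  pullback.lift_snd _ _ _

theorem isPullback_toBaseScheme (B : Subalgebra D F) :
    IsPullback (toBaseScheme z hp B) zF (pullback.snd z (baseMap D B)) (baseMap B F) := by
  refine IsPullback.of_right ?_ (toBaseScheme_snd z hp B)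
    (IsPullback.of_hasPullback z (baseMap D B))
  rw [toBaseScheme_fst, ← Spec.map_comp, ← CommRingCat.ofHom_comp,
    ← IsScalarTower.algebraMap_eq D B F]
  exact hp

theorem toBaseScheme_map {B C : Subalgebra D F} (h : B ≤ C) :
    toBaseScheme z hp C ≫ baseSchemeMap z (Subalgebra.inclusion h) = toBaseScheme z hp B := by
  apply pullback.hom_ext
  · simp
  · rw [Category.assoc, baseSchemeMap_snd, ← Category.assoc, toBaseScheme_snd, toBaseScheme_snd,
      Category.assoc, ← Spec.map_comp]
    rfl

/-- The cone with apex the base change of `Z` to `F`. -/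
def fgCone : Cone (fgDiagram (F := F) z) where
  pt := ZF
  π :=
    { app := fun B ↦ toBaseScheme z hp B.unop.1
      naturality := fun _ _ f ↦ (Category.id_comp _).trans
        (toBaseScheme_map z hp (leOfHom f.unop)).symm }

/-- Compatible homomorphisms on the finitely generated subalgebras define a homomorphism. -/
theorem exists_ringHom_of_fg {T : Type*} [CommRing T] (φ : ∀ B : FGSubalgebra D F, B.1 →+* T)
    (hφ : ∀ B C : FGSubalgebra D F, ∀ h : B.1 ≤ C.1,
      (φ C).comp (Subalgebra.inclusion h).toRingHom = φ B) :
    ∃ ψ : F →+* T, ∀ B : FGSubalgebra D F, ψ.comp B.1.val.toRingHom = φ B := by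
  let S (x : F) : FGSubalgebra D F := ⟨Algebra.adjoin D {x}, ⟨{x}, by simp⟩⟩
  have hS (x : F) : x ∈ (S x).1 := Algebra.self_mem_adjoin_singleton D x
  have key (x : F) (B : FGSubalgebra D F) (hx : x ∈ B.1) : φ (S x) ⟨x, hS x⟩ = φ B ⟨x, hx⟩ :=
    (congr($(hφ (S x) B (Algebra.adjoin_le (by simpa using hx))) ⟨x, hS x⟩)).symm
  let J (x y : F) : FGSubalgebra D F := ⟨(S x).1 ⊔ (S y).1, (S x).2.sup (S y).2⟩
  have hx (x y) : x ∈ (J x y).1 := (le_sup_left : (S x).1 ≤ _) (hS x)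
  have hy (x y) : y ∈ (J x y).1 := (le_sup_right : (S y).1 ≤ _) (hS y)
  refine ⟨{ toFun := fun x ↦ φ (S x) ⟨x, hS x⟩, map_one' := ?_, map_zero' := ?_, map_add' := ?_,
            map_mul' := ?_ }, fun B ↦ ?_⟩
  · exact map_one (φ (S 1))
  · intro x y
    simp only [key x (J x y) (hx x y), key y (J x y) (hy x y),
      key (x * y) (J x y) (mul_mem (hx x y) (hy x y)), ← map_mul]
    rfl
  · exact map_zero (φ (S 0))
  · intro x y
    simp only [key x (J x y) (hx x y), key y (J x y) (hy x y),
      key (x + y) (J x y) (add_mem (hx x y) (hy x y)), ← map_add]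
    rfl
  · ext x
    exact key x B x.2

/-- The ring homomorphism on global sections given by a morphism to an affine scheme. -/
def coordHom {T : Scheme.{u}} {R : CommRingCat.{u}} (f : T ⟶ Spec R) : R ⟶ Γ(T, ⊤) :=
  (Scheme.ΓSpecIso R).inv ≫ f.appTop

theorem toSpecΓ_coordHom {T : Scheme.{u}} {R : CommRingCat.{u}} (f : T ⟶ Spec R) :
    T.toSpecΓ ≫ Spec.map (coordHom f) = f := by
  rw [coordHom, Spec.map_comp, ← Category.assoc, ← Scheme.toSpecΓ_naturality, Category.assoc,
    toSpecΓ_SpecMap_ΓSpecIso_inv, Category.comp_id]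

theorem coordHom_comp {T : Scheme.{u}} {R S : CommRingCat.{u}} (f : T ⟶ Spec S) (φ : R ⟶ S) :
    coordHom (f ≫ Spec.map φ) = φ ≫ coordHom f := by
  rw [coordHom, coordHom, Scheme.ΓSpecIso_inv_naturality_assoc, Scheme.Hom.comp_appTop]

theorem exists_hom_spec_of_fg {T : Scheme.{u}}
    (φ : ∀ B : FGSubalgebra D F, T ⟶ Spec (CommRingCat.of B.1))
    (hφ : ∀ B C : FGSubalgebra D F, ∀ h : B.1 ≤ C.1,
      φ C ≫ Spec.map (CommRingCat.ofHom (Subalgebra.inclusion h).toRingHom) = φ B) :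
    ∃ ψ : T ⟶ Spec (CommRingCat.of F), ∀ B : FGSubalgebra D F,
      ψ ≫ Spec.map (CommRingCat.ofHom B.1.val.toRingHom) = φ B := by
  obtain ⟨ψ, hψ⟩ := exists_ringHom_of_fg (D := D) (F := F) (T := Γ(T, ⊤))
    (fun B ↦ (coordHom (φ B)).hom) fun B C h ↦ by
      rw [← hφ B C h, coordHom_comp]
      rfl
  refine ⟨T.toSpecΓ ≫ Spec.map (CommRingCat.ofHom ψ), fun B ↦ ?_⟩
  rw [Category.assoc, ← Spec.map_comp, ← CommRingCat.ofHom_comp, hψ]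
  exact toSpecΓ_coordHom _

theorem hom_spec_ext_of_fg {T : Scheme.{u}} {f g : T ⟶ Spec (CommRingCat.of F)}
    (h : ∀ B : FGSubalgebra D F, f ≫ Spec.map (CommRingCat.ofHom B.1.val.toRingHom) =
      g ≫ Spec.map (CommRingCat.ofHom B.1.val.toRingHom)) : f = g := by
  rw [← toSpecΓ_coordHom f, ← toSpecΓ_coordHom g]
  congr 2
  ext x
  let B : FGSubalgebra D F :=
    ⟨Algebra.adjoin D {x}, ⟨{x}, by simp⟩⟩
  have h2 := congrArg coordHom (h B)
  rw [coordHom_comp, coordHom_comp] at h2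
  exact congr($h2 ⟨x, Algebra.self_mem_adjoin_singleton D x⟩)

theorem exists_lift_of_fg {T : Scheme.{u}} (t : ∀ B : FGSubalgebra D F, T ⟶ baseScheme z B.1)
    (ht : ∀ B C : FGSubalgebra D F, ∀ h : B.1 ≤ C.1,
      t C ≫ baseSchemeMap z (Subalgebra.inclusion h) = t B) :
    ∃ l : T ⟶ ZF, ∀ B : FGSubalgebra D F, l ≫ toBaseScheme z hp B.1 = t B := by
  let B₀ : FGSubalgebra D F := Classical.arbitrary _
  have hfst (B C : FGSubalgebra D F) : t B ≫ pullback.fst z (baseMap D B.1) =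
      t C ≫ pullback.fst z (baseMap D C.1) := by
    obtain ⟨E, hBE, hCE⟩ := exists_ge_ge B C
    rw [← ht B E hBE, ← ht C E hCE, Category.assoc, Category.assoc, baseSchemeMap_fst,
      baseSchemeMap_fst]
  obtain ⟨ψ, hψ⟩ := exists_hom_spec_of_fg (D := D) (F := F)
    (fun B ↦ t B ≫ pullback.snd z (baseMap D B.1)) fun B C h ↦ by
      rw [← ht B C h, Category.assoc, Category.assoc, baseSchemeMap_snd]
  have hw : (t B₀ ≫ pullback.fst _ _) ≫ z = ψ ≫ baseMap D F := by
    rw [Category.assoc, pullback.condition, ← Category.assoc, ← hψ B₀, Category.assoc,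
      ← Spec.map_comp]
    rfl
  refine ⟨hp.lift (t B₀ ≫ pullback.fst _ _) ψ hw, fun B ↦ ?_⟩
  apply pullback.hom_ext
  · rw [Category.assoc, toBaseScheme_fst, hp.lift_fst, hfst]
  · rw [Category.assoc, toBaseScheme_snd, ← Category.assoc, hp.lift_snd, hψ]

theorem hom_ext_of_fg {T : Scheme.{u}} {l m : T ⟶ ZF}
    (h : ∀ B : FGSubalgebra D F, l ≫ toBaseScheme z hp B.1 = m ≫ toBaseScheme z hp B.1) :
    l = m := by
  refine hp.hom_ext ?_ (hom_spec_ext_of_fg (D := D) fun B ↦ ?_)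
  · rw [← toBaseScheme_fst z hp (Classical.arbitrary (FGSubalgebra D F)).1, ← Category.assoc, h,
      Category.assoc]
  · rw [Category.assoc, Category.assoc, ← toBaseScheme_snd z hp B.1, ← Category.assoc, h,
      Category.assoc]

/-- The base change of `Z` to `F` is the limit of the base changes to the finitely generated
subalgebras of `F`. -/
theorem nonempty_isLimit_fgCone : Nonempty (IsLimit (fgCone z hp)) := by
  have hex (s : Cone (fgDiagram (F := F) z)) : ∃ l : s.pt ⟶ ZF, ∀ B : FGSubalgebra D F,
      l ≫ toBaseScheme z hp B.1 = s.π.app (op B) :=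
    exists_lift_of_fg z hp (fun B ↦ s.π.app (op B)) fun B C h ↦
      s.w (homOfLE (show B ≤ C from h)).op
  choose l hl using hex
  exact ⟨⟨l, fun s B ↦ hl s B.unop, fun s m hm ↦ hom_ext_of_fg z hp fun B ↦
    (hm (op B)).trans (hl s B).symm⟩⟩

instance {B C : (FGSubalgebra D F)ᵒᵖ} (f : B ⟶ C) : IsAffineHom ((fgDiagram z).map f) :=
  inferInstanceAs (IsAffineHom (baseSchemeMap z (Subalgebra.inclusion (leOfHom f.unop))))

instance (B : Type u) [CommRing B] [Algebra D B] [QuasiCompact z] :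
    CompactSpace ↥(baseScheme z B) :=
  QuasiCompact.compactSpace_of_compactSpace (pullback.snd z (baseMap D B))

instance (B : Type u) [CommRing B] [Algebra D B] [QuasiSeparated z] :
    QuasiSeparatedSpace ↥(baseScheme z B) :=
  quasiSeparatedSpace_of_quasiSeparated (pullback.snd z (baseMap D B))

instance [QuasiCompact z] (B : (FGSubalgebra D F)ᵒᵖ) : CompactSpace ((fgDiagram z).obj B) :=
  inferInstanceAs (CompactSpace ↥(baseScheme z B.unop.1))

instance [QuasiSeparated z] (B : (FGSubalgebra D F)ᵒᵖ) :
    QuasiSeparatedSpace ((fgDiagram z).obj B) :=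
  inferInstanceAs (QuasiSeparatedSpace ↥(baseScheme z B.unop.1))

/-- A morphism from the base change of `Z` to `F` to a scheme locally of finite presentation is
defined over a finitely generated subalgebra of `F`. -/
theorem exists_hom_of_fg [QuasiCompact z] [QuasiSeparated z] {S X : Scheme.{u}} (w : Z ⟶ S)
    (f : X ⟶ S) [LocallyOfFinitePresentation f] (a : ZF ⟶ X) (ha : a ≫ f = p ≫ w) :
    ∃ B : Subalgebra D F, B.FG ∧ ∃ g : baseScheme z B ⟶ X,
      toBaseScheme z hp B ≫ g = a ∧ g ≫ f = pullback.fst _ _ ≫ w := by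
  obtain ⟨hc⟩ := nonempty_isLimit_fgCone z hp
  let t : fgDiagram (F := F) z ⟶ (Functor.const _).obj S :=
    { app := fun B ↦ pullback.fst z (baseMap D B.unop.1) ≫ w
      naturality := fun _ _ f ↦ (Category.assoc _ _ _).symm.trans
        ((congrArg (· ≫ w) (baseSchemeMap_fst z _)).trans (Category.comp_id _).symm) }
  obtain ⟨B, g, hg, hgf⟩ := Scheme.exists_π_app_comp_eq_of_locallyOfFinitePresentation
    (fgDiagram z) t f (fgCone z hp) hc a (by
      ext B : 2
      refine Eq.trans ?_ ha.symm
      exact (Category.assoc _ _ _).symm.trans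
        (congrArg (· ≫ w) (toBaseScheme_fst z hp B.unop.1)))
  exact ⟨B.unop.1, B.unop.2, g, hg, hgf⟩

include hp in
/-- Two morphisms on `Z` that agree over `F` agree over a finitely generated subalgebra. -/
theorem exists_eq_of_fg [QuasiCompact z] {S X : Scheme.{u}}
    (f : X ⟶ S) [LocallyOfFiniteType f] (a b : Z ⟶ X) (hab : a ≫ f = b ≫ f)
    (h : p ≫ a = p ≫ b) : ∃ B : Subalgebra D F, B.FG ∧
      pullback.fst z (baseMap D B) ≫ a = pullback.fst z (baseMap D B) ≫ b := by
  obtain ⟨hc⟩ := nonempty_isLimit_fgCone z hp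
  let t : fgDiagram (F := F) z ⟶ (Functor.const _).obj S :=
    { app := fun B ↦ pullback.fst z (baseMap D B.unop.1) ≫ a ≫ f
      naturality := fun _ _ g ↦ (Category.assoc _ _ _).symm.trans
        ((congrArg (· ≫ a ≫ f) (baseSchemeMap_fst z _)).trans (Category.comp_id _).symm) }
  let B₀ : (FGSubalgebra D F)ᵒᵖ := op (Classical.arbitrary _)
  obtain ⟨B, i, hB⟩ := Scheme.exists_hom_comp_eq_comp_of_locallyOfFiniteType
    (fgDiagram z) t f (fgCone z hp) hc (i := B₀) (pullback.fst z (baseMap D B₀.unop.1) ≫ a)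
    (pullback.fst z (baseMap D B₀.unop.1) ≫ b) (Category.assoc _ _ _).symm
    ((congrArg _ hab).trans (Category.assoc _ _ _).symm)
    ((Category.assoc _ _ _).symm.trans ((congrArg (· ≫ a) (toBaseScheme_fst z hp _)).trans
      (h.trans ((Category.assoc _ _ _).symm.trans
        (congrArg (· ≫ b) (toBaseScheme_fst z hp _))).symm)))
  refine ⟨B.unop.1, B.unop.2, ?_⟩
  have h1 := baseSchemeMap_fst z (Subalgebra.inclusion (leOfHom i.unop))
  rw [← h1, Category.assoc, Category.assoc]
  exact hB

/-- A quasi-compact open subset of the base change of `Z` to `F` is defined over a finitely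
generated subalgebra of `F`. -/
theorem exists_opens_of_fg [QuasiCompact z] [QuasiSeparated z] (U : ZF.Opens)
    (hU : IsCompact (U : Set ZF)) : ∃ B : Subalgebra D F, B.FG ∧ ∃ U' : (baseScheme z B).Opens,
      IsCompact (U' : Set (baseScheme z B)) ∧ toBaseScheme z hp B ⁻¹ᵁ U' = U := by
  obtain ⟨hc⟩ := nonempty_isLimit_fgCone z hp
  obtain ⟨B, U', h⟩ := exists_preimage_eq (fgDiagram z) (fgCone z hp) hc U hU
  exact ⟨B.unop.1, B.unop.2, U', h⟩

theorem exists_affineOpens_of_fg [QuasiCompact z] [QuasiSeparated z] (U : ZF.Opens)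
    (hU : IsAffineOpen U) : ∃ B : Subalgebra D F, B.FG ∧ ∃ U' : (baseScheme z B).Opens,
      IsAffineOpen U' ∧ toBaseScheme z hp B ⁻¹ᵁ U' = U := by
  obtain ⟨hc⟩ := nonempty_isLimit_fgCone z hp
  obtain ⟨B, U', h⟩ := exists_isAffineOpen_preimage_eq (fgDiagram z) (fgCone z hp) hc U hU
  exact ⟨B.unop.1, B.unop.2, U', h⟩

include hp in
/-- An open subset of `Z` that contains the image of the base change to `F` contains the image of
the base change to a finitely generated subalgebra. -/
theorem exists_preimage_eq_top_of_fg [QuasiCompact z] (U : Z.Opens) (hU : p ⁻¹ᵁ U = ⊤) :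
    ∃ B : Subalgebra D F, B.FG ∧ pullback.fst z (baseMap D B) ⁻¹ᵁ U = ⊤ := by
  obtain ⟨hc⟩ := nonempty_isLimit_fgCone z hp
  let B₀ : (FGSubalgebra D F)ᵒᵖ := op (Classical.arbitrary _)
  obtain ⟨B, i, hB⟩ := exists_map_eq_top (fgDiagram z) (fgCone z hp) hc (i := B₀)
    (pullback.fst z (baseMap D B₀.unop.1) ⁻¹ᵁ U)
    (((Scheme.Hom.comp_preimage _ _ _).symm.trans
      (congrArg (· ⁻¹ᵁ U) (toBaseScheme_fst z hp _))).trans hU)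
  refine ⟨B.unop.1, B.unop.2, ?_⟩
  rw [← baseSchemeMap_fst z (Subalgebra.inclusion (leOfHom i.unop)), Scheme.Hom.comp_preimage]
  exact hB

end Spreading

/-! ### Gluing cartesian squares along two open subschemes -/

section Glue

/-- The open cover given by two jointly surjective open immersions. -/
def pairCover {Z U W : Scheme.{u}} (i : U ⟶ Z) (j : W ⟶ Z) [IsOpenImmersion i]
    [IsOpenImmersion j] (h : i.opensRange ⊔ j.opensRange = ⊤) : Z.OpenCover where
  I₀ := Bool
  X b := Bool.rec W U b
  f b := Bool.rec j i b
  mem₀ := by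
    rw [Scheme.presieve₀_mem_precoverage_iff]
    refine ⟨fun x ↦ ?_, fun b ↦ by cases b <;> assumption⟩
    have hx : x ∈ i.opensRange ⊔ j.opensRange := h ▸ trivial
    obtain hx | hx := hx
    · exact ⟨true, hx⟩
    · exact ⟨false, hx⟩

variable {Z U W : Scheme.{u}} (i : U ⟶ Z) (j : W ⟶ Z) [IsOpenImmersion i] [IsOpenImmersion j]
  (h : i.opensRange ⊔ j.opensRange = ⊤)

include h in
theorem hom_ext_of_pair {T : Scheme.{u}} {a b : Z ⟶ T} (hi : i ≫ a = i ≫ b)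
    (hj : j ≫ a = j ≫ b) : a = b :=
  (pairCover i j h).hom_ext _ _ fun c ↦ by cases c <;> assumption

include h in
theorem exists_hom_of_pair {T P : Scheme.{u}} {l : P ⟶ U} {m : P ⟶ W} (hP : IsPullback l m i j)
    (a : U ⟶ T) (b : W ⟶ T) (hab : l ≫ a = m ≫ b) : ∃ c : Z ⟶ T, i ≫ c = a ∧ j ≫ c = b := by
  let f (c : Bool) : (pairCover i j h).X c ⟶ T := Bool.rec b a c
  have hf (c d : Bool) : pullback.fst ((pairCover i j h).f c) ((pairCover i j h).f d) ≫ f c =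
      pullback.snd _ _ ≫ f d := by
    cases c <;> cases d
    · have := pullback.condition (f := j) (g := j)
      rw [cancel_mono] at this
      exact congrArg (· ≫ b) this
    · have h1 : IsPullback m l j i := hP.flip
      change pullback.fst j i ≫ b = pullback.snd j i ≫ a
      rw [← cancel_epi h1.isoPullback.hom, h1.isoPullback_hom_fst_assoc,
        h1.isoPullback_hom_snd_assoc, hab]
    · change pullback.fst i j ≫ a = pullback.snd i j ≫ b
      rw [← cancel_epi hP.isoPullback.hom, hP.isoPullback_hom_fst_assoc,
        hP.isoPullback_hom_snd_assoc, hab]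
    · have := pullback.condition (f := i) (g := i)
      rw [cancel_mono] at this
      exact congrArg (· ≫ a) this
  exact ⟨(pairCover i j h).glueMorphisms f hf, (pairCover i j h).ι_glueMorphisms f hf true,
    (pairCover i j h).ι_glueMorphisms f hf false⟩

section Pushout

variable {P Y₁ Y₂ : Scheme.{u}} (o₁ : P ⟶ Y₁) (o₂ : P ⟶ Y₂) [IsOpenImmersion o₁]
  [IsOpenImmersion o₂]

instance : IsOpenImmersion (pushout.inl o₁ o₂) :=
  inferInstanceAs (IsOpenImmersion (colimit.ι (span o₁ o₂) WalkingSpan.left))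

instance : IsOpenImmersion (pushout.inr o₁ o₂) :=
  inferInstanceAs (IsOpenImmersion (colimit.ι (span o₁ o₂) WalkingSpan.right))

theorem opensRange_pushout :
    (pushout.inl o₁ o₂).opensRange ⊔ (pushout.inr o₁ o₂).opensRange = ⊤ := by
  rw [eq_top_iff]
  intro x _
  obtain ⟨c, y, rfl⟩ := Scheme.IsLocallyDirected.ι_jointly_surjective (span o₁ o₂) x
  obtain _ | _ | _ := c
  · refine Or.inl ⟨o₁ y, ?_⟩
    have := colimit.w (span o₁ o₂) WalkingSpan.Hom.fst
    rw [← this]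
    rfl
  · exact Or.inl ⟨y, rfl⟩
  · exact Or.inr ⟨y, rfl⟩

theorem exists_of_pushout_inl_eq_inr {x : Y₁} {y : Y₂}
    (e : pushout.inl o₁ o₂ x = pushout.inr o₁ o₂ y) : ∃ p : P, o₁ p = x ∧ o₂ p = y := by
  obtain ⟨k, f, g, p, hp, hq⟩ := (Scheme.IsLocallyDirected.ι_eq_ι_iff (span o₁ o₂)
    (i := WalkingSpan.left) (j := WalkingSpan.right) (xi := x) (xj := y)).mp e
  obtain _ | _ | _ := k
  · obtain rfl : f = WalkingSpan.Hom.fst := Subsingleton.elim _ _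
    obtain rfl : g = WalkingSpan.Hom.snd := Subsingleton.elim _ _
    exact ⟨p, hp, hq⟩
  · replace g : WidePushoutShape.Hom (some WalkingPair.left) (some WalkingPair.right) := g
    cases g
  · replace f : WidePushoutShape.Hom (some WalkingPair.right) (some WalkingPair.left) := f
    cases f

end Pushout

include h in
/-- Two cartesian squares over `b : T' ⟶ T` whose sources are the members of an open cover of `Z`,
and whose targets are identified along open subschemes compatibly with the overlap, glue to a
cartesian square with source `Z`. -/
theorem exists_isPullback_of_pair {T T' P Q Y₁ Y₂ : Scheme.{u}} {b : T' ⟶ T} (z : Z ⟶ T')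
    {q₁ : U ⟶ Y₁} {y₁ : Y₁ ⟶ T} (h₁ : IsPullback q₁ (i ≫ z) y₁ b)
    {q₂ : W ⟶ Y₂} {y₂ : Y₂ ⟶ T} (h₂ : IsPullback q₂ (j ≫ z) y₂ b)
    {l : P ⟶ U} {m : P ⟶ W} (hP : IsPullback l m i j)
    (o₁ : Q ⟶ Y₁) (o₂ : Q ⟶ Y₂) [IsOpenImmersion o₁] [IsOpenImmersion o₂]
    (ho : o₁ ≫ y₁ = o₂ ≫ y₂) (r : P ⟶ Q) (hr₁ : r ≫ o₁ = l ≫ q₁) (hr₂ : r ≫ o₂ = m ≫ q₂)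
    (hl : q₁ ⁻¹ᵁ o₁.opensRange ≤ i ⁻¹ᵁ j.opensRange)
    (hm : q₂ ⁻¹ᵁ o₂.opensRange ≤ j ⁻¹ᵁ i.opensRange) :
    ∃ (Y : Scheme.{u}) (y : Y ⟶ T) (q : Z ⟶ Y) (j₁ : Y₁ ⟶ Y) (j₂ : Y₂ ⟶ Y)
      (_ : IsOpenImmersion j₁) (_ : IsOpenImmersion j₂), IsPullback q z y b ∧
      j₁.opensRange ⊔ j₂.opensRange = ⊤ ∧ j₁ ≫ y = y₁ ∧ j₂ ≫ y = y₂ ∧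
      i ≫ q = q₁ ≫ j₁ ∧ j ≫ q = q₂ ≫ j₂ := by
  obtain ⟨q, hq₁, hq₂⟩ := exists_hom_of_pair i j h hP (q₁ ≫ pushout.inl o₁ o₂)
    (q₂ ≫ pushout.inr o₁ o₂) (by
      rw [← Category.assoc, ← Category.assoc, ← hr₁, ← hr₂, Category.assoc, Category.assoc,
        pushout.condition])
  let y := pushout.desc y₁ y₂ ho
  have hy₁ : pushout.inl o₁ o₂ ≫ y = y₁ := pushout.inl_desc _ _ _
  have hy₂ : pushout.inr o₁ o₂ ≫ y = y₂ := pushout.inr_desc _ _ _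
  have hZ (x : Z) : x ∈ i.opensRange ∨ x ∈ j.opensRange :=
    show x ∈ i.opensRange ⊔ j.opensRange from h ▸ trivial
  -- The preimages of the two members of the cover of the pushout are the given opens of `Z`.
  have e₁ : q ⁻¹ᵁ (pushout.inl o₁ o₂).opensRange = i.opensRange := by
    refine le_antisymm (fun x hx ↦ ?_) ?_
    · obtain hxi | ⟨w, rfl⟩ := hZ x
      · exact hxi
      · obtain ⟨t, ht⟩ := hx
        obtain ⟨p, -, hp⟩ := exists_of_pushout_inl_eq_inr o₁ o₂ (x := t) (y := q₂ w) <|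
          ht.trans (by rw [← Scheme.Hom.comp_apply, hq₂, Scheme.Hom.comp_apply])
        exact hm ⟨p, hp⟩
    · rintro _ ⟨u, rfl⟩
      exact ⟨q₁ u, by rw [← Scheme.Hom.comp_apply, ← hq₁, Scheme.Hom.comp_apply]⟩
  have e₂ : q ⁻¹ᵁ (pushout.inr o₁ o₂).opensRange = j.opensRange := by
    refine le_antisymm (fun x hx ↦ ?_) ?_
    · obtain ⟨w, rfl⟩ | hxi := hZ x
      · obtain ⟨t, ht⟩ := hx
        obtain ⟨p, hp, -⟩ := exists_of_pushout_inl_eq_inr o₁ o₂ (x := q₁ w) (y := t) <|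
          (by rw [← Scheme.Hom.comp_apply, ← hq₁, Scheme.Hom.comp_apply]; exact ht.symm)
        exact hl ⟨p, hp⟩
      · exact hxi
    · rintro _ ⟨u, rfl⟩
      exact ⟨q₂ u, by rw [← Scheme.Hom.comp_apply, ← hq₂, Scheme.Hom.comp_apply]⟩
  have s₁ : IsPullback q₁ i (pushout.inl o₁ o₂) q := IsOpenImmersion.isPullback _ _ _ _ hq₁ e₁
  have s₂ : IsPullback q₂ j (pushout.inr o₁ o₂) q := IsOpenImmersion.isPullback _ _ _ _ hq₂ e₂
  refine ⟨pushout o₁ o₂, y, q, _, _, inferInstance, inferInstance, ?_, opensRange_pushout o₁ o₂,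
    hy₁, hy₂, hq₁, hq₂⟩
  have aux {A B : Scheme.{u}} {f : A ⟶ pushout o₁ o₂} {g : B ⟶ A} {k : B ⟶ Z}
      (sq : IsPullback g k f q) (hh : IsPullback g (k ≫ z) (f ≫ y) b) :
      IsPullback (pullback.snd q f) (pullback.fst q f ≫ z) (f ≫ y) b := by
    refine hh.of_iso sq.flip.isoPullback (Iso.refl _) (Iso.refl _) (Iso.refl _) ?_ ?_ ?_ ?_ <;>
    simp
  refine Scheme.isPullback_of_openCover _ _ _ _ (pairCover _ _ (opensRange_pushout o₁ o₂)) ?_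
  rintro (_ | _)
  · exact aux s₂ (hy₂ ▸ h₂)
  · exact aux s₁ (hy₁ ▸ h₁)

end Glue

/-! ### Models over finitely generated subalgebras -/

section Model

variable (D : Type u) {F : Type u} [CommRing D] [CommRing F] [Algebra D F]

/-- A scheme `X` over `F` has a model of finite type over the ring `D`. -/
def HasModel {X : Scheme.{u}} (x : X ⟶ Spec (CommRingCat.of F)) : Prop :=
  ∃ (Y : Scheme.{u}) (y : Y ⟶ Spec (CommRingCat.of D)) (m : X ⟶ Y),
    IsPullback m x y (baseMap D F) ∧ LocallyOfFiniteType y ∧ CompactSpace Y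

/-- A scheme over `F` has a model of finite type over some finitely generated `D`-subalgebra
of `F`. -/
def HasFGModel {X : Scheme.{u}} (x : X ⟶ Spec (CommRingCat.of F)) : Prop :=
  ∃ B : Subalgebra D F, B.FG ∧ HasModel B x

variable {D}

theorem HasModel.mono {X : Scheme.{u}} {x : X ⟶ Spec (CommRingCat.of F)} {B C : Subalgebra D F}
    (hx : HasModel B x) (hBC : B ≤ C) : HasModel C x := by
  obtain ⟨Y, y, m, hm, _, _⟩ := hx
  let φ := Spec.map (CommRingCat.ofHom (Subalgebra.inclusion hBC).toRingHom)
  have hφ : baseMap C F ≫ φ = baseMap B F := (Spec.map_comp _ _).symm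
  have w : m ≫ y = (x ≫ baseMap C F) ≫ φ := by rw [Category.assoc, hφ, hm.w]
  refine ⟨pullback y φ, pullback.snd _ _, pullback.lift m (x ≫ baseMap C F) w,
    IsPullback.of_right ?_ (pullback.lift_snd _ _ _) (IsPullback.of_hasPullback y φ),
    inferInstance, QuasiCompact.compactSpace_of_compactSpace (pullback.snd y φ)⟩
  rw [pullback.lift_fst, hφ]
  exact hm

theorem HasFGModel.trans {X : Scheme.{u}} {x : X ⟶ Spec (CommRingCat.of F)} {B : Subalgebra D F}
    (hB : B.FG) (h : HasFGModel B x) : HasFGModel D x := by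
  obtain ⟨C, hC, h⟩ := h
  have := (Subalgebra.fg_iff_finiteType _).mp hB
  have : Algebra.FiniteType B C := (Subalgebra.fg_iff_finiteType _).mp hC
  have : Algebra.FiniteType D C := .trans (S := B) inferInstance inferInstance
  exact ⟨C.restrictScalars D, (Subalgebra.fg_iff_finiteType _).mpr this, h⟩

/-- An affine scheme of finite presentation is defined by finitely many coefficients. -/
theorem hasFGModel_of_isAffine {X : Scheme.{u}} [IsAffine X] (x : X ⟶ Spec (CommRingCat.of F))
    [LocallyOfFinitePresentation x] : HasFGModel D x := by
  let S := Γ(X, ⊤)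
  let φ : CommRingCat.of F ⟶ S := coordHom x
  have hφ : X.isoSpec.hom ≫ Spec.map φ = x := toSpecΓ_coordHom x
  have : LocallyOfFinitePresentation (Spec.map φ) := by
    have : Spec.map φ = X.isoSpec.inv ≫ x := by rw [← hφ, Iso.inv_hom_id_assoc]
    rw [this]
    infer_instance
  have hfp : φ.hom.FinitePresentation := LocallyOfFinitePresentation.SpecMap_iff φ |>.mp this
  let : Algebra F S := φ.hom.toAlgebra
  have : Algebra.FinitePresentation F S := hfp
  obtain ⟨n, k, ⟨P⟩⟩ := Algebra.Presentation.exists_presentation_fin F S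
  let B : Subalgebra D F := Algebra.adjoin D P.coeffs
  have hB : B.FG := Subalgebra.fg_def.mpr ⟨P.coeffs, P.finite_coeffs, rfl⟩
  have : P.HasCoeffs B := ⟨fun c hc ↦ ⟨⟨c, Algebra.subset_adjoin hc⟩, rfl⟩⟩
  let M := P.ModelOfHasCoeffs B
  let e := P.tensorModelOfHasCoeffsEquiv B
  let ψ : M →+* S := e.toRingEquiv.toRingHom.comp
    (Algebra.TensorProduct.includeRight (R := B) (A := F) (B := M)).toRingHom
  have hpush : IsPushout (CommRingCat.ofHom (algebraMap B F)) (CommRingCat.ofHom (algebraMap B M))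
      φ (CommRingCat.ofHom ψ) := by
    refine (CommRingCat.isPushout_tensorProduct B F M).of_iso (Iso.refl _) (Iso.refl _)
      (Iso.refl _) e.toRingEquiv.toCommRingCatIso ?_ ?_ ?_ ?_
    · rfl
    · rfl
    · ext c
      exact e.commutes c
    · rfl
  refine ⟨B, hB, Spec (CommRingCat.of M), Spec.map (CommRingCat.ofHom (algebraMap B M)),
    X.isoSpec.hom ≫ Spec.map (CommRingCat.ofHom ψ), ?_, ?_, inferInstance⟩
  · refine (isPullback_SpecMap_of_isPushout _ _ _ _ hpush.flip).of_iso X.isoSpec.symm (Iso.refl _)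
      (Iso.refl _) (Iso.refl _) ?_ ?_ ?_ ?_
    · simp
    · simp [← hφ]
    · simp
    · simp
  · have : LocallyOfFinitePresentation (Spec.map (CommRingCat.ofHom (algebraMap B M))) := by
      rw [LocallyOfFinitePresentation.SpecMap_iff]
      exact RingHom.finitePresentation_algebraMap.mpr inferInstance
    infer_instance

theorem isNoetherian_of_locallyOfFiniteType [IsNoetherianRing D] {Y : Scheme.{u}}
    (y : Y ⟶ Spec (CommRingCat.of D)) [LocallyOfFiniteType y] [CompactSpace Y] :
    IsNoetherian Y :=
  have := LocallyOfFiniteType.isLocallyNoetherian y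
  ⟨⟩

/-- Functoriality of base change. -/
def baseSchemeHom {Z W : Scheme.{u}} {z : Z ⟶ Spec (CommRingCat.of D)}
    {w : W ⟶ Spec (CommRingCat.of D)} (f : Z ⟶ W) (hf : f ≫ w = z) (B : Type u) [CommRing B]
    [Algebra D B] : baseScheme z B ⟶ baseScheme w B :=
  pullback.lift (pullback.fst _ _ ≫ f) (pullback.snd _ _)
    (by rw [Category.assoc, hf, pullback.condition])

section

variable {Z W : Scheme.{u}} {z : Z ⟶ Spec (CommRingCat.of D)}
    {w : W ⟶ Spec (CommRingCat.of D)} (f : Z ⟶ W) (hf : f ≫ w = z) (B : Type u) [CommRing B]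
    [Algebra D B]

@[simp]
theorem baseSchemeHom_fst :
    baseSchemeHom f hf B ≫ pullback.fst _ _ = pullback.fst _ _ ≫ f := pullback.lift_fst _ _ _

@[simp]
theorem baseSchemeHom_snd :
    baseSchemeHom f hf B ≫ pullback.snd _ _ = pullback.snd _ _ := pullback.lift_snd _ _ _

theorem isPullback_baseSchemeHom : IsPullback (pullback.fst z (baseMap D B))
    (baseSchemeHom f hf B) f (pullback.fst w (baseMap D B)) := by
  refine IsPullback.of_bot ?_ (baseSchemeHom_fst f hf B).symm
    (IsPullback.of_hasPullback w (baseMap D B))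
  rw [baseSchemeHom_snd, hf]
  exact IsPullback.of_hasPullback _ _

instance [IsOpenImmersion f] : IsOpenImmersion (baseSchemeHom f hf B) :=
  MorphismProperty.of_isPullback (isPullback_baseSchemeHom f hf B) ‹_›

theorem toBaseScheme_baseSchemeHom {ZF WF : Scheme.{u}} {p : ZF ⟶ Z} {q : WF ⟶ W}
    {zF : ZF ⟶ Spec (CommRingCat.of F)} {wF : WF ⟶ Spec (CommRingCat.of F)}
    (hp : IsPullback p zF z (baseMap D F)) (hq : IsPullback q wF w (baseMap D F))
    (e : ZF ⟶ WF) (he : e ≫ wF = zF) (hpq : p ≫ f = e ≫ q) (C : Subalgebra D F) :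
    toBaseScheme z hp C ≫ baseSchemeHom f hf C = e ≫ toBaseScheme w hq C := by
  apply pullback.hom_ext
  · rw [Category.assoc, baseSchemeHom_fst, ← Category.assoc, toBaseScheme_fst, Category.assoc,
      toBaseScheme_fst, hpq]
  · rw [Category.assoc, baseSchemeHom_snd, toBaseScheme_snd, Category.assoc, toBaseScheme_snd,
      ← Category.assoc, he]

end

section Pair

variable {X S U P : Scheme.{u}} {x : X ⟶ Spec (CommRingCat.of F)} {i : S ⟶ X} {j : U ⟶ X}
  [IsOpenImmersion i] [IsOpenImmersion j] {l : P ⟶ S} {m : P ⟶ U}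

omit [IsOpenImmersion i] in
theorem isPullback_overlap {Y₁ Q₁ : Scheme.{u}} {y₁ : Y₁ ⟶ Spec (CommRingCat.of D)} {q₁ : S ⟶ Y₁}
    (h₁ : IsPullback q₁ (i ≫ x) y₁ (baseMap D F)) {o₁ : Q₁ ⟶ Y₁} {r₁ : P ⟶ Q₁}
    (hr₁ : IsPullback r₁ l o₁ q₁) :
    IsPullback r₁ (l ≫ i ≫ x) (o₁ ≫ y₁) (baseMap D F) :=
  hr₁.paste_vert h₁

omit [IsOpenImmersion i] in
theorem preimage_opensRange_le (hP : IsPullback l m i j) {Y₁ Q₁ : Scheme.{u}} {q₁ : S ⟶ Y₁}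
    {o₁ : Q₁ ⟶ Y₁} [IsOpenImmersion o₁] {r₁ : P ⟶ Q₁} (hr₁ : IsPullback r₁ l o₁ q₁) :
    q₁ ⁻¹ᵁ o₁.opensRange ≤ i ⁻¹ᵁ j.opensRange := by
  rintro s ⟨t, ht⟩
  obtain ⟨p, -, rfl⟩ := Scheme.Pullback.exists_preimage_pullback t s ht
  refine ⟨m (hr₁.isoPullback.inv p), ?_⟩
  rw [← Scheme.Hom.comp_apply, ← Scheme.Hom.comp_apply, ← Scheme.Hom.comp_apply, ← hP.w,
    hr₁.isoPullback_inv_snd_assoc]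

/-- Models on the members of an open cover that agree on the overlap glue. -/
theorem HasModel.of_pair (h : i.opensRange ⊔ j.opensRange = ⊤) (hP : IsPullback l m i j)
    {Y₁ Y₂ Q₁ Q₂ : Scheme.{u}} {y₁ : Y₁ ⟶ Spec (CommRingCat.of D)}
    {y₂ : Y₂ ⟶ Spec (CommRingCat.of D)} [LocallyOfFiniteType y₁] [LocallyOfFiniteType y₂]
    [CompactSpace Y₁] [CompactSpace Y₂] {q₁ : S ⟶ Y₁} {q₂ : U ⟶ Y₂}
    (h₁ : IsPullback q₁ (i ≫ x) y₁ (baseMap D F)) (h₂ : IsPullback q₂ (j ≫ x) y₂ (baseMap D F))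
    {o₁ : Q₁ ⟶ Y₁} {o₂ : Q₂ ⟶ Y₂} [IsOpenImmersion o₁] [IsOpenImmersion o₂] {r₁ : P ⟶ Q₁}
    {r₂ : P ⟶ Q₂} (hr₁ : IsPullback r₁ l o₁ q₁) (hr₂ : IsPullback r₂ m o₂ q₂) (f : Q₁ ≅ Q₂)
    (hf : r₁ ≫ f.hom = r₂) (hfy : f.hom ≫ o₂ ≫ y₂ = o₁ ≫ y₁) : HasModel D x := by
  obtain ⟨Y, y, q, j₁, j₂, _, _, hY, hj, hy₁, hy₂, -, -⟩ := exists_isPullback_of_pair i j h x h₁ h₂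
    hP o₁ (f.hom ≫ o₂) (by rw [Category.assoc, hfy]) r₁ hr₁.w
    (by rw [← Category.assoc, hf, hr₂.w]) (preimage_opensRange_le hP hr₁) (by
      have : (f.hom ≫ o₂).opensRange = o₂.opensRange := by
        ext t
        constructor
        · rintro ⟨s, rfl⟩
          exact ⟨f.hom s, (Scheme.Hom.comp_apply _ _ _).symm⟩
        · rintro ⟨s, rfl⟩
          refine ⟨f.inv s, ?_⟩
          rw [← Scheme.Hom.comp_apply, Iso.inv_hom_id_assoc]
      rw [this]
      exact preimage_opensRange_le hP.flip hr₂)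
  refine ⟨Y, y, q, hY, ?_, ?_⟩
  · have := HasRingHomProperty.instIsZariskiLocalAtSource (P := @LocallyOfFiniteType.{u})
    refine (IsZariskiLocalAtSource.iff_of_openCover (P := @LocallyOfFiniteType)
      (pairCover j₁ j₂ hj)).mpr ?_
    rintro (_ | _)
    · change LocallyOfFiniteType (j₂ ≫ y)
      rwa [hy₂]
    · change LocallyOfFiniteType (j₁ ≫ y)
      rwa [hy₁]
  · refine ⟨?_⟩
    have h1 : IsCompact (Set.range j₁) := isCompact_range j₁.continuous
    have h2 : IsCompact (Set.range j₂) := isCompact_range j₂.continuous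
    convert! h1.union h2
    exact congr(($hj).1).symm

variable [IsNoetherianRing D]

/-- Models `Y₁` and `Y₂` of the members of an open cover glue if their open subschemes `Q₁` and `Q₂`
that model the overlap are related by morphisms inverse to each other over `F`: they are then inverse
to each other over a finitely generated subalgebra. -/
theorem HasFGModel.of_pair_of_hom (h : i.opensRange ⊔ j.opensRange = ⊤) (hP : IsPullback l m i j)
    {Y₁ Y₂ Q₁ Q₂ : Scheme.{u}} {y₁ : Y₁ ⟶ Spec (CommRingCat.of D)}
    {y₂ : Y₂ ⟶ Spec (CommRingCat.of D)} [LocallyOfFiniteType y₁] [LocallyOfFiniteType y₂]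
    [CompactSpace Y₁] [CompactSpace Y₂] {q₁ : S ⟶ Y₁} {q₂ : U ⟶ Y₂}
    (h₁ : IsPullback q₁ (i ≫ x) y₁ (baseMap D F)) (h₂ : IsPullback q₂ (j ≫ x) y₂ (baseMap D F))
    {o₁ : Q₁ ⟶ Y₁} {o₂ : Q₂ ⟶ Y₂} [IsOpenImmersion o₁] [IsOpenImmersion o₂] {r₁ : P ⟶ Q₁}
    {r₂ : P ⟶ Q₂} (hr₁ : IsPullback r₁ l o₁ q₁) (hr₂ : IsPullback r₂ m o₂ q₂) (f : Q₁ ⟶ Q₂)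
    (g : Q₂ ⟶ Q₁) (hf : r₁ ≫ f = r₂) (hg : r₂ ≫ g = r₁) (hfy : f ≫ o₂ ≫ y₂ = o₁ ≫ y₁)
    (hgy : g ≫ o₁ ≫ y₁ = o₂ ≫ y₂) : HasFGModel D x := by
  have := isNoetherian_of_locallyOfFiniteType y₁
  have := isNoetherian_of_locallyOfFiniteType y₂
  have e₁ := isPullback_overlap h₁ hr₁
  have e₂ := isPullback_overlap h₂ hr₂
  obtain ⟨B₁, hB₁, hfg⟩ := exists_eq_of_fg (o₁ ≫ y₁) e₁ (o₁ ≫ y₁) (f ≫ g) (𝟙 _)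
    (by rw [Category.assoc, hgy, hfy, Category.id_comp])
    (by rw [← Category.assoc, hf, hg, Category.comp_id])
  obtain ⟨B₂, hB₂, hgf⟩ := exists_eq_of_fg (o₂ ≫ y₂) e₂ (o₂ ≫ y₂) (g ≫ f) (𝟙 _)
    (by rw [Category.assoc, hfy, hgy, Category.id_comp])
    (by rw [← Category.assoc, hg, hf, Category.comp_id])
  let B := B₁ ⊔ B₂
  replace hfg : pullback.fst (o₁ ≫ y₁) (baseMap D B) ≫ f ≫ g = pullback.fst _ _ := by
    rw [← baseSchemeMap_fst _ (Subalgebra.inclusion (le_sup_left : B₁ ≤ B)), Category.assoc, hfg,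
      Category.comp_id]
  replace hgf : pullback.fst (o₂ ≫ y₂) (baseMap D B) ≫ g ≫ f = pullback.fst _ _ := by
    rw [← baseSchemeMap_fst _ (Subalgebra.inclusion (le_sup_right : B₂ ≤ B)), Category.assoc, hgf,
      Category.comp_id]
  let φ : baseScheme (o₁ ≫ y₁) B ≅ baseScheme (o₂ ≫ y₂) B :=
    { hom := baseSchemeHom f hfy B
      inv := baseSchemeHom g hgy B
      hom_inv_id := by
        apply pullback.hom_ext
        · rw [Category.assoc, baseSchemeHom_fst, ← Category.assoc, baseSchemeHom_fst,
            Category.assoc, hfg, Category.id_comp]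
        · rw [Category.assoc, baseSchemeHom_snd, baseSchemeHom_snd, Category.id_comp]
      inv_hom_id := by
        apply pullback.hom_ext
        · rw [Category.assoc, baseSchemeHom_fst, ← Category.assoc, baseSchemeHom_fst,
            Category.assoc, hgf, Category.id_comp]
        · rw [Category.assoc, baseSchemeHom_snd, baseSchemeHom_snd, Category.id_comp] }
  have k₁ : IsPullback (toBaseScheme _ e₁ B) l (baseSchemeHom o₁ rfl B) (toBaseScheme _ h₁ B) := by
    refine IsPullback.of_right ?_ (toBaseScheme_baseSchemeHom o₁ rfl e₁ h₁ l rfl hr₁.w B)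
      (isPullback_baseSchemeHom o₁ rfl B)
    rw [toBaseScheme_fst, toBaseScheme_fst]
    exact hr₁
  have k₂ : IsPullback (toBaseScheme _ e₂ B) m (baseSchemeHom o₂ rfl B) (toBaseScheme _ h₂ B) := by
    refine IsPullback.of_right ?_ (toBaseScheme_baseSchemeHom o₂ rfl e₂ h₂ m rfl hr₂.w B)
      (isPullback_baseSchemeHom o₂ rfl B)
    rw [toBaseScheme_fst, toBaseScheme_fst]
    exact hr₂
  refine ⟨B, hB₁.sup hB₂, HasModel.of_pair h hP (isPullback_toBaseScheme _ h₁ B)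
    (isPullback_toBaseScheme _ h₂ B) k₁ k₂ φ ?_ ?_⟩
  · rw [toBaseScheme_baseSchemeHom f hfy e₁ e₂ (𝟙 _) ?_ (by rw [hf, Category.id_comp]),
      Category.id_comp]
    rw [Category.id_comp, ← Category.assoc, ← Category.assoc, hP.w]
  · rw [baseSchemeHom_snd, baseSchemeHom_snd, baseSchemeHom_snd]

/-- Models `Y₁` and `Y₂` of the members of an open cover glue if the overlap is modelled by open
subschemes of both: the identification of these is defined over a finitely generated subalgebra. -/
theorem HasFGModel.of_pair_of_overlap (h : i.opensRange ⊔ j.opensRange = ⊤)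
    (hP : IsPullback l m i j)
    {Y₁ Y₂ Q₁ Q₂ : Scheme.{u}} {y₁ : Y₁ ⟶ Spec (CommRingCat.of D)}
    {y₂ : Y₂ ⟶ Spec (CommRingCat.of D)} [LocallyOfFiniteType y₁] [LocallyOfFiniteType y₂]
    [CompactSpace Y₁] [CompactSpace Y₂] {q₁ : S ⟶ Y₁} {q₂ : U ⟶ Y₂}
    (h₁ : IsPullback q₁ (i ≫ x) y₁ (baseMap D F)) (h₂ : IsPullback q₂ (j ≫ x) y₂ (baseMap D F))
    {o₁ : Q₁ ⟶ Y₁} {o₂ : Q₂ ⟶ Y₂} [IsOpenImmersion o₁] [IsOpenImmersion o₂] {r₁ : P ⟶ Q₁}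
    {r₂ : P ⟶ Q₂} (hr₁ : IsPullback r₁ l o₁ q₁) (hr₂ : IsPullback r₂ m o₂ q₂) :
    HasFGModel D x := by
  have := isNoetherian_of_locallyOfFiniteType y₁
  have := isNoetherian_of_locallyOfFiniteType y₂
  have e₁ := isPullback_overlap h₁ hr₁
  have e₂ := isPullback_overlap h₂ hr₂
  have hlm : l ≫ i ≫ x = m ≫ j ≫ x := by rw [← Category.assoc, ← Category.assoc, hP.w]
  have : LocallyOfFinitePresentation (o₁ ≫ y₁) := inferInstance
  have : LocallyOfFinitePresentation (o₂ ≫ y₂) := inferInstance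
  obtain ⟨B₁, hB₁, f, hf, hfy⟩ := exists_hom_of_fg (o₁ ≫ y₁) e₁ (o₁ ≫ y₁) (o₂ ≫ y₂) r₂
    (by rw [e₂.w, e₁.w, hlm])
  obtain ⟨B₂, hB₂, g, hg, hgy⟩ := exists_hom_of_fg (o₂ ≫ y₂) e₂ (o₂ ≫ y₂) (o₁ ≫ y₁) r₁
    (by rw [e₂.w, e₁.w, hlm])
  let B := B₁ ⊔ B₂
  have hB : B.FG := hB₁.sup hB₂
  have := (Subalgebra.fg_iff_finiteType _).mp hB
  have : IsNoetherianRing B := Algebra.FiniteType.isNoetherianRing D B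
  let i₁ := baseSchemeMap (o₁ ≫ y₁) (Subalgebra.inclusion (le_sup_left : B₁ ≤ B))
  let i₂ := baseSchemeMap (o₂ ≫ y₂) (Subalgebra.inclusion (le_sup_right : B₂ ≤ B))
  have k₁ : IsPullback (toBaseScheme _ e₁ B) l (baseSchemeHom o₁ rfl B) (toBaseScheme _ h₁ B) := by
    refine IsPullback.of_right ?_ (toBaseScheme_baseSchemeHom o₁ rfl e₁ h₁ l rfl hr₁.w B)
      (isPullback_baseSchemeHom o₁ rfl B)
    rw [toBaseScheme_fst, toBaseScheme_fst]
    exact hr₁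
  have k₂ : IsPullback (toBaseScheme _ e₂ B) m (baseSchemeHom o₂ rfl B) (toBaseScheme _ h₂ B) := by
    refine IsPullback.of_right ?_ (toBaseScheme_baseSchemeHom o₂ rfl e₂ h₂ m rfl hr₂.w B)
      (isPullback_baseSchemeHom o₂ rfl B)
    rw [toBaseScheme_fst, toBaseScheme_fst]
    exact hr₂
  let f' : baseScheme (o₁ ≫ y₁) B ⟶ baseScheme (o₂ ≫ y₂) B :=
    pullback.lift (i₁ ≫ f) (pullback.snd _ _)
      (by rw [Category.assoc, hfy, ← Category.assoc, baseSchemeMap_fst, pullback.condition])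
  let g' : baseScheme (o₂ ≫ y₂) B ⟶ baseScheme (o₁ ≫ y₁) B :=
    pullback.lift (i₂ ≫ g) (pullback.snd _ _)
      (by rw [Category.assoc, hgy, ← Category.assoc, baseSchemeMap_fst, pullback.condition])
  refine HasFGModel.trans hB (HasFGModel.of_pair_of_hom h hP (isPullback_toBaseScheme _ h₁ B)
    (isPullback_toBaseScheme _ h₂ B) k₁ k₂ f' g' ?_ ?_ ?_ ?_)
  · apply pullback.hom_ext
    · rw [Category.assoc, pullback.lift_fst, ← Category.assoc, toBaseScheme_map, hf,
        toBaseScheme_fst]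
    · rw [Category.assoc, pullback.lift_snd, toBaseScheme_snd, toBaseScheme_snd, hlm]
  · apply pullback.hom_ext
    · rw [Category.assoc, pullback.lift_fst, ← Category.assoc, toBaseScheme_map, hg,
        toBaseScheme_fst]
    · rw [Category.assoc, pullback.lift_snd, toBaseScheme_snd, toBaseScheme_snd, hlm]
  · rw [baseSchemeHom_snd, baseSchemeHom_snd, pullback.lift_snd]
  · rw [baseSchemeHom_snd, baseSchemeHom_snd, pullback.lift_snd]

/-- The source of an open immersion `l` is the base change of `O` if its range is the preimage
of `O`. -/
theorem exists_isPullback_opens_lift {Y : Scheme.{u}} (q : S ⟶ Y) [IsOpenImmersion l] (O : Y.Opens)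
    (hO : q ⁻¹ᵁ O = l.opensRange) : ∃ r : P ⟶ O, IsPullback r l O.ι q := by
  have hr : Set.range (l ≫ q) ⊆ Set.range O.ι := by
    rintro _ ⟨p, rfl⟩
    have : l p ∈ q ⁻¹ᵁ O := hO ▸ ⟨p, rfl⟩
    simpa using this
  refine ⟨IsOpenImmersion.lift O.ι (l ≫ q) hr, IsOpenImmersion.isPullback _ _ _ _
    (IsOpenImmersion.lift_fac _ _ _).symm ?_⟩
  rw [Scheme.Opens.opensRange_ι, hO]

variable [IsNoetherianRing F]

/-- The property of having a model over a finitely generated subalgebra can be checked on the two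
members of an open cover. -/
theorem HasFGModel.sup (h : i.opensRange ⊔ j.opensRange = ⊤) (h₁ : HasFGModel D (i ≫ x))
    (h₂ : HasFGModel D (j ≫ x)) : HasFGModel D x := by
  obtain ⟨B₁, hB₁, h₁⟩ := h₁
  obtain ⟨B₂, hB₂, h₂⟩ := h₂
  have hB := hB₁.sup hB₂
  refine HasFGModel.trans hB ?_
  replace h₁ := h₁.mono (le_sup_left : B₁ ≤ B₁ ⊔ B₂)
  replace h₂ := h₂.mono (le_sup_right : B₂ ≤ B₁ ⊔ B₂)
  have := (Subalgebra.fg_iff_finiteType _).mp hB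
  have : IsNoetherianRing ↥(B₁ ⊔ B₂) := Algebra.FiniteType.isNoetherianRing D _
  generalize B₁ ⊔ B₂ = B at *
  obtain ⟨Y₁, y₁, q₁, h₁, _, _⟩ := h₁
  obtain ⟨Y₂, y₂, q₂, h₂, _, _⟩ := h₂
  have := isNoetherian_of_locallyOfFiniteType y₁
  have := isNoetherian_of_locallyOfFiniteType y₂
  have : LocallyOfFiniteType (i ≫ x) := MorphismProperty.of_isPullback h₁ ‹_›
  have : LocallyOfFiniteType (j ≫ x) := MorphismProperty.of_isPullback h₂ ‹_›
  have : IsAffineHom q₁ := MorphismProperty.of_isPullback h₁.flip inferInstance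
  have : IsAffineHom q₂ := MorphismProperty.of_isPullback h₂.flip inferInstance
  have : CompactSpace S := QuasiCompact.compactSpace_of_compactSpace q₁
  have : CompactSpace U := QuasiCompact.compactSpace_of_compactSpace q₂
  have := isNoetherian_of_locallyOfFiniteType (i ≫ x)
  have := isNoetherian_of_locallyOfFiniteType (j ≫ x)
  have hP := IsPullback.of_hasPullback i j
  set l := pullback.fst i j
  set m := pullback.snd i j
  obtain ⟨C₁, hC₁, O₁, -, hO₁⟩ := exists_opens_of_fg y₁ h₁ l.opensRange
    (TopologicalSpace.NoetherianSpace.isCompact _)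
  obtain ⟨C₂, hC₂, O₂, -, hO₂⟩ := exists_opens_of_fg y₂ h₂ m.opensRange
    (TopologicalSpace.NoetherianSpace.isCompact _)
  have hC := hC₁.sup hC₂
  have := (Subalgebra.fg_iff_finiteType _).mp hC
  have : IsNoetherianRing ↥(C₁ ⊔ C₂) := Algebra.FiniteType.isNoetherianRing B _
  let i₁ := baseSchemeMap y₁ (Subalgebra.inclusion (le_sup_left : C₁ ≤ C₁ ⊔ C₂))
  let i₂ := baseSchemeMap y₂ (Subalgebra.inclusion (le_sup_right : C₂ ≤ C₁ ⊔ C₂))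
  obtain ⟨r₁, hr₁⟩ := exists_isPullback_opens_lift (l := l) (toBaseScheme y₁ h₁ (C₁ ⊔ C₂))
    (i₁ ⁻¹ᵁ O₁) (by rw [← Scheme.Hom.comp_preimage, toBaseScheme_map, hO₁])
  obtain ⟨r₂, hr₂⟩ := exists_isPullback_opens_lift (l := m) (toBaseScheme y₂ h₂ (C₁ ⊔ C₂))
    (i₂ ⁻¹ᵁ O₂) (by rw [← Scheme.Hom.comp_preimage, toBaseScheme_map, hO₂])
  exact HasFGModel.trans hC (HasFGModel.of_pair_of_overlap h hP (isPullback_toBaseScheme y₁ h₁ _)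
    (isPullback_toBaseScheme y₂ h₂ _) hr₁ hr₂)

end Pair

/-- A scheme of finite type over a Noetherian ring `F` has a model over a finitely generated
`D`-subalgebra of `F`. -/
theorem hasFGModel_of_locallyOfFiniteType [IsNoetherianRing D] [IsNoetherianRing F]
    {X : Scheme.{u}} [CompactSpace X] (x : X ⟶ Spec (CommRingCat.of F)) [LocallyOfFiniteType x] :
    HasFGModel D x := by
  suffices h : ∀ O : X.Opens, IsCompact (O : Set X) → HasFGModel D (O.ι ≫ x) by
    have h1 := h ⊤ isCompact_univ
    obtain ⟨B, hB, Y, y, m, hm, h2, h3⟩ := h1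
    refine ⟨B, hB, Y, y, X.topIso.inv ≫ m, hm.of_iso X.topIso (Iso.refl _) (Iso.refl _)
      (Iso.refl _) ?_ ?_ ?_ ?_, h2, h3⟩ <;> simp
  intro O hO
  refine compact_open_induction_on (P := fun O ↦ HasFGModel D (O.ι ≫ x)) O hO ?_ ?_
  · have : IsAffine (⊥ : X.Opens) := isAffineOpen_bot X
    exact hasFGModel_of_isAffine _
  · intro S _ U hS
    have : IsAffine (U : X.Opens) := U.2
    have hU : HasFGModel D (U.1.ι ≫ x) := hasFGModel_of_isAffine _
    refine HasFGModel.sup (i := X.homOfLE (le_sup_left : S ≤ S ⊔ U))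
      (j := X.homOfLE (le_sup_right : U.1 ≤ S ⊔ U)) ?_ ?_ ?_
    · rw [eq_top_iff]
      rintro ⟨t, ht⟩ -
      obtain ht' | ht' := ht
      · exact Or.inl ⟨⟨t, ht'⟩, Subtype.ext (by simp)⟩
      · exact Or.inr ⟨⟨t, ht'⟩, Subtype.ext (by simp)⟩
    · rwa [Scheme.homOfLE_ι_assoc]
    · rwa [Scheme.homOfLE_ι_assoc]

end Model

/-! ### Transport between the fibres of a family -/

section Away

variable {κ C A : Type*} [CommRing κ] [CommRing C] [CommRing A] [Algebra κ C] [Algebra κ A]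

theorem exists_away_lift {d : C} (f : C →ₐ[κ] A) (hd : IsUnit (f d)) :
    ∃ r : Localization.Away d →ₐ[κ] A, ∀ c, r (algebraMap C _ c) = f c := by
  have h (y : Submonoid.powers d) : IsUnit (f y) := by
    obtain ⟨_, n, rfl⟩ := y
    simpa using hd.pow n
  exact ⟨IsLocalization.liftAlgHom (M := Submonoid.powers d) (S := Localization.Away d) h,
    fun c ↦ IsLocalization.lift_eq _ c⟩

theorem away_hom_ext {d : C} {r s : Localization.Away d →ₐ[κ] A}
    (h : ∀ c, r (algebraMap C _ c) = s (algebraMap C _ c)) : r = s :=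
  AlgHom.coe_ringHom_injective (IsLocalization.ringHom_ext (Submonoid.powers d) (RingHom.ext h))

theorem injective_away_lift {d : C} {f : C →ₐ[κ] A} (hf : Function.Injective f)
    {r : Localization.Away d →ₐ[κ] A} (hr : ∀ c, r (algebraMap C _ c) = f c) :
    Function.Injective r := by
  rw [injective_iff_map_eq_zero]
  intro z hz
  obtain ⟨⟨c, t⟩, hct⟩ := IsLocalization.surj (Submonoid.powers d) z
  have h1 := congrArg r hct
  rw [map_mul, hz, zero_mul, hr] at h1
  have h2 : c = 0 := hf (h1.symm.trans (map_zero f).symm)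
  have h3 : z * algebraMap C _ (t : C) = 0 := by rw [hct]; simp [h2]
  exact (IsLocalization.map_units (Localization.Away d) t).mul_left_eq_zero.mp h3

end Away

section Fractions

variable {C : Type u} [CommRing C] [IsDomain C]

/-- A finitely generated subalgebra of the fraction field maps to the localization at a common
denominator. -/
theorem exists_algHom_away (B : Subalgebra C (FractionRing C)) (hB : B.FG) :
    ∃ d : C, d ≠ 0 ∧ Nonempty (B →ₐ[C] Localization.Away d) := by
  obtain ⟨s, rfl⟩ := hB
  obtain ⟨⟨d, hd⟩, hs⟩ := IsLocalization.exist_integer_multiples_of_finset (nonZeroDivisors C) s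
  have hd0 : d ≠ 0 := nonZeroDivisors.ne_zero hd
  have hdF : algebraMap C (FractionRing C) d ≠ 0 := by simpa using hd0
  obtain ⟨r, hr⟩ := exists_away_lift (κ := C) (d := d) (Algebra.ofId C (FractionRing C))
    hdF.isUnit
  have hinj : Function.Injective r :=
    injective_away_lift (FaithfulSMul.algebraMap_injective C (FractionRing C)) hr
  have hle : Algebra.adjoin C (s : Set (FractionRing C)) ≤ r.range := by
    refine Algebra.adjoin_le fun a ha ↦ ?_
    obtain ⟨c, hc⟩ := hs a ha
    refine ⟨IsLocalization.mk' _ c (⟨d, Submonoid.mem_powers d⟩ : Submonoid.powers d), ?_⟩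
    have h1 := congrArg r (IsLocalization.mk'_spec (Localization.Away d) c
      (⟨d, Submonoid.mem_powers d⟩ : Submonoid.powers d))
    rw [map_mul, hr, hr] at h1
    refine mul_right_cancel₀ hdF (h1.trans ?_)
    change algebraMap C _ c = _
    rw [hc, mul_comm]
    exact Algebra.smul_def d a
  exact ⟨d, hd0, ⟨((AlgEquiv.ofInjective r hinj).symm : r.range →ₐ[C] _).comp
    (Subalgebra.inclusion hle)⟩⟩

theorem subalgebra_fractionRing_hom_ext {B : Subalgebra C (FractionRing C)} {Ω : Type*} [Field Ω]
    {f g : B →+* Ω} (hf : Function.Injective (f.comp (algebraMap C B)))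
    (hfg : f.comp (algebraMap C B) = g.comp (algebraMap C B)) : f = g := by
  ext b
  obtain ⟨⟨c, n⟩, h⟩ := IsLocalization.surj (nonZeroDivisors C) (b : FractionRing C)
  have h' : b * algebraMap C B n = algebraMap C B c := Subtype.ext h
  have hn : f (algebraMap C B n) ≠ 0 := fun h0 ↦
    nonZeroDivisors.ne_zero n.2 (hf (h0.trans (map_zero _).symm))
  have e (c : C) : f (algebraMap C B c) = g (algebraMap C B c) := congr($hfg c)
  refine mul_right_cancel₀ hn ?_
  rw [← map_mul, h', e, e n, ← map_mul, h']

/-- Two morphisms over a family that agree on a generic geometric fibre agree on all geometric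
fibres over a nonempty open subset of the base. -/
theorem exists_ne_zero_of_agree {Ω : Type u} [Field Ω] (j : C →+* Ω) (hj : Function.Injective j)
    {W S X V : Scheme.{u}} (w : W ⟶ Spec (CommRingCat.of C)) [QuasiCompact w] (f : X ⟶ S)
    [LocallyOfFiniteType f] (α β : W ⟶ X) (hαβ : α ≫ f = β ≫ f)
    {v : V ⟶ Spec (CommRingCat.of Ω)} {p : V ⟶ W}
    (hp : IsPullback p v w (Spec.map (CommRingCat.ofHom j))) (h : p ≫ α = p ≫ β) :
    ∃ e : C, e ≠ 0 ∧ ∀ r : C →+* Ω, r e ≠ 0 → ∀ (T : Scheme.{u})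
      (y : T ⟶ Spec (CommRingCat.of Ω)) (g : T ⟶ W),
      g ≫ w = y ≫ Spec.map (CommRingCat.ofHom r) → g ≫ α = g ≫ β := by
  let F := FractionRing C
  let : Algebra C Ω := j.toAlgebra
  have : FaithfulSMul C Ω := (faithfulSMul_iff_algebraMap_injective C Ω).mpr hj
  let : Algebra F Ω := FractionRing.liftAlgebra C Ω
  have : IsScalarTower C F Ω := FractionRing.isScalarTower_liftAlgebra C Ω
  have hF : baseMap F Ω ≫ baseMap C F = Spec.map (CommRingCat.ofHom j) := by
    rw [← Spec.map_comp, ← CommRingCat.ofHom_comp, ← IsScalarTower.algebraMap_eq C F Ω]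
  let pF : V ⟶ baseScheme w F := pullback.lift p (v ≫ baseMap F Ω)
    (by rw [hp.w, Category.assoc, hF])
  have hpF : IsPullback pF v (pullback.snd _ _) (baseMap F Ω) := by
    refine IsPullback.of_right ?_ (pullback.lift_snd _ _ _) (IsPullback.of_hasPullback w _)
    rw [hF, pullback.lift_fst]
    exact hp
  have := flat_of_isPullback hpF
  have := surjective_of_isPullback hpF
  have := isAffineHom_of_isPullback hpF
  have : Epi pF := Flat.epi_of_flat_of_surjective _
  obtain ⟨B, hB, hab⟩ := exists_eq_of_fg w (IsPullback.of_hasPullback w (baseMap C F)) f α β hαβ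
    (by rw [← cancel_epi pF, pullback.lift_fst_assoc, pullback.lift_fst_assoc, h])
  obtain ⟨d, hd, ⟨φ⟩⟩ := exists_algHom_away B hB
  refine ⟨d, hd, fun r hr T y g hg ↦ ?_⟩
  let : Algebra ℤ C := inferInstance
  obtain ⟨r', hr'⟩ := exists_away_lift (κ := ℤ) (d := d) r.toIntAlgHom (IsUnit.mk0 _ hr)
  let g' : T ⟶ baseScheme w B :=
    pullback.lift g (y ≫ Spec.map (CommRingCat.ofHom (r'.toRingHom.comp φ.toRingHom))) (by
      rw [hg, Category.assoc, ← Spec.map_comp, ← CommRingCat.ofHom_comp]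
      congr 3
      ext c
      exact (hr' c).symm.trans (congrArg r' (φ.commutes c).symm))
  have hg' : g' ≫ pullback.fst _ _ = g := pullback.lift_fst _ _ _
  rw [← hg', Category.assoc, hab, Category.assoc]

end Fractions

open TensorProduct

/-- The morphism of spectra induced by a homomorphism of algebras. -/
abbrev specMap {κ A B : Type u} [CommRing κ] [CommRing A] [CommRing B] [Algebra κ A] [Algebra κ B]
    (f : A →ₐ[κ] B) : Spec (CommRingCat.of B) ⟶ Spec (CommRingCat.of A) :=
  Spec.map (CommRingCat.ofHom (f : A →+* B))

theorem specMap_comp {κ A B E : Type u} [CommRing κ] [CommRing A] [CommRing B] [CommRing E]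
    [Algebra κ A] [Algebra κ B] [Algebra κ E] (f : A →ₐ[κ] B) (g : B →ₐ[κ] E) :
    specMap g ≫ specMap f = specMap (g.comp f) :=
  (Spec.map_comp _ _).symm

section Transport

variable (κ : Type u) {R : Type u} [Field κ] [CommRing R] [Algebra κ R]

/-- The inclusion of `R` as the first factor in a localization of `R ⊗ R`. -/
def awayLeft (d : R ⊗[κ] R) : R →ₐ[κ] Localization.Away d :=
  (IsScalarTower.toAlgHom κ (R ⊗[κ] R) _).comp Algebra.TensorProduct.includeLeft

/-- The inclusion of `R` as the second factor in a localization of `R ⊗ R`. -/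
def awayRight (d : R ⊗[κ] R) : R →ₐ[κ] Localization.Away d :=
  (IsScalarTower.toAlgHom κ (R ⊗[κ] R) _).comp Algebra.TensorProduct.includeRight

/-- A transport on a family `x : X ⟶ Spec R` is a morphism from the second to the first pullback
of the family to the locus `d ≠ 0` of `Spec (R ⊗ R)`. -/
structure Transport {X : Scheme.{u}} (x : X ⟶ Spec (CommRingCat.of R)) where
  /-- the function whose nonvanishing locus is the domain of the transport -/
  den : R ⊗[κ] R
  /-- the transport -/
  hom : pullback x (specMap (awayRight κ den)) ⟶ X
  hom_over : hom ≫ x = pullback.snd _ _ ≫ specMap (awayLeft κ den)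

variable {κ} {X : Scheme.{u}} {x : X ⟶ Spec (CommRingCat.of R)} (M : Transport κ x)

/-- The point `t` of the family over `r₂` is transported to the point `t'` over `r₁`. The relation
includes that the pair `(r₁, r₂)` lies in the domain of the transport. -/
def Transport.Rel {A : Type u} [CommRing A] [Algebra κ A] (r₁ r₂ : R →ₐ[κ] A) {T : Scheme.{u}}
    (y : T ⟶ Spec (CommRingCat.of A)) (t t' : T ⟶ X) : Prop :=
  ∃ r : Localization.Away M.den →ₐ[κ] A,
    (∀ c, r (algebraMap _ _ c) = Algebra.TensorProduct.productMap r₁ r₂ c) ∧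
    ∃ g : T ⟶ pullback x (specMap (awayRight κ M.den)),
      g ≫ pullback.fst _ _ = t ∧ g ≫ pullback.snd _ _ = y ≫ specMap r ∧ g ≫ M.hom = t'

namespace Transport

variable {M} {A : Type u} [CommRing A] [Algebra κ A] {r₁ r₂ : R →ₐ[κ] A} {T : Scheme.{u}}
  {y : T ⟶ Spec (CommRingCat.of A)} {t t' t'' : T ⟶ X}

theorem comp_awayLeft {r : Localization.Away M.den →ₐ[κ] A}
    (hr : ∀ c, r (algebraMap _ _ c) = Algebra.TensorProduct.productMap r₁ r₂ c) :
    r.comp (awayLeft κ M.den) = r₁ := by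
  ext a
  exact (hr _).trans (by simp)

theorem comp_awayRight {r : Localization.Away M.den →ₐ[κ] A}
    (hr : ∀ c, r (algebraMap _ _ c) = Algebra.TensorProduct.productMap r₁ r₂ c) :
    r.comp (awayRight κ M.den) = r₂ := by
  ext a
  exact (hr _).trans (by simp)

theorem Rel.source (h : M.Rel r₁ r₂ y t t') : t ≫ x = y ≫ specMap r₂ := by
  obtain ⟨r, hr, g, rfl, hg, -⟩ := h
  rw [Category.assoc, pullback.condition, ← Category.assoc, hg, Category.assoc, specMap_comp,
    comp_awayRight hr]

theorem Rel.target (h : M.Rel r₁ r₂ y t t') : t' ≫ x = y ≫ specMap r₁ := by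
  obtain ⟨r, hr, g, -, hg, rfl⟩ := h
  rw [Category.assoc, M.hom_over, ← Category.assoc, hg, Category.assoc, specMap_comp,
    comp_awayLeft hr]

variable (M) in
theorem exists_rel (hd : IsUnit (Algebra.TensorProduct.productMap r₁ r₂ M.den))
    (ht : t ≫ x = y ≫ specMap r₂) : ∃ t', M.Rel r₁ r₂ y t t' := by
  obtain ⟨r, hr⟩ := exists_away_lift (Algebra.TensorProduct.productMap r₁ r₂) hd
  refine ⟨_, r, hr, pullback.lift t (y ≫ specMap r) ?_, pullback.lift_fst _ _ _,
    pullback.lift_snd _ _ _, rfl⟩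
  rw [Category.assoc, specMap_comp, comp_awayRight hr, ht]

/-- The transport of a point is determined by the point. -/
theorem Rel.unique (h : M.Rel r₁ r₂ y t t') (h' : M.Rel r₁ r₂ y t t'') : t' = t'' := by
  obtain ⟨r, hr, g, hg₁, hg₂, rfl⟩ := h
  obtain ⟨s, hs, g', hg₁', hg₂', rfl⟩ := h'
  obtain rfl : r = s := away_hom_ext fun c ↦ (hr c).trans (hs c).symm
  congr 1
  exact pullback.hom_ext (hg₁.trans hg₁'.symm) (hg₂.trans hg₂'.symm)

theorem Rel.precomp (h : M.Rel r₁ r₂ y t t') {T' : Scheme.{u}} (a : T' ⟶ T) :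
    M.Rel r₁ r₂ (a ≫ y) (a ≫ t) (a ≫ t') := by
  obtain ⟨r, hr, g, hg₁, hg₂, hg₃⟩ := h
  exact ⟨r, hr, a ≫ g, by rw [Category.assoc, hg₁], by rw [Category.assoc, hg₂, Category.assoc],
    by rw [Category.assoc, hg₃]⟩

theorem Rel.baseChange {B : Type u} [CommRing B] [Algebra κ B] {φ : A →ₐ[κ] B}
    {y : T ⟶ Spec (CommRingCat.of B)} (h : M.Rel r₁ r₂ (y ≫ specMap φ) t t') :
    M.Rel (φ.comp r₁) (φ.comp r₂) y t t' := by
  obtain ⟨r, hr, g, hg₁, hg₂, hg₃⟩ := h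
  refine ⟨φ.comp r, fun c ↦ ?_, g, hg₁, by rw [hg₂, Category.assoc, specMap_comp], hg₃⟩
  have : Algebra.TensorProduct.productMap (φ.comp r₁) (φ.comp r₂) =
      φ.comp (Algebra.TensorProduct.productMap r₁ r₂) := by ext <;> simp
  rw [this]
  exact congrArg φ (hr c)

theorem Rel.congr {s₁ s₂ : R →ₐ[κ] A} {y' : T ⟶ Spec (CommRingCat.of A)} {u u' : T ⟶ X}
    (h : M.Rel r₁ r₂ y t t') (h₁ : r₁ = s₁) (h₂ : r₂ = s₂) (hy : y = y') (hu : t = u)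
    (hu' : t' = u') : M.Rel s₁ s₂ y' u u' := by
  subst_vars
  exact h

end Transport

end Transport

/-! ### Generic position -/

section Position

open TensorProduct

variable {κ Ω : Type u} [Field κ] [Field Ω] [Algebra κ Ω]

/-- Two embeddings of a finitely generated domain in `Ω` differ by an automorphism of `Ω`. -/
theorem exists_algEquiv_comp_eq [IsAlgClosed Ω] (htr : Cardinal.aleph0 ≤ Algebra.trdeg κ Ω)
    {C : Type u} [CommRing C] [Algebra κ C] [Algebra.FiniteType κ C] (i j : C →ₐ[κ] Ω)
    (hi : Function.Injective i) (hj : Function.Injective j) :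
    ∃ θ : Ω ≃ₐ[κ] Ω, θ.toAlgHom.comp i = j := by
  have : IsDomain C := hi.isDomain i.toRingHom
  obtain ⟨θ, hθ⟩ := exists_algEquiv_apply_eq (E := FractionRing C) (trdeg_lt_aleph0 κ _) htr
    (IsLocalization.liftAlgHom (M := nonZeroDivisors C) (f := i) fun y ↦
      IsUnit.mk0 _ fun h ↦ nonZeroDivisors.ne_zero y.2 (hi (h.trans (map_zero i).symm)))
    (IsLocalization.liftAlgHom (M := nonZeroDivisors C) (f := j) fun y ↦
      IsUnit.mk0 _ fun h ↦ nonZeroDivisors.ne_zero y.2 (hj (h.trans (map_zero j).symm)))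
  refine ⟨θ, AlgHom.ext fun c ↦ ?_⟩
  have := hθ (algebraMap C _ c)
  rw [IsLocalization.coe_liftAlgHom, IsLocalization.coe_liftAlgHom] at this
  exact (congrArg θ (IsLocalization.lift_eq _ c).symm).trans
    (this.trans (IsLocalization.lift_eq _ c))

/-- Given a finite set `S`, a point `ι` of a regular domain has a conjugate `ρι` in general position
with respect to an algebraically closed field `E` that contains `S`. -/
theorem exists_general_position [IsAlgClosed Ω] (htr : Cardinal.aleph0 ≤ Algebra.trdeg κ Ω)
    {R : Type u} [CommRing R] [Algebra κ R] [Algebra.FiniteType κ R] (ι : R →ₐ[κ] Ω)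
    (hι : Function.Injective (Algebra.TensorProduct.productMap (algebraicClosure κ Ω).val ι))
    {S : Set Ω} (hS : S.Finite) :
    ∃ (E : IntermediateField κ Ω) (ρ : Ω ≃ₐ[algebraicClosure κ Ω] Ω), S ⊆ E ∧
      algebraicClosure κ Ω ≤ E ∧ Function.Injective (Algebra.TensorProduct.productMap E.val
        ((ρ.restrictScalars κ).toAlgHom.comp ι)) := by
  let F := IntermediateField.adjoin κ S
  let E : IntermediateField κ Ω := (algebraicClosure F Ω).restrictScalars κ
  have hKE : algebraicClosure κ Ω ≤ E := fun x hx ↦ by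
    have hx' : IsAlgebraic κ x := mem_algebraicClosure_iff.mp hx
    exact mem_algebraicClosure_iff.mpr (hx'.tower_top F)
  have hSE : S ⊆ E := fun x hx ↦
    (algebraicClosure F Ω).algebraMap_mem ⟨x, IntermediateField.subset_adjoin κ S hx⟩
  have : Algebra.EssFiniteType κ F :=
    IntermediateField.essFiniteType_iff.mpr ⟨hS.toFinset, by simp [F]⟩
  have : IsScalarTower κ F (algebraicClosure F Ω) := inferInstance
  have hE : Algebra.trdeg κ E < Cardinal.aleph0 := by
    change Algebra.trdeg κ (algebraicClosure F Ω) < _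
    have : FinTrdeg κ (algebraicClosure F Ω) := FinTrdeg.trans κ F _
    exact trdeg_lt_aleph0 κ _
  let : Algebra (algebraicClosure κ Ω) E := (IntermediateField.inclusion hKE).toAlgebra
  have : IsScalarTower κ (algebraicClosure κ Ω) E := .of_algebraMap_eq fun _ ↦ rfl
  have : IsScalarTower (algebraicClosure κ Ω) E Ω := .of_algebraMap_eq fun _ ↦ rfl
  have : IsAlgClosed (algebraicClosure κ Ω) := IsAlgClosure.isAlgClosed κ
  obtain ⟨ρ, hρ⟩ := exists_algEquiv_general_position (K := algebraicClosure κ Ω) (E := E) hE htr ι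
    hι
  exact ⟨E, ρ, hSE, hKE, hρ⟩

theorem range_le_of_image_subset {R : Type u} [CommRing R] [Algebra κ R] {s : Set R}
    (hs : Algebra.adjoin κ s = ⊤) (f : R →ₐ[κ] Ω) {E : IntermediateField κ Ω} (h : f '' s ⊆ E) :
    f.range ≤ E.toSubalgebra := by
  rw [← Algebra.map_top, ← hs, AlgHom.map_adjoin]
  exact Algebra.adjoin_le h

theorem injective_productMap_swap {R S : Type u} [CommRing R] [Algebra κ R] [CommRing S]
    [Algebra κ S] {f : R →ₐ[κ] Ω} {g : S →ₐ[κ] Ω}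
    (h : Function.Injective (Algebra.TensorProduct.productMap f g)) :
    Function.Injective (Algebra.TensorProduct.productMap g f) := by
  have : Algebra.TensorProduct.productMap g f = (Algebra.TensorProduct.productMap f g).comp
      (Algebra.TensorProduct.comm κ S R).toAlgHom := by ext <;> simp
  rw [this]
  exact h.comp (Algebra.TensorProduct.comm κ S R).injective

theorem injective_comp_algEquiv {R : Type u} [CommRing R] [Algebra κ R] {f : R →ₐ[κ] Ω}
    (hf : Function.Injective f) (σ : Ω ≃ₐ[κ] Ω) : Function.Injective (σ.toAlgHom.comp f) :=
  σ.injective.comp hf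

theorem productMap_comp {R S A B : Type u} [CommRing R] [Algebra κ R] [CommRing S] [Algebra κ S]
    [CommRing A] [Algebra κ A] [CommRing B] [Algebra κ B] (φ : A →ₐ[κ] B)
    (f : R →ₐ[κ] A) (g : S →ₐ[κ] A) : Algebra.TensorProduct.productMap (φ.comp f) (φ.comp g) =
      φ.comp (Algebra.TensorProduct.productMap f g) := by
  ext <;> simp

/-- A nonzero element of `R ⊗ M` has nonzero image under most specializations of `R`. -/
theorem exists_ne_zero_of_map_ne_zero {R M : Type u} [CommRing R] [Algebra κ R] [CommRing M]
    [Algebra κ M] {e : R ⊗[κ] M} (he : e ≠ 0) : ∃ g : R, g ≠ 0 ∧ ∀ (A : Type u) [CommRing A]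
      [Algebra κ A] (s : R →ₐ[κ] A), s g ≠ 0 →
        Algebra.TensorProduct.map s (AlgHom.id κ M) e ≠ 0 := by
  let b := Module.Basis.ofVectorSpace κ M
  obtain ⟨i, hi⟩ : ∃ i, (Algebra.TensorProduct.basis R b).repr e i ≠ 0 := by
    by_contra! h
    exact he ((Algebra.TensorProduct.basis R b).repr.map_eq_zero_iff.mp (Finsupp.ext h))
  refine ⟨_, hi, fun A _ _ s hs h0 ↦ hs ?_⟩
  have key (x : R ⊗[κ] M) : (Algebra.TensorProduct.basis A b).repr
      (Algebra.TensorProduct.map s (AlgHom.id κ M) x) i =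
        s ((Algebra.TensorProduct.basis R b).repr x i) := by
    induction x with
    | zero => simp
    | add x y hx hy => simp only [map_add, Finsupp.add_apply, hx, hy]
    | tmul a m => simp
  rw [← key, h0]
  simp

end Position

/-! ### Semilinear actions -/

/-- A semilinear action of `Aut(Ω/k)` on a scheme `v : V ⟶ Spec Ω`: automorphisms `a_σ` of the
scheme `V` lying over the automorphisms `Spec σ` of `Spec Ω`. As `Spec` is contravariant, `a_{στ}` is
`a_σ` followed by `a_τ`. -/
structure SemilinearAction (k : Type u) {Ω : Type u} [Field k] [Field Ω] [Algebra k Ω]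
    {V : Scheme.{u}} (v : V ⟶ Spec (CommRingCat.of Ω)) where
  /-- the automorphism `a_σ` of `V` -/
  act : (Ω ≃ₐ[k] Ω) → (V ⟶ V)
  act_over : ∀ σ, act σ ≫ v = v ≫ specAut σ
  act_mul : ∀ σ τ, act (σ * τ) = act σ ≫ act τ
  act_one : act 1 = 𝟙 V

namespace SemilinearAction

variable {k Ω : Type u} [Field k] [Field Ω] [Algebra k Ω] {V : Scheme.{u}}
  {v : V ⟶ Spec (CommRingCat.of Ω)} (A : SemilinearAction k v)

/-- The restriction of a semilinear action to the automorphisms over a larger field. -/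
def restrict (F : Type u) [Field F] [Algebra k F] [Algebra F Ω] [IsScalarTower k F Ω] :
    SemilinearAction F v where
  act σ := A.act (σ.restrictScalars k)
  act_over σ := A.act_over (σ.restrictScalars k)
  act_mul σ τ := A.act_mul (σ.restrictScalars k) (τ.restrictScalars k)
  act_one := A.act_one

/-- The quotient of `V` by the action is defined over `k`: `V` is the base change of a scheme `X`
over `k`, and the action is the one on the second factor of `X ×_k Ω`. -/
def Descends : Prop :=
  ∃ (X : Scheme.{u}) (x : X ⟶ Spec (CommRingCat.of k)) (q : V ⟶ X),
    IsPullback q v x (baseMap k Ω) ∧ ∀ σ, A.act σ ≫ q = q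

theorem act_comp_eq {T : Scheme.{u}} {f : V ⟶ T} {σ τ : Ω ≃ₐ[k] Ω}
    (h : A.act (σ⁻¹ * τ) ≫ f = f) : A.act τ ≫ f = A.act σ ≫ f := by
  have : τ = σ * (σ⁻¹ * τ) := by group
  rw [this, A.act_mul, Category.assoc, h]

theorem act_inv_comp (σ : Ω ≃ₐ[k] Ω) : A.act σ⁻¹ ≫ A.act σ = 𝟙 V := by
  rw [← A.act_mul, inv_mul_cancel, A.act_one]

theorem act_comp_inv (σ : Ω ≃ₐ[k] Ω) : A.act σ ≫ A.act σ⁻¹ = 𝟙 V := by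
  rw [← A.act_mul, mul_inv_cancel, A.act_one]

instance (σ : Ω ≃ₐ[k] Ω) : IsIso (A.act σ) :=
  ⟨A.act σ⁻¹, A.act_comp_inv σ, A.act_inv_comp σ⟩

end SemilinearAction

section Spread

open TensorProduct

variable {κ Ω R : Type u} [Field κ] [Field Ω] [Algebra κ Ω] [CommRing R] [Algebra κ R]
  {V X : Scheme.{u}} {v : V ⟶ Spec (CommRingCat.of Ω)} (A : SemilinearAction κ v)
  {x : X ⟶ Spec (CommRingCat.of R)} {ι : R →ₐ[κ] Ω} {p : V ⟶ X}

theorem SemilinearAction.act_over_specMap (σ : Ω ≃ₐ[κ] Ω) :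
    A.act σ ≫ v = v ≫ specMap σ.toAlgHom := A.act_over σ

include A in
theorem act_comp_eq_of_comp_eq (hA : ∀ σ : Ω ≃ₐ[κ] Ω, σ.toAlgHom.comp ι = ι → A.act σ ≫ p = p)
    {σ τ : Ω ≃ₐ[κ] Ω} (h : σ.toAlgHom.comp ι = τ.toAlgHom.comp ι) :
    A.act σ ≫ p = A.act τ ≫ p := by
  refine A.act_comp_eq (hA _ (AlgHom.ext fun a ↦ ?_))
  have := congr($h a)
  exact (congrArg τ.symm this).trans (τ.symm_apply_apply _)

variable (hp : IsPullback p v x (specMap ι))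

include hp in
/-- An equivariant morphism from `V` to a scheme over `R` spreads out over the locus `d ≠ 0` of a
finitely generated domain `C` containing `R`, of which `Ω` is a generic point. -/
theorem exists_hom_away [CharZero Ω] [IsAlgClosed Ω]
    (htr : Cardinal.aleph0 ≤ Algebra.trdeg κ Ω) {C : Type u} [CommRing C] [Algebra κ C]
    [Algebra.FiniteType κ C] {j : C →ₐ[κ] Ω} (hj : Function.Injective j) {inr inl : R →ₐ[κ] C}
    (hjr : j.comp inr = ι) [QuasiCompact x] [QuasiSeparated x]
    (hA : ∀ σ : Ω ≃ₐ[κ] Ω, σ.toAlgHom.comp j = j → A.act σ ≫ p = p)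
    {Y : Scheme.{u}} {y : Y ⟶ Spec (CommRingCat.of R)} [LocallyOfFinitePresentation y]
    (g : V ⟶ Y) (hg : g ≫ y = v ≫ specMap (j.comp inl))
    (hAg : ∀ σ : Ω ≃ₐ[κ] Ω, σ.toAlgHom.comp j = j → A.act σ ≫ g = g) :
    ∃ (d : C) (m : pullback x (specMap ((IsScalarTower.toAlgHom κ C (Localization.Away d)).comp
        inr)) ⟶ Y) (r : Localization.Away d →ₐ[κ] Ω) (n : V ⟶ pullback x (specMap
        ((IsScalarTower.toAlgHom κ C (Localization.Away d)).comp inr))),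
      m ≫ y = pullback.snd _ _ ≫ specMap ((IsScalarTower.toAlgHom κ C _).comp inl) ∧
      (∀ c, r (algebraMap C _ c) = j c) ∧ n ≫ pullback.fst _ _ = p ∧
      n ≫ pullback.snd _ _ = v ≫ specMap r ∧ n ≫ m = g := by
  have : IsDomain C := hj.isDomain j.toRingHom
  let F := FractionRing C
  let : Algebra C Ω := j.toAlgebra
  have : IsScalarTower κ C Ω := .of_algebraMap_eq fun c ↦ (j.commutes c).symm
  have : FaithfulSMul C Ω := (faithfulSMul_iff_algebraMap_injective C Ω).mpr hj
  let : Algebra F Ω := FractionRing.liftAlgebra C Ω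
  have : IsScalarTower C F Ω := FractionRing.isScalarTower_liftAlgebra C Ω
  have : IsScalarTower κ F Ω := .to₁₃₄ κ C F Ω
  have hF : baseMap F Ω ≫ baseMap C F = specMap j := by
    rw [← Spec.map_comp, ← CommRingCat.ofHom_comp, ← IsScalarTower.algebraMap_eq C F Ω]
    rfl
  let z : pullback x (specMap inr) ⟶ Spec (CommRingCat.of C) := pullback.snd _ _
  -- `V` is the base change of the pullback of the family to `C`.
  let p₂ : V ⟶ pullback x (specMap inr) := pullback.lift p (v ≫ specMap j)
    (by rw [hp.w, Category.assoc, specMap_comp, hjr])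
  have hp₂₁ : p₂ ≫ pullback.fst _ _ = p := pullback.lift_fst _ _ _
  have hp₂₂ : p₂ ≫ z = v ≫ specMap j := pullback.lift_snd _ _ _
  have hp₂ : IsPullback p₂ v z (specMap j) := by
    refine IsPullback.of_right ?_ hp₂₂ (IsPullback.of_hasPullback x _)
    rw [specMap_comp, hjr, hp₂₁]
    exact hp
  let pF : V ⟶ baseScheme z F := pullback.lift p₂ (v ≫ baseMap F Ω)
    (by rw [hp₂.w, Category.assoc, hF])
  have hpF₁ : pF ≫ pullback.fst _ _ = p₂ := pullback.lift_fst _ _ _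
  have hpF₂ : pF ≫ pullback.snd _ _ = v ≫ baseMap F Ω := pullback.lift_snd _ _ _
  have hpF : IsPullback pF v (pullback.snd z (baseMap C F)) (baseMap F Ω) := by
    refine IsPullback.of_right ?_ hpF₂ (IsPullback.of_hasPullback z _)
    rw [hF, hpF₁]
    exact hp₂
  have htrF : Cardinal.aleph0 ≤ Algebra.trdeg F Ω := by
    rwa [trdeg_eq_of_finite (κ := κ) (E := FractionRing C) (trdeg_lt_aleph0 κ _) htr]
  have hfixj (σ : Ω ≃ₐ[F] Ω) : (σ.restrictScalars κ).toAlgHom.comp j = j := by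
    refine AlgHom.ext fun c ↦ ?_
    have h1 : j c = algebraMap F Ω (algebraMap C F c) := IsScalarTower.algebraMap_apply C F Ω c
    change σ (j c) = j c
    rw [h1, σ.commutes]
  let AF := A.restrict F
  have hAp (σ : Ω ≃ₐ[F] Ω) : AF.act σ ≫ p = p := hA _ (hfixj σ)
  have hAv (σ : Ω ≃ₐ[F] Ω) : AF.act σ ≫ v ≫ baseMap F Ω = v ≫ baseMap F Ω := by
    rw [← Category.assoc, AF.act_over, Category.assoc, ← Spec.map_comp, ← CommRingCat.ofHom_comp]
    congr 3
    exact RingHom.ext fun c ↦ σ.commutes c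
  have hApF (σ : Ω ≃ₐ[F] Ω) : AF.act σ ≫ pF = pF := by
    have h2 : (AF.act σ ≫ pF) ≫ pullback.snd _ _ = pF ≫ pullback.snd _ _ := by
      rw [Category.assoc, hpF₂, hAv]
    refine pullback.hom_ext (pullback.hom_ext ?_ ?_) h2
    · rw [Category.assoc (AF.act σ), hpF₁, Category.assoc, hp₂₁, hAp]
    · have h3 := congrArg (· ≫ baseMap C F) h2
      simp only [Category.assoc, ← pullback.condition] at h3
      rw [Category.assoc, Category.assoc, Category.assoc]
      exact h3
  have hepi : Epi pF := by
    have := flat_of_isPullback hpF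
    have := surjective_of_isPullback hpF
    have := isAffineHom_of_isPullback hpF
    exact Flat.epi_of_flat_of_surjective _
  obtain ⟨m, hm⟩ := exists_comp_eq_of_invariant hpF (mem_range_of_forall_algEquiv htrF) AF.act
    AF.act_over hApF g fun σ ↦ hAg _ (hfixj σ)
  obtain ⟨B, hB, n, hn, hny⟩ := exists_hom_of_fg z (IsPullback.of_hasPullback z (baseMap C F))
    (z ≫ specMap inl) y m (by
      rw [← cancel_epi pF, ← Category.assoc, hm, hg, ← Category.assoc, hpF₁, ← Category.assoc,
        hp₂₂, Category.assoc, specMap_comp])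
  obtain ⟨d, hd, ⟨φ⟩⟩ := exists_algHom_away B hB
  obtain ⟨r, hr⟩ := exists_away_lift (d := d) j
    (IsUnit.mk0 _ fun h ↦ hd (hj (h.trans (map_zero j).symm)))
  let L := Localization.Away d
  let l : C →ₐ[κ] L := IsScalarTower.toAlgHom κ C L
  have hrl : r.comp l = j := AlgHom.ext hr
  let s : pullback x (specMap (l.comp inr)) ⟶ pullback x (specMap inr) :=
    pullback.lift (pullback.fst _ _) (pullback.snd _ _ ≫ specMap l)
      (by rw [Category.assoc, specMap_comp, pullback.condition])
  have hs₁ : s ≫ pullback.fst _ _ = pullback.fst _ _ := pullback.lift_fst _ _ _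
  have hs₂ : s ≫ z = pullback.snd _ _ ≫ specMap l := pullback.lift_snd _ _ _
  let b : pullback x (specMap (l.comp inr)) ⟶ baseScheme z B :=
    pullback.lift s (pullback.snd _ _ ≫ Spec.map (CommRingCat.ofHom φ.toRingHom)) (by
      have hφ : (φ.toRingHom).comp (algebraMap C B) = (l : C →+* L) :=
        RingHom.ext fun c ↦ φ.commutes c
      rw [hs₂, Category.assoc, ← Spec.map_comp, ← CommRingCat.ofHom_comp, hφ])
  have hb₁ : b ≫ pullback.fst _ _ = s := pullback.lift_fst _ _ _
  have hb₂ : b ≫ pullback.snd _ _ = pullback.snd _ _ ≫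
    Spec.map (CommRingCat.ofHom φ.toRingHom) := pullback.lift_snd _ _ _
  let i : V ⟶ pullback x (specMap (l.comp inr)) := pullback.lift p (v ≫ specMap r)
    (by rw [hp.w, Category.assoc, specMap_comp, ← AlgHom.comp_assoc, hrl, hjr])
  have hi₁ : i ≫ pullback.fst _ _ = p := pullback.lift_fst _ _ _
  have hi₂ : i ≫ pullback.snd _ _ = v ≫ specMap r := pullback.lift_snd _ _ _
  refine ⟨d, b ≫ n, r, i, ?_, hr, hi₁, hi₂, ?_⟩
  · rw [Category.assoc, hny, ← Category.assoc, hb₁, ← Category.assoc, hs₂, Category.assoc,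
      specMap_comp]
  · rw [← hm, ← hn, ← Category.assoc, ← Category.assoc]
    congr 1
    have hrφ : (r : L →+* Ω).comp φ.toRingHom = (algebraMap F Ω).comp B.val.toRingHom := by
      have h1 : ((r : L →+* Ω).comp φ.toRingHom).comp (algebraMap C B) = j :=
        RingHom.ext fun c ↦ (congrArg r (φ.commutes c)).trans (hr c)
      have h2 : ((algebraMap F Ω).comp B.val.toRingHom).comp (algebraMap C B) = j :=
        RingHom.ext fun c ↦ (IsScalarTower.algebraMap_apply C F Ω c).symm
      exact subalgebra_fractionRing_hom_ext (by rw [h1]; exact hj) (h1.trans h2.symm)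
    refine pullback.hom_ext ?_ ?_
    · rw [Category.assoc, hb₁, Category.assoc, toBaseScheme_fst, hpF₁]
      refine pullback.hom_ext ?_ ?_
      · rw [Category.assoc, hs₁, hi₁, hp₂₁]
      · refine (Category.assoc _ _ _).trans ?_
        change i ≫ s ≫ z = p₂ ≫ z
        rw [hs₂, ← Category.assoc, hi₂, Category.assoc, specMap_comp, hrl, hp₂₂]
    · rw [Category.assoc, hb₂, ← Category.assoc, hi₂, Category.assoc, Category.assoc,
        toBaseScheme_snd, ← Category.assoc pF, hpF₂, Category.assoc, ← Spec.map_comp,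
        ← Spec.map_comp, ← CommRingCat.ofHom_comp, ← CommRingCat.ofHom_comp, hrφ]

include hp in
/-- The isomorphism `a_ρ` between the fibres of the family at the generic points `ρι` and `ι`
spreads out to a transport. -/
theorem exists_transport [CharZero Ω] [IsAlgClosed Ω]
    (htr : Cardinal.aleph0 ≤ Algebra.trdeg κ Ω) [Algebra.FiniteType κ R] [QuasiCompact x]
    [QuasiSeparated x] [LocallyOfFinitePresentation x]
    (hA : ∀ σ : Ω ≃ₐ[κ] Ω, σ.toAlgHom.comp ι = ι → A.act σ ≫ p = p) (ρ : Ω ≃ₐ[κ] Ω)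
    (hρ : Function.Injective (Algebra.TensorProduct.productMap (ρ.toAlgHom.comp ι) ι)) :
    ∃ M : Transport κ x, M.Rel (ρ.toAlgHom.comp ι) ι v p (A.act ρ ≫ p) := by
  have hjl : (Algebra.TensorProduct.productMap (ρ.toAlgHom.comp ι) ι).comp
      Algebra.TensorProduct.includeLeft = ρ.toAlgHom.comp ι :=
    Algebra.TensorProduct.productMap_left _ _
  have hjr : (Algebra.TensorProduct.productMap (ρ.toAlgHom.comp ι) ι).comp
      Algebra.TensorProduct.includeRight = ι :=
    Algebra.TensorProduct.productMap_right _ _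
  have : Algebra.FiniteType κ (R ⊗[κ] R) := .trans (S := R) inferInstance inferInstance
  obtain ⟨d, m, r, n, hm, hr, hn₁, hn₂, hn₃⟩ := exists_hom_away A hp htr hρ hjr (y := x)
    (inl := Algebra.TensorProduct.includeLeft) (fun σ hσ ↦ hA σ (by
      conv_rhs => rw [← hjr, ← hσ, AlgHom.comp_assoc, hjr])) (A.act ρ ≫ p)
    (by rw [Category.assoc, hp.w, ← Category.assoc, A.act_over_specMap, Category.assoc,
      specMap_comp, hjl]) (fun σ hσ ↦ by
      rw [← Category.assoc, ← A.act_mul]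
      refine act_comp_eq_of_comp_eq A hA ?_
      conv_rhs => rw [← hjl, ← hσ, AlgHom.comp_assoc, hjl]
      rfl)
  exact ⟨⟨d, m, hm⟩, r, hr, n, hn₁, hn₂, hn₃⟩

end Spread

/-! ### Cocycle relations for transports -/

section Cocycle

open TensorProduct Algebra.TensorProduct

variable {κ Ω R : Type u} [Field κ] [Field Ω] [Algebra κ Ω] [CommRing R] [Algebra κ R]
  {V X : Scheme.{u}} {v : V ⟶ Spec (CommRingCat.of Ω)} (A : SemilinearAction κ v)
  {x : X ⟶ Spec (CommRingCat.of R)} {ι : R →ₐ[κ] Ω} {p : V ⟶ X}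

theorem Transport.Rel.specialize {M : Transport κ x} {B E : Type u} [CommRing B] [Algebra κ B]
    [CommRing E] [Algebra κ E] {s₁ s₂ : R →ₐ[κ] B} {W T : Scheme.{u}}
    {w : W ⟶ Spec (CommRingCat.of B)} {a b : W ⟶ X} (h : M.Rel s₁ s₂ w a b) {φ : B →ₐ[κ] E}
    {y : T ⟶ Spec (CommRingCat.of E)} {g : T ⟶ W} (hg : g ≫ w = y ≫ specMap φ) :
    M.Rel (φ.comp s₁) (φ.comp s₂) y (g ≫ a) (g ≫ b) :=
  ((h.precomp g).congr rfl rfl hg rfl rfl).baseChange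

theorem Transport.Rel.productMap_ne_zero {M : Transport κ x} {s₁ s₂ : R →ₐ[κ] Ω} {T : Scheme.{u}}
    {y : T ⟶ Spec (CommRingCat.of Ω)} {a b : T ⟶ X} (h : M.Rel s₁ s₂ y a b) :
    productMap s₁ s₂ M.den ≠ 0 := by
  obtain ⟨r, hr, -⟩ := h
  rw [← hr]
  exact ((IsLocalization.Away.algebraMap_isUnit M.den).map r).ne_zero

/-- Two morphisms that agree at the generic point `p` agree at the points over a nonempty open
subset of the base. -/
theorem exists_agree_away {C : Type u} [CommRing C] [Algebra κ C] {j : C →ₐ[κ] Ω}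
    (hj : Function.Injective j) {s : R →ₐ[κ] C} (hs : j.comp s = ι)
    (hp : IsPullback p v x (specMap ι)) [QuasiCompact x] [LocallyOfFiniteType x] {D : C}
    (hD : D ≠ 0)
    (α β : pullback x (specMap ((IsScalarTower.toAlgHom κ C (Localization.Away D)).comp s)) ⟶ X)
    (hαβ : α ≫ x = β ≫ x)
    (h : ∀ (r : Localization.Away D →ₐ[κ] Ω) (n : V ⟶ pullback x _),
      r.comp (IsScalarTower.toAlgHom κ C (Localization.Away D)) = j → n ≫ pullback.fst _ _ = p →
      n ≫ pullback.snd _ _ = v ≫ specMap r → n ≫ α = n ≫ β) :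
    ∃ e : C, e ≠ 0 ∧ ∀ r : C →ₐ[κ] Ω, r e ≠ 0 → ∃ rB : Localization.Away D →ₐ[κ] Ω,
      rB.comp (IsScalarTower.toAlgHom κ C (Localization.Away D)) = r ∧ ∀ (T : Scheme.{u})
      (y : T ⟶ Spec (CommRingCat.of Ω)) (w : T ⟶ pullback x _),
      w ≫ pullback.snd _ _ = y ≫ specMap rB → w ≫ α = w ≫ β := by
  have : IsDomain C := hj.isDomain j.toRingHom
  have hjD : j D ≠ 0 := fun h0 ↦ hD (hj (h0.trans (map_zero j).symm))
  obtain ⟨r, hr⟩ := exists_away_lift (d := D) j (IsUnit.mk0 _ hjD)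
  have hr' : r.comp (IsScalarTower.toAlgHom κ C (Localization.Away D)) = j := AlgHom.ext hr
  have hrinj : Function.Injective r := injective_away_lift hj hr
  have : IsDomain (Localization.Away D) := hrinj.isDomain r.toRingHom
  let n : V ⟶ pullback x (specMap ((IsScalarTower.toAlgHom κ C (Localization.Away D)).comp s)) :=
    pullback.lift p (v ≫ specMap r)
      (by rw [hp.w, Category.assoc, specMap_comp, ← AlgHom.comp_assoc, hr', hs])
  have hn₁ : n ≫ pullback.fst _ _ = p := pullback.lift_fst _ _ _
  have hn₂ : n ≫ pullback.snd _ _ = v ≫ specMap r := pullback.lift_snd _ _ _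
  have hn : IsPullback n v (pullback.snd _ _) (specMap r) := by
    refine IsPullback.of_right ?_ hn₂ (IsPullback.of_hasPullback x _)
    rw [hn₁, specMap_comp, ← AlgHom.comp_assoc, hr', hs]
    exact hp
  obtain ⟨eB, heB, hagree⟩ := exists_ne_zero_of_agree (r : Localization.Away D →+* Ω) hrinj
    (pullback.snd _ _) x α β hαβ hn (h r n hr' hn₁ hn₂)
  obtain ⟨⟨c, t⟩, hct⟩ := IsLocalization.surj (Submonoid.powers D) eB
  have hc : c ≠ 0 := by
    rintro rfl
    have h3 : eB * algebraMap C _ (t : C) = 0 := by rw [hct]; simp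
    exact heB ((IsLocalization.map_units (Localization.Away D) t).mul_left_eq_zero.mp h3)
  refine ⟨c * D, mul_ne_zero hc hD, fun r' hr0 ↦ ?_⟩
  rw [map_mul] at hr0
  obtain ⟨rB, hrB⟩ := exists_away_lift (d := D) r' (IsUnit.mk0 _ (right_ne_zero_of_mul hr0))
  refine ⟨rB, AlgHom.ext hrB, fun T y w hw ↦ hagree (rB : Localization.Away D →+* Ω) ?_ T y w hw⟩
  intro h0
  have h1 := congrArg rB hct
  rw [map_mul, show rB eB = 0 from h0, zero_mul, hrB] at h1
  exact left_ne_zero_of_mul hr0 h1.symm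

theorem isUnit_productMap {C : Type u} [CommRing C] [Algebra κ C] {s₁ s₂ : R →ₐ[κ] C} {D : C}
    {d : R ⊗[κ] R} (h : productMap s₁ s₂ d ∣ D) :
    IsUnit (productMap ((IsScalarTower.toAlgHom κ C (Localization.Away D)).comp s₁)
      ((IsScalarTower.toAlgHom κ C (Localization.Away D)).comp s₂) d) := by
  rw [productMap_comp]
  exact isUnit_of_dvd_unit (map_dvd (algebraMap C (Localization.Away D)) h)
    (IsLocalization.Away.algebraMap_isUnit D)

include A in
/-- A transport that extends `a_ρ` relates all pairs of generic points `σι`, `τι` in general position,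
since these are conjugate to the pair `ρι`, `ι`. -/
theorem rel_of_injective [IsAlgClosed Ω] (htr : Cardinal.aleph0 ≤ Algebra.trdeg κ Ω)
    [Algebra.FiniteType κ R]
    (hA : ∀ σ : Ω ≃ₐ[κ] Ω, σ.toAlgHom.comp ι = ι → A.act σ ≫ p = p) {M : Transport κ x}
    {ρ : Ω ≃ₐ[κ] Ω} (hρ : Function.Injective (productMap (ρ.toAlgHom.comp ι) ι))
    (hM : M.Rel (ρ.toAlgHom.comp ι) ι v p (A.act ρ ≫ p)) (σ τ : Ω ≃ₐ[κ] Ω)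
    (hστ : Function.Injective (productMap (σ.toAlgHom.comp ι) (τ.toAlgHom.comp ι))) :
    M.Rel (σ.toAlgHom.comp ι) (τ.toAlgHom.comp ι) v (A.act τ ≫ p) (A.act σ ≫ p) := by
  have : Algebra.FiniteType κ (R ⊗[κ] R) := .trans (S := R) inferInstance inferInstance
  obtain ⟨θ, hθ⟩ := exists_algEquiv_comp_eq htr _ _ hρ hστ
  rw [← productMap_comp] at hθ
  have h₁ : θ.toAlgHom.comp (ρ.toAlgHom.comp ι) = σ.toAlgHom.comp ι := by
    have := congrArg (fun f ↦ f.comp includeLeft) hθ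
    simpa only [productMap_left] using this
  have h₂ : θ.toAlgHom.comp ι = τ.toAlgHom.comp ι := by
    have := congrArg (fun f ↦ f.comp includeRight) hθ
    simpa only [productMap_right] using this
  refine (hM.specialize (A.act_over_specMap θ)).congr h₁ h₂ rfl
    (act_comp_eq_of_comp_eq A hA h₂) ?_
  rw [← Category.assoc, ← A.act_mul]
  exact act_comp_eq_of_comp_eq A hA h₁

variable {M : Transport κ x} (hp : IsPullback p v x (specMap ι)) [QuasiCompact x]
  [LocallyOfFiniteType x]
  (hM : ∀ σ τ : Ω ≃ₐ[κ] Ω,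
    Function.Injective (productMap (σ.toAlgHom.comp ι) (τ.toAlgHom.comp ι)) →
      M.Rel (σ.toAlgHom.comp ι) (τ.toAlgHom.comp ι) v (A.act τ ≫ p) (A.act σ ≫ p))

include hp hM in
/-- Transport to a general fibre and back is the identity. -/
theorem exists_rel_symm {ρ : Ω ≃ₐ[κ] Ω}
    (hρ : Function.Injective (productMap (ρ.toAlgHom.comp ι) ι)) :
    ∃ e : R ⊗[κ] R, e ≠ 0 ∧ ∀ r₁ r₂ : R →ₐ[κ] Ω, productMap r₁ r₂ e ≠ 0 → ∀ (T : Scheme.{u})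
      (y : T ⟶ Spec (CommRingCat.of Ω)) (t t' : T ⟶ X), M.Rel r₁ r₂ y t t' →
        M.Rel r₂ r₁ y t' t := by
  let j := productMap (ρ.toAlgHom.comp ι) ι
  have h₁ : M.Rel (ρ.toAlgHom.comp ι) ι v p (A.act ρ ≫ p) :=
    (hM ρ 1 hρ).congr rfl rfl rfl (by rw [A.act_one, Category.id_comp]) rfl
  have h₂ : M.Rel ι (ρ.toAlgHom.comp ι) v (A.act ρ ≫ p) p :=
    (hM 1 ρ (injective_productMap_swap hρ)).congr rfl rfl rfl rfl
      (by rw [A.act_one, Category.id_comp])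
  let l₁ : R →ₐ[κ] R ⊗[κ] R := includeLeft
  let l₂ : R →ₐ[κ] R ⊗[κ] R := includeRight
  have hl₁ (r₁ r₂ : R →ₐ[κ] Ω) : (productMap r₁ r₂).comp l₁ = r₁ := productMap_left _ _
  have hl₂ (r₁ r₂ : R →ₐ[κ] Ω) : (productMap r₁ r₂).comp l₂ = r₂ := productMap_right _ _
  have hd {s₁ s₂ : R →ₐ[κ] R ⊗[κ] R} {f₁ f₂ : R →ₐ[κ] Ω} (e₁ : j.comp s₁ = f₁)
      (e₂ : j.comp s₂ = f₂) {a b : V ⟶ X} (h : M.Rel f₁ f₂ v a b) :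
      productMap s₁ s₂ M.den ≠ 0 := by
    intro h0
    apply h.productMap_ne_zero
    rw [← e₁, ← e₂, productMap_comp]
    exact (congrArg j h0).trans (map_zero j)
  have : IsDomain (R ⊗[κ] R) := hρ.isDomain j.toRingHom
  let D := productMap l₁ l₂ M.den * productMap l₂ l₁ M.den
  have hD : D ≠ 0 := mul_ne_zero (hd (hl₁ _ _) (hl₂ _ _) h₁) (hd (hl₂ _ _) (hl₁ _ _) h₂)
  let l := IsScalarTower.toAlgHom κ (R ⊗[κ] R) (Localization.Away D)
  obtain ⟨α₀, hα₀⟩ := M.exists_rel (t := pullback.fst x (specMap (l.comp l₂)))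
    (isUnit_productMap (Dvd.intro _ rfl : productMap l₁ l₂ M.den ∣ D)) pullback.condition
  obtain ⟨α, hα⟩ := M.exists_rel (t := α₀)
    (isUnit_productMap (Dvd.intro_left _ rfl : productMap l₂ l₁ M.den ∣ D)) hα₀.target
  have hcomp {r : R ⊗[κ] R →ₐ[κ] Ω} {rB : Localization.Away D →ₐ[κ] Ω} (hr : rB.comp l = r)
    (s : R →ₐ[κ] R ⊗[κ] R) : rB.comp (l.comp s) = r.comp s := by rw [← AlgHom.comp_assoc, hr]
  obtain ⟨e, he, h⟩ := exists_agree_away hρ (hl₂ _ _) hp hD α (pullback.fst _ _)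
    (by rw [hα.target, pullback.condition]) fun r n hr hn₁ hn₂ ↦ by
      have k₁ := (hα₀.specialize hn₂).congr ((hcomp hr l₁).trans (hl₁ _ _))
        ((hcomp hr l₂).trans (hl₂ _ _)) rfl hn₁ rfl
      have k₂ := (hα.specialize hn₂).congr ((hcomp hr l₂).trans (hl₂ _ _))
        ((hcomp hr l₁).trans (hl₁ _ _)) rfl (k₁.unique h₁) rfl
      exact (k₂.unique h₂).trans hn₁.symm
  refine ⟨e, he, fun r₁ r₂ hr T y t t' ht ↦ ?_⟩
  obtain ⟨rB, hrB, hagree⟩ := h _ hr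
  let w : T ⟶ pullback x (specMap (l.comp l₂)) := pullback.lift t (y ≫ specMap rB)
    (by rw [ht.source, Category.assoc, specMap_comp, hcomp hrB, hl₂])
  have hw₁ : w ≫ pullback.fst _ _ = t := pullback.lift_fst _ _ _
  have hw₂ : w ≫ pullback.snd _ _ = y ≫ specMap rB := pullback.lift_snd _ _ _
  have k₁ := (hα₀.specialize hw₂).congr ((hcomp hrB l₁).trans (hl₁ _ _))
    ((hcomp hrB l₂).trans (hl₂ _ _)) rfl hw₁ rfl
  exact (hα.specialize hw₂).congr ((hcomp hrB l₂).trans (hl₂ _ _))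
    ((hcomp hrB l₁).trans (hl₁ _ _)) rfl (k₁.unique ht) ((hagree T y w hw₂).trans hw₁)

include hp hM in
/-- Transports between general fibres satisfy the cocycle relation. -/
theorem exists_rel_trans {ρ₁ ρ₂ : Ω ≃ₐ[κ] Ω}
    (h₁₃ : Function.Injective (productMap (ρ₁.toAlgHom.comp ι) ι))
    (h₂₃ : Function.Injective (productMap (ρ₂.toAlgHom.comp ι) ι))
    (h₁₂ : Function.Injective (productMap (ρ₁.toAlgHom.comp ι) (ρ₂.toAlgHom.comp ι)))
    (h₁₃₂ : Function.Injective
      (productMap (productMap (ρ₁.toAlgHom.comp ι) ι) (ρ₂.toAlgHom.comp ι))) :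
    ∃ e : (R ⊗[κ] R) ⊗[κ] R, e ≠ 0 ∧ ∀ r₁ r₂ r₃ : R →ₐ[κ] Ω,
      productMap (productMap r₁ r₃) r₂ e ≠ 0 → ∀ (T : Scheme.{u})
        (y : T ⟶ Spec (CommRingCat.of Ω)) (t t' t'' : T ⟶ X), M.Rel r₂ r₃ y t t' →
          M.Rel r₁ r₂ y t' t'' → M.Rel r₁ r₃ y t t'' := by
  let C := (R ⊗[κ] R) ⊗[κ] R
  let j : C →ₐ[κ] Ω := productMap (productMap (ρ₁.toAlgHom.comp ι) ι) (ρ₂.toAlgHom.comp ι)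
  have h₁ : M.Rel (ρ₁.toAlgHom.comp ι) ι v p (A.act ρ₁ ≫ p) :=
    (hM ρ₁ 1 h₁₃).congr rfl rfl rfl (by rw [A.act_one, Category.id_comp]) rfl
  have h₂ : M.Rel (ρ₂.toAlgHom.comp ι) ι v p (A.act ρ₂ ≫ p) :=
    (hM ρ₂ 1 h₂₃).congr rfl rfl rfl (by rw [A.act_one, Category.id_comp]) rfl
  have h₃ := hM ρ₁ ρ₂ h₁₂
  let l₁ : R →ₐ[κ] C := includeLeft.comp includeLeft
  let l₃ : R →ₐ[κ] C := includeLeft.comp includeRight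
  let l₂ : R →ₐ[κ] C := includeRight
  have hl₁ (r₁ r₂ r₃ : R →ₐ[κ] Ω) : (productMap (productMap r₁ r₃) r₂).comp l₁ = r₁ := by
    rw [← AlgHom.comp_assoc, productMap_left, productMap_left]
  have hl₃ (r₁ r₂ r₃ : R →ₐ[κ] Ω) : (productMap (productMap r₁ r₃) r₂).comp l₃ = r₃ := by
    rw [← AlgHom.comp_assoc, productMap_left, productMap_right]
  have hl₂ (r₁ r₂ r₃ : R →ₐ[κ] Ω) : (productMap (productMap r₁ r₃) r₂).comp l₂ = r₂ :=
    productMap_right _ _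
  have hd {s₁ s₂ : R →ₐ[κ] C} {f₁ f₂ : R →ₐ[κ] Ω} (e₁ : j.comp s₁ = f₁)
      (e₂ : j.comp s₂ = f₂) {a b : V ⟶ X} (h : M.Rel f₁ f₂ v a b) :
      productMap s₁ s₂ M.den ≠ 0 := by
    intro h0
    apply h.productMap_ne_zero
    rw [← e₁, ← e₂, productMap_comp]
    exact (congrArg j h0).trans (map_zero j)
  have : IsDomain C := h₁₃₂.isDomain j.toRingHom
  -- Over the locus `D ≠ 0` both the composite transport `α` and the direct transport `β` are defined.
  let D := productMap l₁ l₂ M.den * productMap l₂ l₃ M.den * productMap l₁ l₃ M.den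
  have hD : D ≠ 0 := mul_ne_zero (mul_ne_zero (hd (hl₁ _ _ _) (hl₂ _ _ _) h₃)
    (hd (hl₂ _ _ _) (hl₃ _ _ _) h₂)) (hd (hl₁ _ _ _) (hl₃ _ _ _) h₁)
  let l := IsScalarTower.toAlgHom κ C (Localization.Away D)
  obtain ⟨α₀, hα₀⟩ := M.exists_rel (t := pullback.fst x (specMap (l.comp l₃)))
    (isUnit_productMap (dvd_mul_of_dvd_left (dvd_mul_left _ _) _ :
      productMap l₂ l₃ M.den ∣ D)) pullback.condition
  obtain ⟨α, hα⟩ := M.exists_rel (t := α₀)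
    (isUnit_productMap (dvd_mul_of_dvd_left (dvd_mul_right _ _) _ :
      productMap l₁ l₂ M.den ∣ D)) hα₀.target
  obtain ⟨β, hβ⟩ := M.exists_rel (t := pullback.fst x (specMap (l.comp l₃)))
    (isUnit_productMap (dvd_mul_left _ _ : productMap l₁ l₃ M.den ∣ D)) pullback.condition
  have hcomp {r : C →ₐ[κ] Ω} {rB : Localization.Away D →ₐ[κ] Ω} (hr : rB.comp l = r)
    (s : R →ₐ[κ] C) : rB.comp (l.comp s) = r.comp s := by rw [← AlgHom.comp_assoc, hr]
  obtain ⟨e, he, h⟩ := exists_agree_away h₁₃₂ (hl₃ _ _ _) hp hD α β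
    (by rw [hα.target, hβ.target]) fun r n hr hn₁ hn₂ ↦ by
      have k₁ := (hα₀.specialize hn₂).congr ((hcomp hr l₂).trans (hl₂ _ _ _))
        ((hcomp hr l₃).trans (hl₃ _ _ _)) rfl hn₁ rfl
      have k₂ := (hα.specialize hn₂).congr ((hcomp hr l₁).trans (hl₁ _ _ _))
        ((hcomp hr l₂).trans (hl₂ _ _ _)) rfl (k₁.unique h₂) rfl
      have k₃ := (hβ.specialize hn₂).congr ((hcomp hr l₁).trans (hl₁ _ _ _))
        ((hcomp hr l₃).trans (hl₃ _ _ _)) rfl hn₁ rfl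
      exact (k₂.unique h₃).trans (k₃.unique h₁).symm
  refine ⟨e, he, fun r₁ r₂ r₃ hr T y t t' t'' ht ht' ↦ ?_⟩
  obtain ⟨rB, hrB, hagree⟩ := h _ hr
  let w : T ⟶ pullback x (specMap (l.comp l₃)) := pullback.lift t (y ≫ specMap rB)
    (by rw [ht.source, Category.assoc, specMap_comp, hcomp hrB, hl₃])
  have hw₁ : w ≫ pullback.fst _ _ = t := pullback.lift_fst _ _ _
  have hw₂ : w ≫ pullback.snd _ _ = y ≫ specMap rB := pullback.lift_snd _ _ _
  have k₁ := (hα₀.specialize hw₂).congr ((hcomp hrB l₂).trans (hl₂ _ _ _))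
    ((hcomp hrB l₃).trans (hl₃ _ _ _)) rfl hw₁ rfl
  have k₂ := (hα.specialize hw₂).congr ((hcomp hrB l₁).trans (hl₁ _ _ _))
    ((hcomp hrB l₂).trans (hl₂ _ _ _)) rfl (k₁.unique ht) rfl
  exact (hβ.specialize hw₂).congr ((hcomp hrB l₁).trans (hl₁ _ _ _))
    ((hcomp hrB l₃).trans (hl₃ _ _ _)) rfl hw₁ ((hagree T y w hw₂).symm.trans (k₂.unique ht'))

end Cocycle

/-! ### Specialization of a family to a finite extension -/

section Specialization

open TensorProduct Algebra.TensorProduct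

variable {κ Ω R : Type u} [Field κ] [Field Ω] [Algebra κ Ω] [CommRing R] [Algebra κ R]
  {V X : Scheme.{u}} {v : V ⟶ Spec (CommRingCat.of Ω)} (A : SemilinearAction κ v)
  {x : X ⟶ Spec (CommRingCat.of R)} {ι : R →ₐ[κ] Ω} {p : V ⟶ X}

/-- A fibre that is identified with the generic fibre by transport is a model of `V`. -/
theorem isPullback_of_rel {M : Transport κ x} (hp : IsPullback p v x (specMap ι))
    {s : R →ₐ[κ] Ω} {q : V ⟶ X} (hq : M.Rel s ι v p q) (hd : productMap ι s M.den ≠ 0)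
    (h₁ : ∀ (T : Scheme.{u}) (y : T ⟶ Spec (CommRingCat.of Ω)) (t t' : T ⟶ X),
      M.Rel s ι y t t' → M.Rel ι s y t' t)
    (h₂ : ∀ (T : Scheme.{u}) (y : T ⟶ Spec (CommRingCat.of Ω)) (t t' : T ⟶ X),
      M.Rel ι s y t t' → M.Rel s ι y t' t) :
    IsPullback q v x (specMap s) := by
  refine ⟨⟨hq.target⟩, ⟨PullbackCone.IsLimit.mk _ (fun c ↦ ?_) ?_ ?_ ?_⟩⟩
  · exact hp.lift (M.exists_rel (IsUnit.mk0 _ hd) c.condition).choose c.snd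
      (M.exists_rel (IsUnit.mk0 _ hd) c.condition).choose_spec.target
  · intro c
    have h := (M.exists_rel (IsUnit.mk0 _ hd) c.condition).choose_spec
    exact ((hq.precomp _).congr rfl rfl (hp.lift_snd _ _ _) (hp.lift_fst _ _ _) rfl).unique
      (h₂ _ _ _ _ h)
  · intro c
    exact hp.lift_snd _ _ _
  · intro c m hm₁ hm₂
    have h := (M.exists_rel (IsUnit.mk0 _ hd) c.condition).choose_spec
    refine hp.hom_ext ?_ (hm₂.trans (hp.lift_snd _ _ _).symm)
    rw [hp.lift_fst]
    exact (h₁ _ _ _ _ ((hq.precomp m).congr rfl rfl hm₂ rfl hm₁)).unique h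

include A in
/-- If the restriction of the action to the stabilizer of a point `ι` of general position descends
to a family over `R`, then the restriction to the automorphisms over some finite extension of `κ`
descends. -/
theorem exists_finite_descends [CharZero Ω] [IsAlgClosed Ω]
    (htr : Cardinal.aleph0 ≤ Algebra.trdeg κ Ω) [Algebra.FiniteType κ R] [QuasiCompact x]
    [QuasiSeparated x] [LocallyOfFinitePresentation x] (hp : IsPullback p v x (specMap ι))
    (hA : ∀ σ : Ω ≃ₐ[κ] Ω, σ.toAlgHom.comp ι = ι → A.act σ ≫ p = p)
    (hreg : Function.Injective (productMap (algebraicClosure κ Ω).val ι)) :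
    ∃ F : IntermediateField κ Ω, FiniteDimensional κ F ∧ (A.restrict F).Descends := by
  obtain ⟨S, hS⟩ := (‹Algebra.FiniteType κ R›).out
  have hι : Function.Injective ι := by
    have h := hreg.comp (includeRight_injective
      (algebraMap κ (algebraicClosure κ Ω)).injective : Function.Injective
        (includeRight : R →ₐ[κ] algebraicClosure κ Ω ⊗[κ] R))
    have h' : (productMap (algebraicClosure κ Ω).val ι) ∘ includeRight = ι :=
      congrArg (fun f : R →ₐ[κ] Ω ↦ (f : R → Ω)) (productMap_right _ _)
    exact h' ▸ h
  have : IsDomain R := hι.isDomain ι.toRingHom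
  obtain ⟨E₁, ρ₁', hE₁, -, hρ₁⟩ := exists_general_position htr ι hreg (S.finite_toSet.image ι)
  let ρ₁ := ρ₁'.restrictScalars κ
  have h₁₃ : Function.Injective (productMap (ρ₁.toAlgHom.comp ι) ι) :=
    injective_productMap_swap (injective_productMap_of_range_le hρ₁ ι hι
      (range_le_of_image_subset hS ι hE₁))
  obtain ⟨E₂, ρ₂', hE₂, -, hρ₂⟩ := exists_general_position htr ι hreg
    ((S.finite_toSet.image ι).union (S.finite_toSet.image (ρ₁.toAlgHom.comp ι)))
  let ρ₂ := ρ₂'.restrictScalars κ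
  have hr₁ : ι.range ≤ E₂.toSubalgebra :=
    range_le_of_image_subset hS ι (Set.subset_union_left.trans hE₂)
  have hr₂ : (ρ₁.toAlgHom.comp ι).range ≤ E₂.toSubalgebra :=
    range_le_of_image_subset hS _ (Set.subset_union_right.trans hE₂)
  have h₂₃ : Function.Injective (productMap (ρ₂.toAlgHom.comp ι) ι) :=
    injective_productMap_swap (injective_productMap_of_range_le hρ₂ ι hι hr₁)
  have h₁₂ := injective_productMap_of_range_le hρ₂ (ρ₁.toAlgHom.comp ι)
    (injective_comp_algEquiv hι ρ₁) hr₂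
  have h₁₃₂ := injective_productMap_of_range_le hρ₂ _ h₁₃
    (by rw [productMap_range]; exact sup_le hr₂ hr₁)
  obtain ⟨M, hM₀⟩ := exists_transport A hp htr hA ρ₁ h₁₃
  have hM := rel_of_injective A htr hA h₁₃ hM₀
  obtain ⟨e₂, he₂, hsymm⟩ := exists_rel_symm A hp hM h₁₃
  obtain ⟨e₃, he₃, htrans⟩ := exists_rel_trans A hp hM h₁₃ h₂₃ h₁₂ h₁₃₂
  have : IsDomain (R ⊗[κ] R) := h₁₃.isDomain (productMap (ρ₁.toAlgHom.comp ι) ι).toRingHom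
  -- The point `s` is chosen such that the pairs `(s, ι)` and `(ι, s)` lie in the domain of the
  -- transport and satisfy the inverse relation, and that the cocycle relation holds for `(s, τι, ι)`
  -- whenever `τι` is in general position.
  let c := Algebra.TensorProduct.comm κ R R
  have hc (r₁ r₂ : R →ₐ[κ] Ω) (e : R ⊗[κ] R) : productMap r₁ r₂ (c e) = productMap r₂ r₁ e := by
    have : (productMap r₁ r₂).comp c.toAlgHom = productMap r₂ r₁ := by ext <;> simp [c]
    exact congr($this e)
  have hden : M.den ≠ 0 := fun h ↦ hM₀.productMap_ne_zero (by rw [h, map_zero])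
  have hc0 {e : R ⊗[κ] R} (he : e ≠ 0) : c e ≠ 0 :=
    fun h ↦ he (c.injective (h.trans (map_zero c).symm))
  let f := M.den * c M.den * (e₂ * c e₂)
  have hf : f ≠ 0 := mul_ne_zero (mul_ne_zero hden (hc0 hden)) (mul_ne_zero he₂ (hc0 he₂))
  obtain ⟨g₂, hg₂, hg₂'⟩ := exists_ne_zero_of_map_ne_zero hf
  let a := Algebra.TensorProduct.assoc κ κ κ R R R
  have hae : a e₃ ≠ 0 := fun h ↦ he₃ (a.injective (h.trans (map_zero a).symm))
  obtain ⟨g₃, hg₃, hg₃'⟩ := exists_ne_zero_of_map_ne_zero hae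
  obtain ⟨s, hs, hfin⟩ := exists_algHom_apply_ne_zero (κ := κ) (Ω := Ω) (mul_ne_zero hg₂ hg₃)
  let K := algebraicClosure κ Ω
  have hsK (b : R) : s b ∈ K := by
    have : IsIntegral κ (⟨s b, b, rfl⟩ : s.range) := Algebra.IsIntegral.isIntegral _
    exact mem_algebraicClosure_iff.mpr (this.map s.range.val).isAlgebraic
  let sK : R →ₐ[κ] K := s.codRestrict K.toSubalgebra hsK
  have hsK' : K.val.comp sK = s := rfl
  have hs₂ : sK g₂ ≠ 0 := fun h ↦ hs (by
    rw [map_mul, ← hsK', AlgHom.comp_apply, h, map_zero, zero_mul])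
  have hs₃ : sK g₃ ≠ 0 := fun h ↦ hs (by
    rw [map_mul, ← hsK', AlgHom.comp_apply K.val sK g₃, h, map_zero, mul_zero])
  have hf' : productMap s ι f ≠ 0 := by
    have h : productMap s ι = (productMap K.val ι).comp (map sK (AlgHom.id κ R)) := by
      ext b
      · simp [sK]
        rfl
      · simp
    rw [h]
    exact fun h0 ↦ hg₂' K sK hs₂ (hreg (h0.trans (map_zero _).symm))
  have he₃' (τ : Ω ≃ₐ[κ] Ω)
      (hτ : Function.Injective (productMap (productMap K.val ι) (τ.toAlgHom.comp ι))) :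
      productMap (productMap s ι) (τ.toAlgHom.comp ι) e₃ ≠ 0 := by
    have h : productMap (productMap s ι) (τ.toAlgHom.comp ι) =
        ((productMap (productMap K.val ι) (τ.toAlgHom.comp ι)).comp
          (Algebra.TensorProduct.assoc κ κ κ K R R).symm.toAlgHom).comp
            ((map sK (AlgHom.id κ (R ⊗[κ] R))).comp a.toAlgHom) := by
      ext b
      · simp [sK, a]
        rfl
      · simp [a]
      · have h₁ : ((1 : R ⊗[κ] R) ⊗ₜ[κ] b) = ((1 : R) ⊗ₜ[κ] (1 : R)) ⊗ₜ[κ] b := rfl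
        simp only [AlgHom.comp_apply, AlgHom.restrictScalars_apply, includeRight_apply, h₁]
        simp [a]
    rw [h]
    exact fun h0 ↦ hg₃' K sK hs₃
      ((map_eq_zero_iff _ (Algebra.TensorProduct.assoc κ κ κ K R R).symm.injective).mp
        ((map_eq_zero_iff _ hτ).mp h0))
  rw [map_mul, map_mul, map_mul, hc, hc] at hf'
  obtain ⟨⟨hd₁, hd₂⟩, hd₃, hd₄⟩ : (productMap s ι M.den ≠ 0 ∧ productMap ι s M.den ≠ 0) ∧
    productMap s ι e₂ ≠ 0 ∧ productMap ι s e₂ ≠ 0 := by simpa [mul_ne_zero_iff] using hf'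
  obtain ⟨q, hq⟩ := M.exists_rel (IsUnit.mk0 _ hd₁) hp.w
  have hqp : IsPullback q v x (specMap s) := isPullback_of_rel hp hq hd₂ (hsymm _ _ hd₃)
    (hsymm _ _ hd₄)
  have hfield : IsField s.range := by
    have : Algebra.IsIntegral κ s.range := inferInstance
    exact isField_of_isIntegral_of_isField' (Field.toIsField κ)
  let F : IntermediateField κ Ω := s.range.toIntermediateField' hfield
  let sF : R →ₐ[κ] F := s.rangeRestrict
  have hsF : F.val.comp sF = s := rfl
  refine ⟨F, hfin, ?_⟩
  let AF := A.restrict F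
  have hFs (σ : Ω ≃ₐ[F] Ω) : (σ.restrictScalars κ).toAlgHom.comp s = s :=
    AlgHom.ext fun b ↦ σ.commutes (sF b)
  -- Invariance under automorphisms in general position comes from the cocycle relation.
  have hgen (τ : Ω ≃ₐ[F] Ω) (hτ : Function.Injective (productMap (productMap K.val ι)
      ((τ.restrictScalars κ).toAlgHom.comp ι))) : AF.act τ ≫ q = q := by
    have hτ' : Function.Injective (productMap ((τ.restrictScalars κ).toAlgHom.comp ι) ι) := by
      have h : productMap ι ((τ.restrictScalars κ).toAlgHom.comp ι) =
          (productMap (productMap K.val ι) ((τ.restrictScalars κ).toAlgHom.comp ι)).comp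
            (map includeRight (AlgHom.id κ R)) := by
        ext b <;> simp
      refine injective_productMap_swap ?_
      rw [h]
      exact hτ.comp (Module.Flat.rTensor_preserves_injective_linearMap (M := R)
        (includeRight : R →ₐ[κ] K ⊗[κ] R).toLinearMap
        (includeRight_injective (algebraMap κ K).injective))
    have k₁ := (hM (τ.restrictScalars κ) 1 hτ').congr rfl rfl rfl
      (by rw [A.act_one, Category.id_comp] : A.act 1 ≫ p = p) rfl
    have k₂ := (hq.specialize (A.act_over_specMap (τ.restrictScalars κ))).congr (hFs τ) rfl rfl rfl
      rfl
    exact (htrans _ _ _ (he₃' _ hτ) _ _ _ _ _ k₁ k₂).unique hq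
  have hinv (τ : Ω ≃ₐ[F] Ω) : AF.act τ ≫ q = q := by
    let τ' := τ.restrictScalars κ
    -- Both `ρ` and `τρ` are in general position for a suitable `ρ` fixing `K`.
    obtain ⟨E, ρ', hE, hKE, hρ⟩ := exists_general_position htr ι hreg
      ((S.finite_toSet.image ι).union (S.finite_toSet.image (τ'.symm.toAlgHom.comp ι)))
    let ρ : Ω ≃ₐ[F] Ω := AlgEquiv.ofRingEquiv (f := ρ'.toRingEquiv) fun y ↦
      ρ'.commutes ⟨y, by obtain ⟨_, b, rfl⟩ := y; exact hsK b⟩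
    have hKr : K.val.range ≤ E.toSubalgebra := by
      rintro _ ⟨y, rfl⟩
      exact hKE y.2
    have hKr' : (τ'.symm.toAlgHom.comp K.val).range ≤ E.toSubalgebra := by
      rintro _ ⟨y, rfl⟩
      exact hKE (mem_algebraicClosure_iff.mpr
        ((mem_algebraicClosure_iff.mp y.2).algHom τ'.symm.toAlgHom))
    have hρ₁ : AF.act ρ ≫ q = q := hgen ρ (injective_productMap_of_range_le hρ _ hreg (by
      rw [productMap_range]
      exact sup_le hKr (range_le_of_image_subset hS ι (Set.subset_union_left.trans hE))))
    have hτρ : AF.act (τ * ρ) ≫ q = q := hgen (τ * ρ) (by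
      have h := injective_productMap_of_range_le hρ _ (injective_comp_algEquiv hreg τ'.symm) (by
        rw [← productMap_comp, productMap_range]
        exact sup_le hKr' (range_le_of_image_subset hS _ (Set.subset_union_right.trans hE)))
      have h' := injective_comp_algEquiv h τ'
      have h₀ : τ'.toAlgHom.comp (τ'.symm.toAlgHom.comp (productMap K.val ι)) =
        productMap K.val ι := AlgHom.ext fun b ↦ τ'.apply_symm_apply _
      rw [← productMap_comp, h₀] at h'
      exact h')
    rw [AF.act_mul, Category.assoc, hρ₁] at hτρ
    exact hτρ
  let q' : V ⟶ pullback x (specMap sF) := pullback.lift q (v ≫ baseMap F Ω)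
    (by rw [hqp.w, Category.assoc, ← Spec.map_comp]; rfl)
  have hq₁ : q' ≫ pullback.fst _ _ = q := pullback.lift_fst _ _ _
  have hq₂ : q' ≫ pullback.snd _ _ = v ≫ baseMap F Ω := pullback.lift_snd _ _ _
  refine ⟨_, pullback.snd x (specMap sF), q', ?_, fun τ ↦ ?_⟩
  · refine IsPullback.of_right ?_ hq₂ (IsPullback.of_hasPullback x _)
    rw [hq₁, ← Spec.map_comp]
    exact hqp
  · refine pullback.hom_ext ?_ ?_
    · rw [Category.assoc, hq₁]
      exact hinv τ
    · rw [Category.assoc, hq₂, ← Category.assoc, SemilinearAction.act_over, Category.assoc,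
        ← Spec.map_comp]
      congr 2
      exact CommRingCat.hom_ext (RingHom.ext τ.commutes)

end Specialization

/-! ### Reduction to a finite extension -/

section Descent

variable {k Ω : Type u} [Field k] [Field Ω] [Algebra k Ω] {V X : Scheme.{u}}
  {v : V ⟶ Spec (CommRingCat.of Ω)} {x : X ⟶ Spec (CommRingCat.of k)} {q : V ⟶ X}

theorem surjective_flat_quasiCompact_baseMap :
    (@Surjective ⊓ @Flat ⊓ @QuasiCompact : MorphismProperty Scheme.{u}) (baseMap k Ω) :=
  ⟨⟨inferInstance, inferInstance⟩, inferInstance⟩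

theorem locallyOfFiniteType_of_isPullback (hq : IsPullback q v x (baseMap k Ω))
    [LocallyOfFiniteType v] : LocallyOfFiniteType x :=
  MorphismProperty.of_isPullback_of_descendsAlong (P := @LocallyOfFiniteType)
    (Q := @Surjective ⊓ @Flat ⊓ @QuasiCompact) hq.flip surjective_flat_quasiCompact_baseMap
    inferInstance

theorem compactSpace_of_isPullback (hq : IsPullback q v x (baseMap k Ω)) [CompactSpace V] :
    CompactSpace X :=
  have := surjective_of_isPullback hq
  ⟨by simpa [q.surjective.range_eq] using isCompact_range q.continuous⟩

end Descent

section Tower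

variable {k κ L Ω : Type u} [Field k] [Field κ] [Field L] [Field Ω] [Algebra k κ] [Algebra k Ω]
  [Algebra κ Ω] [Algebra κ L] [Algebra L Ω] [IsScalarTower k κ Ω] [IsScalarTower κ L Ω]
  {V : Scheme.{u}} {v : V ⟶ Spec (CommRingCat.of Ω)}

/-- If `κ` is finite over `k`, a finite extension of `κ` is one of `k`. -/
theorem SemilinearAction.exists_finite_descends_trans (A : SemilinearAction k v) [Module.Finite k κ]
    (h : ∃ F : IntermediateField κ Ω, FiniteDimensional κ F ∧
      ((A.restrict κ).restrict F).Descends) :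
    ∃ F : IntermediateField k Ω, FiniteDimensional k F ∧ (A.restrict F).Descends := by
  obtain ⟨F, hF, X, x, q, hq, hA⟩ := h
  have : Module.Finite k F := Module.Finite.trans κ F
  exact ⟨F.restrictScalars k, this, X, x, q, hq, hA⟩

/-- Descent to a finite extension of `κ` when the action descends to a finitely generated extension
in which `κ` is algebraically closed. -/
theorem exists_finite_descends_of_algebraicallyClosed [CharZero Ω] [IsAlgClosed Ω]
    (htr : Cardinal.aleph0 ≤ Algebra.trdeg κ Ω) [LocallyOfFiniteType v] [CompactSpace V]
    (A : SemilinearAction κ v) [Algebra.EssFiniteType κ L]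
    (hL : ∀ l : L, IsAlgebraic κ l → l ∈ Set.range (algebraMap κ L))
    (hA : (A.restrict L).Descends) :
    ∃ F : IntermediateField κ Ω, FiniteDimensional κ F ∧ (A.restrict F).Descends := by
  obtain ⟨X, x, q, hq, hinv⟩ := hA
  have := locallyOfFiniteType_of_isPullback hq
  have := compactSpace_of_isPullback hq
  obtain ⟨S, hS⟩ := IntermediateField.fg_top_iff.mpr ‹Algebra.EssFiniteType κ L›
  obtain ⟨B, hB, hBx⟩ := hasFGModel_of_locallyOfFiniteType (D := κ) x
  let R := B ⊔ Algebra.adjoin κ (S : Set L)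
  have hR : R.FG := hB.sup (Subalgebra.fg_adjoin_finset S)
  obtain ⟨Y, y, m, hm, _, _⟩ := hBx.mono (C := R) le_sup_left
  have : Algebra.FiniteType κ R := R.fg_iff_finiteType.mp hR
  have : IsNoetherianRing R := Algebra.FiniteType.isNoetherianRing κ R
  have := isNoetherian_of_locallyOfFiniteType y
  let j : L →ₐ[κ] Ω := IsScalarTower.toAlgHom κ L Ω
  let ι : R →ₐ[κ] Ω := j.comp R.val
  have hp : IsPullback (q ≫ m) v y (specMap ι) := by
    have := hq.paste_horiz hm
    rw [← Spec.map_comp] at this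
    exact this
  have hLκ : Algebra.trdeg j.fieldRange Ω = Algebra.trdeg κ Ω := by
    refine trdeg_eq_of_finite ?_ htr
    exact (AlgEquiv.ofInjectiveField j).trdeg_eq.symm.trans_lt (trdeg_lt_aleph0 κ L)
  have hreg := injective_productMap_algebraicClosure ι
    ((algebraMap L Ω).injective.comp Subtype.val_injective) j.fieldRange
    (by rintro _ ⟨a, rfl⟩; exact ⟨a, rfl⟩) (by
      rintro _ ⟨a, rfl⟩ ha
      obtain ⟨b, rfl⟩ := hL a ((isAlgebraic_algHom_iff j j.injective).mp ha)
      exact ⟨b, (j.commutes b).symm⟩) (htr.trans_eq hLκ.symm)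
  refine exists_finite_descends A htr hp (fun σ hσ ↦ ?_) hreg
  -- An automorphism fixing `R` fixes generators of `L`.
  have hfix (l : L) : σ (j l) = j l := by
    have : (σ.toAlgHom.comp j).comp (⊤ : IntermediateField κ L).val =
        j.comp (IntermediateField.val _) :=
      IntermediateField.algHom_ext_of_eq_adjoin _ hS.symm fun a ha ↦
        congr($hσ ⟨a, le_sup_right (a := B) (Algebra.subset_adjoin ha)⟩)
    exact congr($this ⟨l, trivial⟩)
  let σL : Ω ≃ₐ[L] Ω := AlgEquiv.ofRingEquiv (f := σ.toRingEquiv) hfix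
  rw [← Category.assoc]
  exact congrArg (· ≫ m) (hinv σL)

end Tower

/-- An action that descends to a finitely generated extension descends to a finite extension. -/
theorem exists_finite_descends_of_fg {k Ω : Type u} [Field k] [Field Ω] [Algebra k Ω]
    {V : Scheme.{u}} {v : V ⟶ Spec (CommRingCat.of Ω)} (A : SemilinearAction k v)
    [CharZero Ω] [IsAlgClosed Ω] (htr : Cardinal.aleph0 ≤ Algebra.trdeg k Ω)
    [LocallyOfFiniteType v] [CompactSpace V] (L : IntermediateField k Ω) (hL : L.FG)
    (hA : (A.restrict L).Descends) :
    ∃ F : IntermediateField k Ω, FiniteDimensional k F ∧ (A.restrict F).Descends := by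
  have : Algebra.EssFiniteType k L := IntermediateField.essFiniteType_iff.mpr hL
  let κ := algebraicClosure k L
  have hκ : Module.Finite k κ := finite_algebraicClosure
  have : Algebra.EssFiniteType κ L := .of_comp k κ L
  have hκtr : Algebra.trdeg κ Ω = Algebra.trdeg k Ω := trdeg_eq_of_finite
    (trdeg_eq_zero.trans_lt Cardinal.aleph0_pos) htr
  refine A.exists_finite_descends_trans (κ := κ) (exists_finite_descends_of_algebraicallyClosed
    (L := L) (hκtr ▸ htr) (A.restrict κ) (fun l hl ↦ ?_) hA)
  exact ⟨⟨l, mem_algebraicClosure_iff.mpr (hl.restrictScalars k)⟩, rfl⟩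

/-! ### Stable affine open subschemes -/

section Specialize

variable {F Ω : Type u} [Field F] [Field Ω] [Algebra F Ω] {V X : Scheme.{u}}
  {v : V ⟶ Spec (CommRingCat.of Ω)} {x : X ⟶ Spec (CommRingCat.of F)} {q : V ⟶ X}

/-- The residue field of a closed point of `X` is finite over `F`, so that its fibre is finite. -/
theorem finite_preimage_of_isClosed (hq : IsPullback q v x (baseMap F Ω)) [LocallyOfFiniteType x]
    {y : X} (hy : IsClosed {y}) : (q ⁻¹' {y}).Finite := by
  let i := X.fromSpecResidueField y
  have : IsClosedImmersion i := isClosed_singleton_iff_isClosedImmersion.mp hy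
  have : IsFinite (i ≫ x) := isFinite_iff_locallyOfFiniteType_of_jacobsonSpace.mpr inferInstance
  have h : IsPullback (pullback.snd q i) (pullback.fst q i ≫ v) (i ≫ x) (baseMap F Ω) :=
    (IsPullback.of_hasPullback q i).flip.paste_vert hq
  have : IsFinite (pullback.fst q i ≫ v) := MorphismProperty.of_isPullback h inferInstance
  have hfin := Scheme.Hom.finite_preimage_singleton (pullback.fst q i ≫ v)
    (IsLocalRing.closedPoint Ω)
  rw [← Scheme.range_fromSpecResidueField, ← Scheme.Pullback.range_fst, ← Set.image_univ]
  refine Set.Finite.image _ (hfin.subset fun z _ ↦ ?_)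
  exact Subsingleton.elim (α := PrimeSpectrum Ω) _ _

theorem preimage_sup_preimage {Z : Scheme.{u}} {g : V ⟶ Z} {f : Z ⟶ X} (h : g ≫ f = q)
    (U : Z.Opens) (O : X.Opens) : g ⁻¹ᵁ (U ⊔ f ⁻¹ᵁ O) = g ⁻¹ᵁ U ⊔ q ⁻¹ᵁ O := by
  subst h
  rfl

/-- A point `s` of the `F`-algebra `C` with values in `Ω` maps `V` to the base change of `X` to a
subring `B` of `C`, invariantly under the automorphisms that fix `s`. An open subset `W` of this base
change that becomes everything over `C` pulls back to all of `V`. -/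
theorem exists_hom_baseScheme (A : SemilinearAction F v) (hq : IsPullback q v x (baseMap F Ω))
    (haq : ∀ σ, A.act σ ≫ q = q) {B C : Type u} [CommRing B] [CommRing C] [Algebra F B]
    [Algebra F C] [Algebra B C] [IsScalarTower F B C] (s : C →ₐ[F] Ω) :
    ∃ g : V ⟶ baseScheme x B, IsAffineHom g ∧ g ≫ pullback.fst _ _ = q ∧
      (∀ W : (baseScheme x B).Opens,
        pullback.fst (pullback.snd x (baseMap F B)) (baseMap B C) ⁻¹ᵁ W = ⊤ → g ⁻¹ᵁ W = ⊤) ∧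
      ∀ σ : Ω ≃ₐ[F] Ω, (∀ c, σ (s c) = s c) → A.act σ ≫ g = g := by
  let s' : B →ₐ[F] Ω := s.comp (IsScalarTower.toAlgHom F B C)
  have hs' : specMap s' ≫ baseMap F B = baseMap F Ω := by
    rw [← Spec.map_comp, ← CommRingCat.ofHom_comp]
    congr 2
    exact s'.comp_algebraMap
  have hs : specMap s ≫ baseMap B C = specMap s' := (Spec.map_comp _ _).symm
  let g : V ⟶ baseScheme x B := pullback.lift q (v ≫ specMap s')
    (by rw [hq.w, Category.assoc, hs'])
  have hg₁ : g ≫ pullback.fst _ _ = q := pullback.lift_fst _ _ _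
  have hg₂ : g ≫ pullback.snd _ _ = v ≫ specMap s' := pullback.lift_snd _ _ _
  have hg : IsPullback g v (pullback.snd x (baseMap F B)) (specMap s') := by
    refine IsPullback.of_right ?_ hg₂ (IsPullback.of_hasPullback x (baseMap F B))
    rw [hg₁, hs']
    exact hq
  let h : V ⟶ pullback (pullback.snd x (baseMap F B)) (baseMap B C) :=
    pullback.lift g (v ≫ specMap s) (by rw [hg₂, Category.assoc, hs])
  have hh : h ≫ pullback.fst _ _ = g := pullback.lift_fst _ _ _
  refine ⟨g, MorphismProperty.of_isPullback hg.flip inferInstance, hg₁, fun W hW ↦ ?_,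
    fun σ hσ ↦ pullback.hom_ext ?_ ?_⟩
  · rw [← hh, Scheme.Hom.comp_preimage]
    exact congrArg (h ⁻¹ᵁ ·) hW
  · rw [Category.assoc, hg₁, haq]
  · rw [Category.assoc, hg₂, ← Category.assoc, A.act_over, Category.assoc, ← Spec.map_comp,
      ← CommRingCat.ofHom_comp]
    congr 3
    exact RingHom.ext fun b ↦ hσ _

/-- An affine open subset of `V` specializes to one that is defined over a finite extension; it may
be required to still contain a given closed subset defined over `F`. -/
theorem exists_finite_stable_affineOpen [IsAlgClosed Ω] (A : SemilinearAction F v)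
    (hq : IsPullback q v x (baseMap F Ω)) (haq : ∀ σ, A.act σ ≫ q = q) [QuasiCompact x]
    [QuasiSeparated x] {U : V.Opens} (hU : IsAffineOpen U) {O : X.Opens} (hUO : U ⊔ q ⁻¹ᵁ O = ⊤) :
    ∃ F' : IntermediateField F Ω, FiniteDimensional F F' ∧ ∃ U' : V.Opens, IsAffineOpen U' ∧
      U' ⊔ q ⁻¹ᵁ O = ⊤ ∧ ∀ σ : Ω ≃ₐ[F] Ω, (∀ c ∈ F', σ c = c) → A.act σ ⁻¹ᵁ U' = U' := by
  obtain ⟨B, hB, U₁, hU₁, rfl⟩ := exists_affineOpens_of_fg x hq U hU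
  let W := U₁ ⊔ pullback.fst x (baseMap F B) ⁻¹ᵁ O
  have hW : toBaseScheme x hq B ⁻¹ᵁ W = ⊤ :=
    (preimage_sup_preimage (toBaseScheme_fst x hq B) U₁ O).trans hUO
  obtain ⟨C, hC, hCW⟩ := exists_preimage_eq_top_of_fg _ (isPullback_toBaseScheme x hq B) W hW
  have : Algebra.FiniteType F B := B.fg_iff_finiteType.mp hB
  have : Algebra.FiniteType B C := C.fg_iff_finiteType.mp hC
  have : Algebra.FiniteType F C := .trans (S := B) inferInstance inferInstance
  obtain ⟨s, -, hfin⟩ := exists_algHom_apply_ne_zero (κ := F) (Ω := Ω) (one_ne_zero (α := C))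
  have hfield : IsField s.range := by
    have : Algebra.IsIntegral F s.range := inferInstance
    exact isField_of_isIntegral_of_isField' (Field.toIsField F)
  obtain ⟨g, _, hg, hgW, hgσ⟩ := exists_hom_baseScheme A hq haq (B := B) s
  refine ⟨s.range.toIntermediateField' hfield, hfin, g ⁻¹ᵁ U₁, hU₁.preimage g,
    (preimage_sup_preimage hg U₁ O).symm.trans (hgW W hCW), fun σ hσ ↦ ?_⟩
  rw [← Scheme.Hom.comp_preimage, hgσ σ fun c ↦ hσ _ ⟨c, rfl⟩]

end Specialize

section Orbit

variable {k Ω : Type u} [Field k] [Field Ω] [Algebra k Ω] {V : Scheme.{u}}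
  {v : V ⟶ Spec (CommRingCat.of Ω)} (A : SemilinearAction k v)

namespace SemilinearAction

theorem act_mul_apply (σ τ : Ω ≃ₐ[k] Ω) (z : V) : A.act (σ * τ) z = A.act τ (A.act σ z) := by
  rw [A.act_mul]
  rfl

/-- A subset that is stable under the automorphisms over a finite extension `F` has finitely many
translates: they are determined by embeddings of `F` in `Ω`. -/
theorem finite_range_preimage (F : IntermediateField k Ω) [FiniteDimensional k F] (s : Set V)
    (hs : ∀ σ : Ω ≃ₐ[k] Ω, (∀ c ∈ F, σ c = c) → A.act σ ⁻¹' s = s) :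
    (Set.range fun σ ↦ A.act σ ⁻¹' s).Finite := by
  choose g hg using fun y : Set.range (fun σ ↦ A.act σ ⁻¹' s) ↦ y.2
  have : Function.Injective fun y ↦ (g y).toAlgHom.comp F.val := fun y y' h ↦ Subtype.ext <| by
    rw [← hg, ← hg]
    have h₁ : A.act (((g y)⁻¹ * g y')) ⁻¹' s = s := hs _ fun c hc ↦ by
      have := congr($h ⟨c, hc⟩)
      exact ((congrArg (g y).symm this).symm).trans ((g y).symm_apply_apply c)
    have h₂ : g y' = g y * ((g y)⁻¹ * g y') := by group
    rw [h₂]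
    ext z
    simp only [Set.mem_preimage, A.act_mul_apply (g y)]
    exact (iff_of_eq congr($h₁ (A.act (g y) z))).symm
  have := Finite.of_injective _ this
  exact Set.toFinite _

end SemilinearAction

theorem isAffineOpen_finset_inf [V.IsSeparated] {t : Finset V.Opens} (ht : t.Nonempty)
    (h : ∀ U ∈ t, IsAffineOpen U) : IsAffineOpen (t.inf id) := by
  induction ht using Finset.Nonempty.cons_induction with
  | singleton U => simpa using h U (by simp)
  | cons U t hU ht ih =>
    rw [Finset.inf_cons]
    exact (h U (by simp)).inf (ih fun W hW ↦ h W (by simp [hW]))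

/-- If the restriction of the action to the automorphisms over a finite extension of `k` descends to
`X`, then the fibre of a closed point of `X` is contained in a stable affine open subset. -/
theorem exists_stable_affineOpen [CharZero Ω] [IsAlgClosed Ω]
    (htr : Cardinal.aleph0 ≤ Algebra.trdeg k Ω) [V.IsSeparated]
    (hV : ∀ s : Set V, s.Finite → ∃ U : V.Opens, IsAffineOpen U ∧ s ⊆ U)
    (F : IntermediateField k Ω) [FiniteDimensional k F] {X : Scheme.{u}}
    {x : X ⟶ Spec (CommRingCat.of F)} [LocallyOfFiniteType x] [QuasiCompact x] [QuasiSeparated x]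
    {q : V ⟶ X} (hq : IsPullback q v x (baseMap F Ω))
    (haq : ∀ σ : Ω ≃ₐ[F] Ω, (A.restrict F).act σ ≫ q = q) {y : X} (hy : IsClosed {y}) :
    ∃ U : V.Opens, IsAffineOpen U ∧ q ⁻¹' {y} ⊆ U ∧ ∀ σ, A.act σ ⁻¹ᵁ U = U := by
  have htrF : Algebra.trdeg F Ω = Algebra.trdeg k Ω :=
    trdeg_eq_of_finite (trdeg_eq_zero.trans_lt Cardinal.aleph0_pos) htr
  have haq' (σ : Ω ≃ₐ[k] Ω) (hσ : ∀ c ∈ F, σ c = c) : A.act σ ≫ q = q :=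
    haq (AlgEquiv.ofRingEquiv (f := σ.toRingEquiv) fun c ↦ hσ c c.2)
  let T := q ⁻¹' {y}
  have hT : T.Finite := finite_preimage_of_isClosed hq hy
  have hTc : IsClosed T := hy.preimage q.continuous
  -- The orbit of the fibre is finite and, as a closed subset, comes from `X`.
  let S := ⋃ σ, A.act σ ⁻¹' T
  have hSU : S = ⋃₀ Set.range fun σ ↦ A.act σ ⁻¹' T := (Set.sUnion_range _).symm
  have hTS : T ⊆ S := fun z hz ↦ Set.mem_iUnion.mpr ⟨1, by rw [A.act_one]; exact hz⟩
  have hfinT := A.finite_range_preimage F T fun σ hσ ↦ by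
    ext z
    exact iff_of_eq (congrArg (· = y) congr($(haq' σ hσ) z))
  have hS : S.Finite := by
    rw [hSU]
    refine hfinT.sUnion ?_
    rintro _ ⟨σ, rfl⟩
    exact hT.preimage ((A.act σ).isOpenEmbedding.injective.injOn)
  have hSc : IsClosed S := by
    rw [hSU, Set.sUnion_eq_biUnion]
    refine hfinT.isClosed_biUnion ?_
    rintro _ ⟨σ, rfl⟩
    exact hTc.preimage (A.act σ).continuous
  have hSs (σ : Ω ≃ₐ[k] Ω) (z : V) (hz : z ∈ S) : A.act σ z ∈ S := by
    obtain ⟨τ, hτ⟩ := Set.mem_iUnion.mp hz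
    refine Set.mem_iUnion.mpr ⟨σ⁻¹ * τ, ?_⟩
    have : A.act (σ⁻¹ * τ) (A.act σ z) = A.act τ z := by
      rw [← A.act_mul_apply, mul_inv_cancel_left]
    exact (congrArg q this).trans hτ
  obtain ⟨O, hO⟩ := exists_preimage_eq_of_stable hq
    (mem_range_of_forall_algEquiv (htr.trans_eq htrF.symm)) (A.restrict F).act
    (A.restrict F).act_over haq ⟨Sᶜ, hSc.isOpen_compl⟩ fun σ z hz hzS ↦ hz (hSs _ _ hzS)
  have hOS (z : V) : z ∈ q ⁻¹ᵁ O ↔ z ∉ S := by rw [hO]; rfl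
  obtain ⟨U, hU, hSU⟩ := hV S hS
  obtain ⟨F', hF', U', hU', hUO, hUs⟩ := exists_finite_stable_affineOpen (A.restrict F) hq haq hU
    (O := O) (top_le_iff.mp fun z _ ↦ by
      by_cases hz : z ∈ S
      · exact Or.inl (hSU hz)
      · exact Or.inr ((hOS z).mpr hz))
  have hSU' : S ⊆ U' := fun z hz ↦ by
    have : z ∈ U' ⊔ q ⁻¹ᵁ O := hUO ▸ trivial
    exact this.resolve_right fun h ↦ (hOS z).mp h hz
  -- The affine open subset `U'` has finitely many translates, which all contain the orbit.
  have : FiniteDimensional k (F'.restrictScalars k) := Module.Finite.trans (R := k) F F'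
  have hfin := A.finite_range_preimage (F'.restrictScalars k) U' fun σ hσ ↦
    congrArg (fun W : V.Opens ↦ (W : Set V)) (hUs (AlgEquiv.ofRingEquiv (f := σ.toRingEquiv) fun c ↦
      hσ _ (algebraMap F F' c).2) hσ)
  have hfin' : (Set.range fun σ ↦ A.act σ ⁻¹ᵁ U').Finite := by
    refine Set.Finite.of_finite_image (f := fun W : V.Opens ↦ (W : Set V)) ?_
      SetLike.coe_injective.injOn
    rw [← Set.range_comp]
    exact hfin
  have hmem (z : V) : z ∈ hfin'.toFinset.inf id ↔ ∀ σ, A.act σ z ∈ U' := by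
    change z ∈ ((hfin'.toFinset.inf id : V.Opens) : Set V) ↔ _
    rw [TopologicalSpace.Opens.coe_finset_inf]
    simp
  refine ⟨hfin'.toFinset.inf id, isAffineOpen_finset_inf ⟨_, hfin'.mem_toFinset.mpr ⟨1, rfl⟩⟩ ?_,
    fun z hz ↦ (hmem z).mpr fun σ ↦ hSU' (hSs σ z (hTS hz)), fun τ ↦ ?_⟩
  · intro W hW
    obtain ⟨σ, rfl⟩ := hfin'.mem_toFinset.mp hW
    exact hU'.preimage_of_isIso _
  · ext z
    refine (hmem _).trans (Iff.trans ⟨fun h σ ↦ ?_, fun h σ ↦ ?_⟩ (hmem z).symm)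
    · have := h (τ⁻¹ * σ)
      rwa [← A.act_mul_apply, mul_inv_cancel_left] at this
    · rw [← A.act_mul_apply]
      exact h _

end Orbit

/-! ### Descent of affine schemes along a finite extension -/

section Invariants

open TensorProduct

variable {k Ω B : Type u} [Field k] [Field Ω] [Algebra k Ω] [AddCommGroup B] [Module Ω B]
  (ρ : (Ω ≃ₐ[k] Ω) → B →+ B) (hsmul : ∀ σ c b, ρ σ (c • b) = σ c • ρ σ b)

include hsmul in
/-- If the stabilizer of `b` for a semilinear action contains the automorphisms over a finite
extension of `k`, then `b` is a linear combination of invariants, namely of traces of multiples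
of `b`. -/
theorem mem_span_invariant [IsAlgClosed Ω] (htr : Cardinal.aleph0 ≤ Algebra.trdeg k Ω)
    (hmul : ∀ σ τ b, ρ (σ * τ) b = ρ σ (ρ τ b)) (F : IntermediateField k Ω) [FiniteDimensional k F]
    {b : B} (hb : ∀ σ : Ω ≃ₐ[k] Ω, (∀ c ∈ F, σ c = c) → ρ σ b = b) :
    b ∈ Submodule.span Ω {b | ∀ σ, ρ σ b = b} := by
  classical
  have hext (e : F →ₐ[k] Ω) : ∃ σ : Ω ≃ₐ[k] Ω, ∀ c : F, σ c = e c :=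
    exists_algEquiv_apply_eq (trdeg_eq_zero.trans_lt Cardinal.aleph0_pos) htr F.val e
  choose g hg using hext
  have hρ {σ τ : Ω ≃ₐ[k] Ω} (h : ∀ c : F, σ c = τ c) : ρ σ b = ρ τ b := by
    have h₁ : τ = σ * (σ⁻¹ * τ) := by group
    rw [h₁, hmul, hb (σ⁻¹ * τ) fun c hc ↦
      (congrArg σ.symm (h ⟨c, hc⟩)).symm.trans (σ.symm_apply_apply c)]
  let t (c : F) : B := ∑ e : F →ₐ[k] Ω, e c • ρ (g e) b
  have ht (c : F) (τ : Ω ≃ₐ[k] Ω) : ρ τ (t c) = t c := by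
    rw [map_sum]
    refine Fintype.sum_bijective (fun e ↦ τ.toAlgHom.comp e) (Function.bijective_iff_has_inverse.mpr
      ⟨fun e ↦ τ.symm.toAlgHom.comp e, fun e ↦ AlgHom.ext fun c ↦ τ.symm_apply_apply _,
        fun e ↦ AlgHom.ext fun c ↦ τ.apply_symm_apply _⟩) _ _ fun e ↦ ?_
    rw [hsmul, ← hmul, hρ (τ := g (τ.toAlgHom.comp e)) fun c ↦
      (congrArg τ (hg e c)).trans (hg (τ.toAlgHom.comp e) c).symm]
    rfl
  -- By independence of the embeddings of `F` in `Ω`, their value vectors span.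
  let w (c : F) : (F →ₐ[k] Ω) → Ω := fun e ↦ e c
  have hw : Submodule.span Ω (Set.range w) = ⊤ := by
    by_contra hne
    obtain ⟨l, hl0, hl⟩ := Submodule.exists_le_ker_of_lt_top _ (lt_top_iff_ne_top.mpr hne)
    refine hl0 ?_
    have hlw (c : F) : ∑ e : F →ₐ[k] Ω, l (Pi.single e 1) • e.toLinearMap c = 0 := by
      have h₁ : l (w c) = 0 := hl (Submodule.subset_span ⟨c, rfl⟩)
      rw [LinearMap.pi_apply_eq_sum_univ l (w c)] at h₁
      refine Eq.trans (Finset.sum_congr rfl fun e _ ↦ ?_) h₁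
      rw [smul_eq_mul, smul_eq_mul, mul_comm]
      have h₂ : (Pi.single e 1 : (F →ₐ[k] Ω) → Ω) = fun j ↦ if e = j then 1 else 0 :=
        funext fun j ↦ by simp [Pi.single_apply, eq_comm]
      rw [h₂]
      rfl
    have hli := Fintype.linearIndependent_iff.mp (linearIndependent_toLinearMap k F Ω)
      (fun e ↦ l (Pi.single e 1)) (LinearMap.ext fun c ↦ by
        rw [LinearMap.sum_apply]
        exact hlw c)
    exact LinearMap.pi_ext' fun e ↦ LinearMap.ext_ring (hli e)
  let Φ : ((F →ₐ[k] Ω) → Ω) →ₗ[Ω] B := Fintype.linearCombination Ω fun e ↦ ρ (g e) b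
  have hΦ : LinearMap.range Φ ≤ Submodule.span Ω {b | ∀ σ, ρ σ b = b} := by
    rw [LinearMap.range_eq_map, ← hw, Submodule.map_span, Submodule.span_le]
    rintro _ ⟨_, ⟨c, rfl⟩, rfl⟩
    exact Submodule.subset_span (ht c)
  refine hΦ ⟨Pi.single F.val 1, ?_⟩
  rw [Fintype.linearCombination_apply_single, one_smul]
  exact hb _ fun c hc ↦ hg F.val ⟨c, hc⟩

include hsmul in
/-- A semilinear representation spanned by its invariants is the base change of the space of
invariants. -/
theorem isBaseChange_invariant [Module k B] [IsScalarTower k Ω B]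
    (hfix : ∀ y : Ω, (∀ σ : Ω ≃ₐ[k] Ω, σ y = y) → y ∈ Set.range (algebraMap k Ω))
    (hspan : ∀ b, b ∈ Submodule.span Ω {b | ∀ σ, ρ σ b = b}) (M : Submodule k B)
    (hM : ∀ b, b ∈ M ↔ ∀ σ, ρ σ b = b) : IsBaseChange Ω M.subtype := by
  let φ : Ω ⊗[k] M →ₗ[Ω] B := LinearMap.liftBaseChange Ω M.subtype
  have hφ (c : Ω) (m : M) : φ (c ⊗ₜ m) = c • (m : B) := LinearMap.liftBaseChange_tmul ..
  have hinj : LinearMap.ker φ = ⊥ := by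
    refine eq_bot_of_stable Set.univ (fun y hy ↦ hfix y fun σ ↦ hy σ trivial) _
      (fun σ _ n hn ↦ ?_) fun m hm ↦ ?_
    · have h : φ (σ.toLinearMap.rTensor M n) = ρ σ (φ n) := by
        clear hn
        induction n with
        | zero => simp
        | tmul c m =>
          rw [LinearMap.rTensor_tmul, hφ, hφ, hsmul, (hM _).mp m.2]
          rfl
        | add x y hx hy => simp only [map_add, hx, hy]
      rw [LinearMap.mem_ker, h, LinearMap.mem_ker.mp hn, map_zero]
    · rw [LinearMap.mem_ker, hφ, one_smul] at hm
      exact Subtype.ext hm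
  have hsurj : Function.Surjective φ := by
    rw [← LinearMap.range_eq_top, eq_top_iff]
    intro b _
    refine Submodule.span_le.mpr (fun m hm ↦ ?_) (hspan b)
    exact ⟨1 ⊗ₜ ⟨m, (hM m).mpr hm⟩, (hφ _ _).trans (one_smul _ _)⟩
  exact IsBaseChange.of_equiv (LinearEquiv.ofBijective φ ⟨LinearMap.ker_eq_bot.mp hinj, hsurj⟩)
    fun m ↦ (hφ 1 m).trans (one_smul _ _)

end Invariants

section Affine

variable {k Ω : Type u} [Field k] [Field Ω] [Algebra k Ω]

/-- Galois descent for algebras: an `Ω`-algebra with a semilinear action that descends to a finite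
extension `F` of `k` descends to `k`. -/
theorem exists_isPushout_of_finite [CharZero Ω] [IsAlgClosed Ω]
    (htr : Cardinal.aleph0 ≤ Algebra.trdeg k Ω) (F : IntermediateField k Ω) [FiniteDimensional k F]
    {A B : CommRingCat.{u}} {α : CommRingCat.of F ⟶ A} {π : A ⟶ B} {β : CommRingCat.of Ω ⟶ B}
    (h : IsPushout α (CommRingCat.ofHom (algebraMap F Ω)) π β)
    (act : (Ω ≃ₐ[k] Ω) → B →+* B) (hβ : ∀ σ c, act σ (β c) = β (σ c))
    (hmul : ∀ σ τ b, act (σ * τ) b = act σ (act τ b))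
    (hπ : ∀ σ : Ω ≃ₐ[k] Ω, (∀ c ∈ F, σ c = c) → ∀ a, act σ (π a) = π a) :
    ∃ (S : CommRingCat.{u}) (γ : CommRingCat.of k ⟶ S) (i : S ⟶ B),
      IsPushout γ (CommRingCat.ofHom (algebraMap k Ω)) i β ∧ ∀ σ s, act σ (i s) = i s := by
  have htrF : Algebra.trdeg F Ω = Algebra.trdeg k Ω :=
    trdeg_eq_of_finite (trdeg_eq_zero.trans_lt Cardinal.aleph0_pos) htr
  let : Algebra Ω B := β.hom.toAlgebra
  let : Algebra k B := (β.hom.comp (algebraMap k Ω)).toAlgebra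
  have : IsScalarTower k Ω B := .of_algebraMap_eq' rfl
  let ρ (σ : Ω ≃ₐ[k] Ω) : B →+ B := (act σ).toAddMonoidHom
  have hsmul (σ : Ω ≃ₐ[k] Ω) (c : Ω) (b : B) : ρ σ (c • b) = σ c • ρ σ b := by
    rw [Algebra.smul_def, Algebra.smul_def]
    exact (map_mul (act σ) _ _).trans (congrArg (· * _) (hβ σ c))
  have hspan : (⊤ : AddSubmonoid B) ≤ (Submodule.span Ω {b | ∀ σ, ρ σ b = b}).toAddSubmonoid :=
    mem_of_stable_of_isPushout h (mem_range_of_forall_algEquiv (htr.trans_eq htrF.symm))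
      (fun σ ↦ act (σ.restrictScalars k)) (fun σ ↦ hβ _)
      (fun σ ↦ hπ (σ.restrictScalars k) fun c hc ↦ σ.commutes ⟨c, hc⟩) _ _
      (fun _ _ _ ↦ trivial)
      (fun c b hb ↦ by
        have := Submodule.smul_mem _ c hb
        rwa [Algebra.smul_def] at this)
      (fun _ _ _ ↦ trivial)
      fun a _ ↦ mem_span_invariant ρ hsmul htr hmul F fun σ hσ ↦ hπ σ hσ a
  let S : Subalgebra k B :=
    { carrier := {b | ∀ σ, act σ b = b}
      mul_mem' := fun ha hb σ ↦ by rw [map_mul, ha, hb]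
      add_mem' := fun ha hb σ ↦ by rw [map_add, ha, hb]
      algebraMap_mem' := fun c σ ↦ (hβ σ _).trans (congrArg β (σ.commutes c)) }
  have hS : IsBaseChange Ω (Subalgebra.toSubmodule S).subtype :=
    isBaseChange_invariant ρ hsmul (mem_range_of_forall_algEquiv htr) (fun b ↦ hspan trivial) _
      fun b ↦ Iff.rfl
  have : Algebra.IsPushout k Ω S B := ⟨hS⟩
  exact ⟨.of S, CommRingCat.ofHom (algebraMap k S), CommRingCat.ofHom (algebraMap S B),
    (CommRingCat.isPushout_iff_isPushout.mpr this).flip, fun σ s ↦ s.2 σ⟩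

variable {V : Scheme.{u}} {v : V ⟶ Spec (CommRingCat.of Ω)} (A : SemilinearAction k v)

theorem scalars_top {R : CommRingCat.{u}} {X : Scheme.{u}} (x : X ⟶ Spec R) :
    scalars x ⊤ = coordHom x := by
  rw [scalars, coordHom, Scheme.Hom.appTop, Scheme.Hom.app_eq_appLE]
  rfl

/-- An action on an affine scheme descends if its restriction to the automorphisms over a finite
extension of `k` does. -/
theorem SemilinearAction.descends_of_isAffine [CharZero Ω] [IsAlgClosed Ω]
    (htr : Cardinal.aleph0 ≤ Algebra.trdeg k Ω) [IsAffine V] [LocallyOfFiniteType v]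
    (F : IntermediateField k Ω) [FiniteDimensional k F] (hF : (A.restrict F).Descends) :
    A.Descends := by
  obtain ⟨X, x, q, hq, hA⟩ := hF
  have := compactSpace_of_isPullback hq
  have := locallyOfFiniteType_of_isPullback hq
  have := isNoetherian_of_locallyOfFiniteType x
  have hpo : IsPushout (coordHom x) (CommRingCat.ofHom (algebraMap F Ω)) q.appTop
      (coordHom v) := by
    rw [← scalars_top, ← scalars_top]
    exact isPushout_sections hq isCompact_univ isQuasiSeparated_univ
  have hcoord (σ : Ω ≃ₐ[k] Ω) :
      coordHom v ≫ (A.act σ).appTop = CommRingCat.ofHom (σ : Ω →+* Ω) ≫ coordHom v := by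
    rw [← coordHom_comp, ← A.act_over, coordHom, coordHom, Category.assoc, Scheme.Hom.comp_appTop]
  obtain ⟨S, γ, i, hS, hi⟩ := exists_isPushout_of_finite htr F hpo
    (fun σ ↦ (A.act σ).appTop.hom) (fun σ c ↦ congr($(hcoord σ) c)) (fun σ τ b ↦ by
      rw [A.act_mul, Scheme.Hom.comp_appTop]
      rfl) fun σ hσ a ↦ by
      have : A.act σ ≫ q = q := hA (AlgEquiv.ofRingEquiv (f := σ.toRingEquiv) fun c ↦ hσ c c.2)
      have h₁ : q.appTop ≫ (A.act σ).appTop = q.appTop := by rw [← Scheme.Hom.comp_appTop, this]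
      exact congr($h₁ a)
  have hv : V.isoSpec.hom ≫ Spec.map (coordHom v) = v := toSpecΓ_coordHom v
  refine ⟨Spec S, Spec.map γ, V.isoSpec.hom ≫ Spec.map i, ?_, fun σ ↦ ?_⟩
  · refine (isPullback_SpecMap_of_isPushout _ _ _ _ hS).of_iso V.isoSpec.symm (Iso.refl _)
      (Iso.refl _) (Iso.refl _) ?_ ?_ ?_ ?_
    · exact (Category.comp_id _).trans (Iso.inv_hom_id_assoc _ _).symm
    · refine (Category.comp_id _).trans ?_
      exact (Iso.eq_inv_comp _).mpr hv
    · exact (Category.comp_id _).trans (Category.id_comp _).symm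
    · exact (Category.comp_id _).trans (Category.id_comp _).symm
  · have h₁ : i ≫ (A.act σ).appTop = i := CommRingCat.hom_ext (RingHom.ext (hi σ))
    rw [← Category.assoc, ← Scheme.isoSpec_hom_naturality, Category.assoc, ← Spec.map_comp, h₁]

end Affine

/-! ### Descent along a finite extension -/

section Pair

variable {k Ω : Type u} [Field k] [Field Ω] [Algebra k Ω] {V U W P : Scheme.{u}}
  {v : V ⟶ Spec (CommRingCat.of Ω)} (A : SemilinearAction k v) {i : U ⟶ V} {j : W ⟶ V}
  [IsOpenImmersion i] [IsOpenImmersion j] {A₁ : SemilinearAction k (i ≫ v)}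
  {A₂ : SemilinearAction k (j ≫ v)}

include A in
omit [IsOpenImmersion i] [IsOpenImmersion j] in
/-- The intersection of two stable open subschemes is stable, hence comes from an open subscheme of
a model of the first. -/
theorem exists_preimage_eq_overlap
    (hfix : ∀ y : Ω, (∀ σ : Ω ≃ₐ[k] Ω, σ y = y) → y ∈ Set.range (algebraMap k Ω))
    (h₁ : ∀ σ, A₁.act σ ≫ i = i ≫ A.act σ) (h₂ : ∀ σ, A₂.act σ ≫ j = j ≫ A.act σ)
    {l : P ⟶ U} {m : P ⟶ W} (hP : IsPullback l m i j) [IsOpenImmersion l] {X : Scheme.{u}}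
    {x : X ⟶ Spec (CommRingCat.of k)} {q : U ⟶ X} (hq : IsPullback q (i ≫ v) x (baseMap k Ω))
    (hA : ∀ σ, A₁.act σ ≫ q = q) : ∃ O : X.Opens, q ⁻¹ᵁ O = l.opensRange := by
  refine exists_preimage_eq_of_stable hq hfix A₁.act A₁.act_over hA _ fun σ u hu ↦ ?_
  obtain ⟨p, hp⟩ := hu
  have h₃ : i u = j (A₂.act σ⁻¹ (m p)) := by
    have h₄ : A.act σ (i u) = j (m p) := by
      have e₁ := congr($(h₁ σ) u)
      have e₂ := congr($(hP.w) p)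
      rw [Scheme.Hom.comp_apply, Scheme.Hom.comp_apply] at e₁ e₂
      rw [← e₁, ← e₂, hp]
    have e₃ := congr($(h₂ σ⁻¹) (m p))
    rw [Scheme.Hom.comp_apply, Scheme.Hom.comp_apply, ← h₄, ← A.act_mul_apply, mul_inv_cancel,
      A.act_one] at e₃
    exact e₃.symm
  obtain ⟨z, hz, -⟩ := Scheme.Pullback.exists_preimage_pullback u _ h₃
  refine ⟨hP.isoPullback.inv z, ?_⟩
  rw [← Scheme.Hom.comp_apply, hP.isoPullback_inv_fst]
  exact hz

/-- Descent can be checked on the members of a stable open cover. -/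
theorem SemilinearAction.descends_of_pair {v₁ : U ⟶ Spec (CommRingCat.of Ω)}
    {v₂ : W ⟶ Spec (CommRingCat.of Ω)} {A₁ : SemilinearAction k v₁} {A₂ : SemilinearAction k v₂}
    (hv₁ : v₁ = i ≫ v) (hv₂ : v₂ = j ≫ v) (h : i.opensRange ⊔ j.opensRange = ⊤)
    (hfix : ∀ y : Ω, (∀ σ : Ω ≃ₐ[k] Ω, σ y = y) → y ∈ Set.range (algebraMap k Ω))
    (h₁ : ∀ σ, A₁.act σ ≫ i = i ≫ A.act σ) (h₂ : ∀ σ, A₂.act σ ≫ j = j ≫ A.act σ)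
    (hA₁ : A₁.Descends) (hA₂ : A₂.Descends) : A.Descends := by
  subst hv₁ hv₂
  obtain ⟨X₁, x₁, q₁, hq₁, hA₁⟩ := hA₁
  obtain ⟨X₂, x₂, q₂, hq₂, hA₂⟩ := hA₂
  let l := pullback.fst i j
  let m := pullback.snd i j
  have hP : IsPullback l m i j := .of_hasPullback i j
  obtain ⟨O₁, hO₁⟩ := exists_preimage_eq_overlap A hfix h₁ h₂ hP hq₁ hA₁
  obtain ⟨O₂, hO₂⟩ := exists_preimage_eq_overlap A hfix h₂ h₁ hP.flip hq₂ hA₂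
  obtain ⟨r₁, hr₁⟩ := exists_isPullback_opens_lift (l := l) q₁ O₁ hO₁
  obtain ⟨r₂, hr₂⟩ := exists_isPullback_opens_lift (l := m) q₂ O₂ hO₂
  have hr₁' := isPullback_overlap hq₁ hr₁
  have hr₂' := isPullback_overlap hq₂ hr₂
  let a (σ : Ω ≃ₐ[k] Ω) := hP.lift (l ≫ A₁.act σ) (m ≫ A₂.act σ) (by
    rw [Category.assoc, h₁, Category.assoc, h₂, hP.w_assoc])
  have hal (σ) : a σ ≫ l = l ≫ A₁.act σ := hP.lift_fst _ _ _
  have ham (σ) : a σ ≫ m = m ≫ A₂.act σ := hP.lift_snd _ _ _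
  have har₁ (σ) : a σ ≫ r₁ = r₁ := by
    rw [← cancel_mono O₁.ι, Category.assoc, hr₁.w, ← Category.assoc, hal, Category.assoc, hA₁]
  have har₂ (σ) : a σ ≫ r₂ = r₂ := by
    rw [← cancel_mono O₂.ι, Category.assoc, hr₂.w, ← Category.assoc, ham, Category.assoc, hA₂]
  obtain ⟨f, hf⟩ := exists_comp_eq_of_invariant hr₁' hfix a (fun σ ↦ by
    rw [← Category.assoc, hal, Category.assoc, A₁.act_over]
    simp only [Category.assoc]) har₁ r₂ har₂
  obtain ⟨g, hg⟩ := exists_comp_eq_of_invariant hr₂' hfix a (fun σ ↦ by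
    rw [← Category.assoc, ham, Category.assoc, A₂.act_over]
    simp only [Category.assoc]) har₂ r₁ har₁
  have hepi {X : Scheme.{u}} {x : X ⟶ Spec (CommRingCat.of k)} {r : pullback i j ⟶ X}
      {z : pullback i j ⟶ Spec (CommRingCat.of Ω)} (hr : IsPullback r z x (baseMap k Ω)) : Epi r :=
    have := flat_of_isPullback hr
    have := surjective_of_isPullback hr
    Flat.epi_of_flat_of_surjective _
  -- The identifications `f` and `g` of the two models of the overlap are inverse to each other, since
  -- the projections to these models are epimorphisms.
  have := hepi hr₁'
  have := hepi hr₂'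
  have : IsIso f := ⟨g, by rw [← cancel_epi r₁, ← Category.assoc, hf, hg, Category.comp_id],
    by rw [← cancel_epi r₂, ← Category.assoc, hg, hf, Category.comp_id]⟩
  obtain ⟨Y, y, q, j₁, j₂, _, _, hq, -, -, -, hq₁', hq₂'⟩ := exists_isPullback_of_pair i j h v
    hq₁ hq₂ hP O₁.ι (f ≫ O₂.ι) (by
      have e₁ := hr₁'.w
      have e₂ := hr₂'.w
      rw [← hf, Category.assoc, ← Category.assoc f, ← hP.w_assoc] at e₂
      exact (cancel_epi r₁).mp (e₁.trans e₂.symm)) r₁ hr₁.w (by rw [← Category.assoc, hf, hr₂.w])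
    (preimage_opensRange_le hP hr₁) (by
      rw [Scheme.Hom.opensRange_comp_of_isIso]
      exact preimage_opensRange_le hP.flip hr₂)
  refine ⟨Y, y, q, hq, fun σ ↦ hom_ext_of_pair i j h ?_ ?_⟩
  · rw [← Category.assoc, ← h₁, Category.assoc, hq₁', ← Category.assoc, hA₁]
  · rw [← Category.assoc, ← h₂, Category.assoc, hq₂', ← Category.assoc, hA₂]

end Pair

section Opens

variable {k Ω : Type u} [Field k] [Field Ω] [Algebra k Ω] {V : Scheme.{u}}
  {v : V ⟶ Spec (CommRingCat.of Ω)} (A : SemilinearAction k v)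

/-- The action on a stable open subscheme. -/
def SemilinearAction.onOpens (U : V.Opens) (hU : ∀ σ, A.act σ ⁻¹ᵁ U = U) :
    SemilinearAction k (U.ι ≫ v) where
  act σ := (A.act σ).resLE U U (hU σ).ge
  act_over σ := by
    rw [← Category.assoc, Scheme.Hom.resLE_comp_ι, Category.assoc, A.act_over, Category.assoc]
  act_mul σ τ := by
    rw [← cancel_mono U.ι, Scheme.Hom.resLE_comp_ι, Category.assoc, Scheme.Hom.resLE_comp_ι,
      Scheme.Hom.resLE_comp_ι_assoc, A.act_mul]
  act_one := by
    rw [← cancel_mono U.ι, Scheme.Hom.resLE_comp_ι, A.act_one, Category.comp_id, Category.id_comp]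

theorem SemilinearAction.onOpens_act_ι (U : V.Opens) (hU : ∀ σ, A.act σ ⁻¹ᵁ U = U)
    (σ : Ω ≃ₐ[k] Ω) : (A.onOpens U hU).act σ ≫ U.ι = U.ι ≫ A.act σ :=
  Scheme.Hom.resLE_comp_ι _ _

theorem SemilinearAction.Descends.onOpens
    (hfix : ∀ y : Ω, (∀ σ : Ω ≃ₐ[k] Ω, σ y = y) → y ∈ Set.range (algebraMap k Ω))
    (hA : A.Descends) (U : V.Opens) (hU : ∀ σ, A.act σ ⁻¹ᵁ U = U) :
    (A.onOpens U hU).Descends := by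
  obtain ⟨X, x, q, hq, hA⟩ := hA
  obtain ⟨O, hO⟩ := exists_preimage_eq_of_stable hq hfix A.act A.act_over hA U fun σ ↦ (hU σ).le
  obtain ⟨r, hr⟩ := exists_isPullback_opens_lift (l := U.ι) q O
    (by rw [hO, Scheme.Opens.opensRange_ι])
  refine ⟨O, O.ι ≫ x, r, hr.paste_vert hq, fun σ ↦ ?_⟩
  rw [← cancel_mono O.ι, Category.assoc, hr.w, ← Category.assoc, A.onOpens_act_ι, Category.assoc,
    hA]

theorem SemilinearAction.Descends.sup
    (hfix : ∀ y : Ω, (∀ σ : Ω ≃ₐ[k] Ω, σ y = y) → y ∈ Set.range (algebraMap k Ω))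
    {U W : V.Opens} {hU : ∀ σ, A.act σ ⁻¹ᵁ U = U} {hW : ∀ σ, A.act σ ⁻¹ᵁ W = W}
    (hAU : (A.onOpens U hU).Descends) (hAW : (A.onOpens W hW).Descends)
    (hUW : ∀ σ, A.act σ ⁻¹ᵁ (U ⊔ W) = U ⊔ W) : (A.onOpens (U ⊔ W) hUW).Descends := by
  refine SemilinearAction.descends_of_pair _ (i := V.homOfLE (le_sup_left : U ≤ U ⊔ W))
    (j := V.homOfLE (le_sup_right : W ≤ U ⊔ W)) (by rw [Scheme.homOfLE_ι_assoc])
    (by rw [Scheme.homOfLE_ι_assoc]) ?_ hfix (fun σ ↦ ?_) (fun σ ↦ ?_) hAU hAW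
  · rw [eq_top_iff]
    rintro ⟨t, ht⟩ -
    obtain ht' | ht' := ht
    · exact Or.inl ⟨⟨t, ht'⟩, Subtype.ext (by simp)⟩
    · exact Or.inr ⟨⟨t, ht'⟩, Subtype.ext (by simp)⟩
  · rw [← cancel_mono (U ⊔ W).ι, Category.assoc, Scheme.homOfLE_ι, A.onOpens_act_ι, Category.assoc,
      A.onOpens_act_ι, Scheme.homOfLE_ι_assoc]
  · rw [← cancel_mono (U ⊔ W).ι, Category.assoc, Scheme.homOfLE_ι, A.onOpens_act_ι, Category.assoc,
      A.onOpens_act_ι, Scheme.homOfLE_ι_assoc]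

theorem SemilinearAction.Descends.of_onOpens_top (hU : ∀ σ, A.act σ ⁻¹ᵁ ⊤ = ⊤)
    (h : (A.onOpens ⊤ hU).Descends) : A.Descends := by
  obtain ⟨X, x, q, hq, hA⟩ := h
  refine ⟨X, x, V.topIso.inv ≫ q, hq.of_iso V.topIso (Iso.refl _) (Iso.refl _) (Iso.refl _)
    (by simp) (by simp) (by simp) (by simp), fun σ ↦ ?_⟩
  have e : A.act σ = V.topIso.inv ≫ (A.onOpens ⊤ hU).act σ ≫ V.topIso.hom :=
    (Iso.eq_inv_comp _).mpr (A.onOpens_act_ι ⊤ hU σ).symm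
  rw [e, Category.assoc, Category.assoc, Iso.hom_inv_id_assoc, hA]

variable [CharZero Ω] [IsAlgClosed Ω]

theorem SemilinearAction.onOpens_descends_of_isAffineOpen
    (htr : Cardinal.aleph0 ≤ Algebra.trdeg k Ω) [LocallyOfFiniteType v] (F : IntermediateField k Ω)
    [FiniteDimensional k F] (hF : (A.restrict F).Descends) {U : V.Opens} (hUa : IsAffineOpen U)
    (hU : ∀ σ, A.act σ ⁻¹ᵁ U = U) : (A.onOpens U hU).Descends := by
  have : IsAffine U := hUa
  have htrF : Algebra.trdeg F Ω = Algebra.trdeg k Ω :=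
    trdeg_eq_of_finite (trdeg_eq_zero.trans_lt Cardinal.aleph0_pos) htr
  exact (A.onOpens U hU).descends_of_isAffine htr F
    (hF.onOpens _ (mem_range_of_forall_algEquiv (htrF ▸ htr)) U fun σ ↦ hU _)

/-- If every finite set of points of `V` is contained in an affine open subset, an action
descends to `k` if it descends to a finite extension. -/
theorem SemilinearAction.descends_of_finite
    (htr : Cardinal.aleph0 ≤ Algebra.trdeg k Ω) [V.IsSeparated] [CompactSpace V]
    [LocallyOfFiniteType v]
    (hV : ∀ s : Set V, s.Finite → ∃ U : V.Opens, IsAffineOpen U ∧ s ⊆ U)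
    (F : IntermediateField k Ω) [FiniteDimensional k F] (hF : (A.restrict F).Descends) :
    A.Descends := by
  have hF' := hF
  obtain ⟨X, x, q, hq, hA⟩ := hF
  have htrF : Algebra.trdeg F Ω = Algebra.trdeg k Ω :=
    trdeg_eq_of_finite (trdeg_eq_zero.trans_lt Cardinal.aleph0_pos) htr
  have := compactSpace_of_isPullback hq
  have := locallyOfFiniteType_of_isPullback hq
  have := isNoetherian_of_locallyOfFiniteType x
  let G (U : V.Opens) : Prop := ∃ hU : ∀ σ, A.act σ ⁻¹ᵁ U = U, (A.onOpens U hU).Descends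
  have hG {U : V.Opens} (hUa : IsAffineOpen U) (hU : ∀ σ, A.act σ ⁻¹ᵁ U = U) : G U :=
    ⟨hU, A.onOpens_descends_of_isAffineOpen htr F hF' hUa hU⟩
  obtain ⟨U, ⟨hU, hAU⟩, hU'⟩ : ∃ U, G U ∧ Set.univ ⊆ (U : Set V) := by
    refine isCompact_univ.induction_on (p := fun s ↦ ∃ U, G U ∧ s ⊆ (U : Set V)) ?_ ?_ ?_ ?_
    · exact ⟨⊥, hG (isAffineOpen_bot V) fun σ ↦ rfl, Set.empty_subset _⟩
    · exact fun s t hst ⟨U, hU, ht⟩ ↦ ⟨U, hU, hst.trans ht⟩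
    · rintro s t ⟨U, ⟨hU, hAU⟩, hs⟩ ⟨W, ⟨hW, hAW⟩, ht⟩
      have hUW (σ) : A.act σ ⁻¹ᵁ (U ⊔ W) = U ⊔ W := by rw [Scheme.Hom.preimage_sup, hU, hW]
      exact ⟨U ⊔ W, ⟨hUW, .sup A (mem_range_of_forall_algEquiv htr) hAU hAW hUW⟩,
        Set.union_subset_union hs ht⟩
    · intro z _
      -- A stable open subset that contains the fibre of a closed specialization of `q z` also
      -- contains `z`, since it is the preimage of an open subset of `X`.
      obtain ⟨y, hyz, hy⟩ := (isClosed_closure (s := {q z})).exists_closed_singleton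
        (Set.singleton_nonempty _).closure
      obtain ⟨U, hUa, hyU, hU⟩ := exists_stable_affineOpen A htr hV F hq hA hy
      obtain ⟨O, hO⟩ := exists_preimage_eq_of_stable hq
        (mem_range_of_forall_algEquiv (htrF ▸ htr)) (A.restrict F).act (A.restrict F).act_over hA U
        fun σ ↦ (hU _).le
      have hyO : y ∈ O := by
        have := surjective_of_isPullback hq
        obtain ⟨w, hw⟩ := q.surjective y
        have hwU : w ∈ U := hyU hw
        rw [← hO] at hwU
        exact hw ▸ hwU
      have hzU : z ∈ U := by
        rw [← hO]
        exact (specializes_iff_mem_closure.mpr hyz).mem_open O.2 hyO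
      exact ⟨U, mem_nhdsWithin_of_mem_nhds (U.2.mem_nhds hzU), U, hG hUa hU, subset_rfl⟩
  obtain rfl : U = ⊤ := top_le_iff.mp fun z hz ↦ hU' hz
  exact .of_onOpens_top A hU hAU

end Opens

/-! ### Finite subsets of quasiprojective schemes -/

section Proj

variable {K A : Type u} [Field K] [CommRing A] [Algebra K A] (𝒜 : ℕ → Submodule K A)
  [GradedAlgebra 𝒜]

/-- The sets `D₊(f)` with `f` homogeneous of positive degree form a basis of the topology of `Proj`. -/
theorem exists_homogeneous_notMem {O : (Proj 𝒜).Opens} {t : Proj 𝒜} (ht : t ∈ O) :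
    ∃ (d : ℕ) (f : A), 0 < d ∧ f ∈ 𝒜 d ∧ t ∈ Proj.basicOpen 𝒜 f ∧ Proj.basicOpen 𝒜 f ≤ O := by
  obtain ⟨_, ⟨_, ⟨g, rfl⟩, rfl⟩, htg, hgO⟩ :=
    (Proj.isBasis_basicOpen 𝒜).exists_subset_of_mem_open ht O.2
  have key (g : A) (hg : t ∈ Proj.basicOpen 𝒜 g) :
      ∃ i, t ∈ Proj.basicOpen 𝒜 (GradedRing.proj 𝒜 i g) := by
    rwa [Proj.basicOpen_eq_iSup_proj, TopologicalSpace.Opens.mem_iSup] at hg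
  obtain ⟨d, hd⟩ := key g htg
  obtain ⟨h, hh, hht⟩ := SetLike.not_le_iff_exists.mp t.not_irrelevant_le
  obtain ⟨e, he⟩ := key h ((Proj.mem_basicOpen 𝒜 _ _).mpr hht)
  have he0 : e ≠ 0 := by
    rintro rfl
    rw [HomogeneousIdeal.mem_irrelevant_iff] at hh
    rw [hh] at he
    simp at he
  refine ⟨d + e, GradedRing.proj 𝒜 d g * GradedRing.proj 𝒜 e h, by lia,
    SetLike.mul_mem_graded (SetLike.coe_mem _) (SetLike.coe_mem _), ?_, ?_⟩
  · rw [Proj.basicOpen_mul]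
    exact ⟨hd, he⟩
  · rw [Proj.basicOpen_mul]
    refine inf_le_left.trans (le_trans ?_ hgO)
    rw [Proj.basicOpen_eq_iSup_proj 𝒜 g]
    exact le_iSup (fun i ↦ Proj.basicOpen 𝒜 (GradedRing.proj 𝒜 i g)) d

/-- A finite set of points of an open subset `O` of `Proj 𝒜` lies in an affine open subset of `O`:
among the homogeneous elements of a suitable degree that vanish outside `O`, those that vanish at
one of the points form finitely many proper subspaces. -/
theorem exists_isAffineOpen_of_finite [Infinite K] {O : (Proj 𝒜).Opens} {s : Set (Proj 𝒜)}
    (hs : s.Finite) (hsO : s ⊆ O) : ∃ U : (Proj 𝒜).Opens, IsAffineOpen U ∧ s ⊆ U ∧ U ≤ O := by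
  choose d f hd hf hfs hfO using fun t : s ↦ exists_homogeneous_notMem 𝒜 (hsO t.2)
  have := hs.to_subtype
  have := Fintype.ofFinite s
  let N := ∏ t, d t
  have hN : 0 < N := Finset.prod_pos fun t _ ↦ hd t
  -- The elements of degree `N` that vanish outside `O`; a power of each `f t` is one of them.
  let W : Submodule K A := 𝒜 N ⊓ ⨅ z : {z : Proj 𝒜 // z ∉ O},
    (z.1.asHomogeneousIdeal.toIdeal.restrictScalars K)
  let p (t : s) : Submodule K W :=
    (t.1.asHomogeneousIdeal.toIdeal.restrictScalars K).comap W.subtype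
  have hp (t : s) : p t ≠ ⊤ := by
    obtain ⟨e, he⟩ : d t ∣ N := Finset.dvd_prod_of_mem d (Finset.mem_univ t)
    have he' : e ≠ 0 := by rintro rfl; simp [he] at hN
    intro h
    have hW : f t ^ e ∈ W := by
      refine ⟨?_, (Submodule.mem_iInf _).mpr fun z ↦ ?_⟩
      · have := SetLike.pow_mem_graded e (hf t)
        rwa [he, mul_comm, ← smul_eq_mul]
      · have hz : ¬ z.1 ∈ Proj.basicOpen 𝒜 (f t) := fun h ↦ z.2 (hfO t h)
        rw [Proj.mem_basicOpen, not_not] at hz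
        exact Ideal.pow_mem_of_mem _ hz _ (Nat.pos_of_ne_zero he')
    have h' : (⟨_, hW⟩ : W) ∈ p t := h ▸ Submodule.mem_top
    exact (Proj.mem_basicOpen 𝒜 _ _).mp (hfs t) (t.1.isPrime.mem_of_pow_mem _ h')
  obtain ⟨g, hg⟩ : ∃ g : W, ∀ t, g ∉ p t := by
    by_contra! h
    obtain ⟨t, ht⟩ := Subspace.exists_eq_top_of_iUnion_eq_univ (p := p)
      (Set.eq_univ_of_forall fun g ↦ Set.mem_iUnion.mpr (h g))
    exact hp t ht
  refine ⟨Proj.basicOpen 𝒜 g.1, Proj.isAffineOpen_basicOpen 𝒜 g.1 g.2.1 hN,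
    fun t ht ↦ (Proj.mem_basicOpen 𝒜 _ _).mpr (hg ⟨t, ht⟩), fun z hz ↦ ?_⟩
  by_contra hzO
  exact (Proj.mem_basicOpen 𝒜 _ _).mp hz ((Submodule.mem_iInf _).mp g.2.2 ⟨z, hzO⟩)

end Proj

/-- A scheme inherits the property that finite sets of points lie in affine open subsets from a scheme
of which it is a locally closed subscheme, provided these subsets can be taken inside a given open
neighbourhood of the points. -/
theorem exists_isAffineOpen_of_isImmersion {X Y : Scheme.{u}} (i : X ⟶ Y) [IsImmersion i]
    (hY : ∀ (O : Y.Opens) (s : Set Y), s.Finite → s ⊆ O →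
      ∃ U : Y.Opens, IsAffineOpen U ∧ s ⊆ U ∧ U ≤ O) (s : Set X) (hs : s.Finite) :
    ∃ U : X.Opens, IsAffineOpen U ∧ s ⊆ U := by
  have hi (x : X) : i x ∈ i.coborderRange := by
    have e := congr($(i.liftCoborder_ι) x)
    rw [Scheme.Hom.comp_apply] at e
    exact e ▸ (i.liftCoborder x).2
  obtain ⟨U, hU, hsU, hUO⟩ := hY i.coborderRange (i '' s) (hs.image i)
    (Set.image_subset_iff.mpr fun x _ ↦ hi x)
  refine ⟨i.liftCoborder ⁻¹ᵁ i.coborderRange.ι ⁻¹ᵁ U,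
    (hU.preimage_of_isOpenImmersion _ (by rwa [Scheme.Opens.opensRange_ι])).preimage _, ?_⟩
  rw [← Scheme.Hom.comp_preimage, i.liftCoborder_ι]
  exact fun x hx ↦ hsU ⟨x, hx, rfl⟩

variable {K : Type u} [Field K] [Infinite K] {X : Over (Spec (CommRingCat.of K))}

theorem IsQuasiprojective.exists_isAffineOpen (hX : IsQuasiprojective X) (s : Set X.left)
    (hs : s.Finite) : ∃ U : X.left.Opens, IsAffineOpen U ∧ s ⊆ U := by
  obtain ⟨n, i, hi⟩ := hX
  let : GradedAlgebra (MvPolynomial.homogeneousSubmodule (Fin (n + 1)) K) :=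
    MvPolynomial.gradedAlgebra
  exact exists_isAffineOpen_of_isImmersion (Y := (projectiveSpace K n).left) i.left
    (fun O s hs hsO ↦ exists_isAffineOpen_of_finite _ hs hsO) s hs

omit [Infinite K] in
theorem IsQuasiprojective.isSeparated (hX : IsQuasiprojective X) : X.left.IsSeparated := by
  obtain ⟨n, i, hi⟩ := hX
  let : GradedAlgebra (MvPolynomial.homogeneousSubmodule (Fin (n + 1)) K) :=
    MvPolynomial.gradedAlgebra
  have : (projectiveSpace K n).left.IsSeparated :=
    inferInstanceAs (Proj (MvPolynomial.homogeneousSubmodule (Fin (n + 1)) K)).IsSeparated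
  refine ⟨?_⟩
  rw [← terminal.comp_from i.left]
  infer_instance

/-! ### Models are varieties -/

theorem isReduced_of_flat_of_surjective {X Y : Scheme.{u}} (f : X ⟶ Y) [Flat f] [Surjective f]
    [IsReduced X] : IsReduced Y := by
  have (y : Y) : _root_.IsReduced (Y.presheaf.stalk y) := by
    obtain ⟨x, rfl⟩ := f.surjective y
    have hf : (f.stalkMap x).hom.Flat := Flat.stalkMap f x
    algebraize [(f.stalkMap x).hom]
    have : IsLocalHom (algebraMap (Y.presheaf.stalk (f x)) (X.presheaf.stalk x)) :=
      inferInstanceAs (IsLocalHom (f.stalkMap x).hom)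
    have : Module.FaithfullyFlat (Y.presheaf.stalk (f x)) (X.presheaf.stalk x) :=
      .of_flat_of_isLocalHom
    exact isReduced_of_injective _ (FaithfulSMul.algebraMap_injective
      (Y.presheaf.stalk (f x)) (X.presheaf.stalk x))
  exact isReduced_of_isReduced_stalk Y

/-- Two extensions of a field embed into a common one. -/
theorem exists_compositum (k K Ω : Type u) [Field k] [Field K] [Field Ω] [Algebra k K]
    [Algebra k Ω] : ∃ (K' : Type u) (_ : Field K') (_ : Algebra K K') (_ : Algebra Ω K'),
      (algebraMap K K').comp (algebraMap k K) = (algebraMap Ω K').comp (algebraMap k Ω) := by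
  obtain ⟨M, hM⟩ := Ideal.exists_maximal (TensorProduct k K Ω)
  refine ⟨TensorProduct k K Ω ⧸ M, Ideal.Quotient.field M,
    ((Ideal.Quotient.mk M).comp Algebra.TensorProduct.includeLeftRingHom).toAlgebra,
    ((Ideal.Quotient.mk M).comp Algebra.TensorProduct.includeRight.toRingHom).toAlgebra,
    RingHom.ext fun c ↦ congrArg (Ideal.Quotient.mk M) ?_⟩
  exact (Algebra.TensorProduct.includeLeft (R := k) (S := k) (A := K) (B := Ω)).commutes c |>.trans
    (Algebra.TensorProduct.includeRight.commutes c).symm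

variable {k Ω : Type u} [Field k] [Field Ω] [Algebra k Ω] {V X : Scheme.{u}}
  {v : V ⟶ Spec (CommRingCat.of Ω)} {x : X ⟶ Spec (CommRingCat.of k)} {q : V ⟶ X}

/-- Geometric reducedness descends along an extension of fields. -/
theorem geometricallyReduced_of_isPullback (hq : IsPullback q v x (baseMap k Ω))
    [GeometricallyReduced v] : GeometricallyReduced x := by
  refine ⟨geometrically_iff_of_commRing.mpr fun K _ _ Y y₁ y₂ hY ↦ ?_⟩
  obtain ⟨K', _, _, _, hK'⟩ := exists_compositum k K Ω
  have hab : baseMap K K' ≫ baseMap k K = baseMap Ω K' ≫ baseMap k Ω := by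
    rw [← Spec.map_comp, ← Spec.map_comp, ← CommRingCat.ofHom_comp, ← CommRingCat.ofHom_comp, hK']
  have hZ := IsPullback.of_hasPullback y₂ (baseMap K K')
  have hZX := hZ.paste_horiz hY
  rw [hab] at hZX
  have := GeometricallyReduced.geometrically_isReduced (f := v) _ _ _ (IsPullback.of_right
    (t := hq) (h₁₁ := hq.lift _ _ (hZX.w.trans (Category.assoc _ _ _).symm))
    (by rwa [hq.lift_fst]) (hq.lift_snd _ _ _))
  have := flat_of_isPullback hZ
  have := surjective_of_isPullback hZ
  exact isReduced_of_flat_of_surjective (pullback.fst y₂ (baseMap K K'))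

/-! ### Descent systems as semilinear actions -/

section Translation

variable {k Ω : Type u} [Field k] [Field Ω] [Algebra k Ω] {V : Over (Spec (CommRingCat.of Ω))}

theorem baseChangeComp_proj {A B C : Type u} [CommRing A] [CommRing B] [CommRing C]
    (φ : A →+* B) (ψ : B →+* C) (χ : A →+* C) (h : ψ.comp φ = χ)
    (X : Over (Spec (CommRingCat.of A))) :
    (baseChangeComp φ ψ χ h X).hom.left ≫ baseChangeProj χ X =
      baseChangeProj ψ (baseChange φ X) ≫ baseChangeProj φ X :=
  toBaseChange_proj _ _ _ _ _

namespace DescentSystem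

variable (D : DescentSystem k V)

/-- The automorphism of the scheme `V` over `Spec σ` corresponding to `f_σ⁻¹ : V ⟶ σV`. -/
def act (σ : Ω ≃ₐ[k] Ω) : V.left ⟶ V.left :=
  (D.iso σ).inv.left ≫ baseChangeProj (σ : Ω →+* Ω) V

theorem act_mul (σ τ : Ω ≃ₐ[k] Ω) : D.act (σ * τ) = D.act σ ≫ D.act τ := by
  have h : (D.iso (σ * τ)).inv = (D.iso σ).inv ≫ baseChangeMap (σ : Ω →+* Ω) (D.iso τ).inv ≫
      (baseChangeComp (τ : Ω →+* Ω) (σ : Ω →+* Ω) _ (comp_eq_mul σ τ) V).hom := by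
    have h₁ := congrArg Iso.inv (D.iso_mul σ τ)
    rw [Iso.trans_inv, Iso.trans_inv, Iso.comp_inv_eq] at h₁
    rw [h₁, Category.assoc]
    rfl
  rw [act, h, Over.comp_left, Over.comp_left, Category.assoc, Category.assoc, baseChangeComp_proj,
    ← Category.assoc (baseChangeMap _ _).left, baseChangeMap_proj, act, act, Category.assoc,
    Category.assoc]

theorem act_one : D.act 1 = 𝟙 V.left := by
  have h₀ : IsIso (Spec.map (CommRingCat.ofHom ((1 : Ω ≃ₐ[k] Ω) : Ω →+* Ω))) := by
    change IsIso (Spec.map (𝟙 (CommRingCat.of Ω)))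
    infer_instance
  have h₁ : IsIso (baseChangeProj ((1 : Ω ≃ₐ[k] Ω) : Ω →+* Ω) V) :=
    inferInstanceAs (IsIso (pullback.fst _ _))
  have h₂ : IsIso (D.iso 1).inv.left :=
    inferInstanceAs (IsIso ((Over.forget _).map (D.iso 1).inv))
  have h₃ : IsIso (D.act 1) := IsIso.comp_isIso
  have h := D.act_mul 1 1
  rw [mul_one] at h
  rw [← cancel_epi (D.act 1), ← h, Category.comp_id]

/-- The semilinear action defined by a descent system. -/
def action : SemilinearAction k V.hom where
  act := D.act
  act_over σ := by
    rw [act, Category.assoc, (baseChange_isPullback (σ : Ω →+* Ω) V).w, ← Category.assoc,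
      Over.w (D.iso σ).inv]
  act_mul := D.act_mul
  act_one := D.act_one

end DescentSystem

/-- The projection of `V` to a model. -/
def Model.proj (M : Model k V) : V.left ⟶ M.obj.left :=
  M.iso.inv.left ≫ baseChangeProj (algebraMap k Ω) M.obj

theorem Model.isPullback (M : Model k V) : IsPullback M.proj V.hom M.obj.hom (baseMap k Ω) :=
  (baseChange_isPullback (algebraMap k Ω) M.obj).of_iso ((Over.forget _).mapIso M.iso) (Iso.refl _)
    (Iso.refl _) (Iso.refl _) (by simp [Model.proj, ← Over.comp_left_assoc]) (by simp) (by simp)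
    (by simp)

/-- A model splits a descent system if and only if the projection of `V` to the model is invariant
under the corresponding action. -/
theorem Model.splits_iff (M : Model k V) (D : DescentSystem k V) :
    M.Splits D ↔ ∀ σ, D.act σ ≫ M.proj = M.proj := by
  refine forall_congr' fun σ ↦ ?_
  have e₁ : ((D.iso σ).hom ≫ M.iso.inv).left ≫ baseChangeProj (algebraMap k Ω) M.obj =
      (D.iso σ).hom.left ≫ M.proj := by
    rw [Over.comp_left, Category.assoc, Model.proj]
  have e₂ : (baseChangeMap (σ : Ω →+* Ω) M.iso.inv ≫ (conjBaseChange σ M.obj).hom).left ≫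
      baseChangeProj (algebraMap k Ω) M.obj = baseChangeProj (σ : Ω →+* Ω) V ≫ M.proj := by
    rw [Over.comp_left, Category.assoc, conjBaseChange, baseChangeComp_proj, ← Category.assoc,
      baseChangeMap_proj, Category.assoc, Model.proj]
  have e₃ : D.act σ ≫ M.proj = M.proj ↔
      (D.iso σ).hom.left ≫ M.proj = baseChangeProj (σ : Ω →+* Ω) V ≫ M.proj := by
    rw [DescentSystem.act, Category.assoc]
    exact (Iso.inv_comp_eq ((Over.forget _).mapIso (D.iso σ))).trans eq_comm
  rw [e₃, ← e₁, ← e₂]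
  refine ⟨fun h ↦ ?_, fun h ↦ Iso.ext ?_⟩
  · rw [h]
    simp only [Iso.trans_hom, Category.assoc, Iso.hom_inv_id, Category.comp_id]
    rfl
  · rw [← cancel_mono M.iso.inv]
    simp only [Iso.trans_hom, Category.assoc, Iso.hom_inv_id, Category.comp_id]
    exact baseChange_hom_ext _ _ h

theorem DescentSystem.IsEffective.descends {D : DescentSystem k V} (h : D.IsEffective) :
    D.action.Descends := by
  obtain ⟨M, hM⟩ := h
  exact ⟨M.obj.left, M.obj.hom, M.proj, M.isPullback, (M.splits_iff D).mp hM⟩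

theorem DescentSystem.isEffective_of_descends {D : DescentSystem k V} (hV : IsVariety V)
    (h : D.action.Descends) : D.IsEffective := by
  obtain ⟨X, x, q, hq, hA⟩ := h
  have := hV.locallyOfFiniteType
  have := hV.quasiCompact
  have := hV.geometricallyReduced
  have : CompactSpace V.left := QuasiCompact.compactSpace_of_compactSpace V.hom
  have := compactSpace_of_isPullback hq
  have := locallyOfFiniteType_of_isPullback hq
  have := isNoetherian_of_locallyOfFiniteType x
  let M : Model k V :=
    { obj := Over.mk x
      isVariety := ⟨geometricallyReduced_of_isPullback hq, ‹_›, inferInstanceAs (QuasiCompact x)⟩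
      iso := Over.isoMk hq.isoPullback.symm hq.isoPullback_inv_snd }
  have hM : M.proj = q := hq.isoPullback_hom_fst
  exact ⟨M, (M.splits_iff D).mpr fun σ ↦ by rw [hM]; exact hA σ⟩

end Translation

end WeilDescent

end

theorem theorem1p1 {k Ω : Type u} [Field k] [Field Ω] [CharZero Ω] [IsAlgClosed Ω] [Algebra k Ω]
    (htr : Cardinal.aleph0 ≤ Algebra.trdeg k Ω)
    (V : CategoryTheory.Over (AlgebraicGeometry.Spec (CommRingCat.of Ω)))
    (hV : WeilDescent.IsVariety V) (hVq : WeilDescent.IsQuasiprojective V)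
    (D : WeilDescent.DescentSystem k V)
    (h : ∃ L : IntermediateField k Ω, L.FG ∧ (D.restrict L).IsEffective) :
    D.IsEffective := by
  obtain ⟨L, hL, hD⟩ := h
  have := hV.locallyOfFiniteType
  have := hV.quasiCompact
  have : CompactSpace V.left := AlgebraicGeometry.QuasiCompact.compactSpace_of_compactSpace V.hom
  have := hVq.isSeparated
  obtain ⟨F, _, hF⟩ :=
    WeilDescent.exists_finite_descends_of_fg D.action htr L hL hD.descends
  exact WeilDescent.DescentSystem.isEffective_of_descends hV
    (D.action.descends_of_finite htr (fun s hs ↦ hVq.exists_isAffineOpen s hs) F hF)
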